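/- **Setting.** Let $(X,\Theta)$ be a 3-dimensional oriented Poisson manifold (Hausdorff, $\sigma$-compact, without boundary) and let $(\mathcal G,\omega)\rightrightarrows X$ be a local symplectic groupoid of $(X,\Theta)$: a local Lie groupoid, with source $s$, target $t$, units $i:X\to\mathcal G$ and a multiplication $m$ that is defined on an open neighbourhood $\mathcal G_m$ of the units in $\{(\beta,\alpha): s(\beta)=t(\alpha)\}$ (containing all $(\alpha,i(s(\alpha)))$, $(i(t(\alpha)),\alpha)$, $(\alpha,\alpha^{-1})$, $(\alpha^{-1},\alpha)$), with a symplectic form $\omega$ such that the graph of $m$ is Lagrangian in $\overline{\mathcal G}\times\mathcal G\times\mathcal G$ and $s$ is a Poisson map. (Symplectic groupoids are the case in which every pair with $s(\beta)=t(\alpha)$ lies in $\mathcal G_m$.) Suppose that $\omega=d\vartheta$ for a smooth 1-form $\vartheta$ on $\mathcal G$. A bisection $\Sigma\subset\mathcal G$ is given by the smooth map $\Sigma_s=(s|_\Sigma)^{-1}:X\to\mathcal G$, and $l_\Sigma=t\circ\Sigma_s$ is a diffeomorphism of $X$. The product $\Sigma\circ\Lambda$ is the bisection with $(\Sigma\circ\Lambda)_s(x)=m\big(\Sigma_s(l_\Lambda(x)),\Lambda_s(x)\big)$,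 if all these products are defined. Put $F^s(\Sigma)=\Sigma_s^*\omega$, $\vartheta(A)=\vartheta_\Sigma=\Sigma_s^*\vartheta$, and for $K\subseteq X$ compact $$S_K(\Sigma)=\int_K\vartheta_\Sigma\wedge F^s(\Sigma),$$ so that $S_X(\Sigma)=\int_X\vartheta(A)\wedge F^s$ is the action when $X$ is compact. **1. Equations of motion.** For every bisection $\Sigma$ the following are equivalent: (a) the action is stationary at $\Sigma$: for every smooth family of bisections $(\Sigma_\epsilon)_{\epsilon\in\mathbb R}$ with $\Sigma_0=\Sigma$ that agrees with $\Sigma$ over $X\setminus K$ for a compact $K$, the derivative $\frac{d}{d\epsilon}S_K(\Sigma_\epsilon)\big|_{\epsilon=0}$ exists and vanishes; (b) the same holds for the variations $\Sigma_\epsilon=\Sigma\circ\delta\Sigma_\epsilon$, where $(\delta\Sigma_\epsilon)_{\epsilon\in\mathbb R}$ is any smooth family of bisections which starts at the bisection of units for $\epsilon=0$, agrees with it over $X\setminus K$ for a compact $K$, and for which all products $\Sigma\circ\delta\Sigma_\epsilon$ are defined; (c) $F^s(\Sigma)=0$; (d) $\Sigma$ is a Lagrangian bisection, i.e. a Lagrangian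 submanifold of $(\mathcal G,\omega)$. **2. Gauge invariance.** Let $\Sigma$ be a bisection and $\Lambda$ a Lagrangian bisection for which $\Sigma\circ\Lambda$ is defined. Then $F^s(\Sigma\circ\Lambda)=l_\Lambda^*F^s(\Sigma)$, and $\vartheta_{\Sigma\circ\Lambda}-l_\Lambda^*\vartheta_\Sigma$ is closed. If moreover $l_\Lambda$ preserves the orientation of $X$, then the action is invariant up to a boundary term: for every compact $K\subseteq X$, $$S_K(\Sigma\circ\Lambda)=S_{l_\Lambda(K)}(\Sigma)+\int_K d\big(l_\Lambda^*\vartheta_\Sigma\wedge\vartheta_{\Sigma\circ\Lambda}\big),$$ and $S_K(\Sigma\circ\Lambda)=S_K(\Sigma)$ for every compact $K\subseteq X$ such that $\Lambda$ agrees with the bisection of units over $X\setminus K$. In particular, if $X$ is compact, $S_X(\Sigma\circ\Lambda)=S_X(\Sigma)$. -/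

import Mathlib

open scoped Manifold ContDiff Topology

namespace PoissonCS

noncomputable section

/-! ## Differential forms on manifolds without boundary -/

section Forms

variable (E : Type*) [NormedAddCommGroup E] [NormedSpace ℝ E]
variable (M : Type*) [TopologicalSpace M] [ChartedSpace E M]

/-- (Not necessarily smooth) real-valued differential `k`-forms on a manifold modelled on `E`. -/
abbrev Form (k : ℕ) : Type _ :=
  ∀ x : M, (TangentSpace 𝓘(ℝ, E) x) [⋀^Fin k]→L[ℝ] ℝ

variable {E M}
variable {E' : Type*} [NormedAddCommGroup E'] [NormedSpace ℝ E']
variable {N : Type*} [TopologicalSpace N] [ChartedSpace E' N]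

/-- The pullback `f^* η` of a form along a map `f : M → N`. -/
def pullback {k : ℕ} (f : M → N) (η : Form E' N k) : Form E M k := fun x =>
  (η (f x)).compContinuousLinearMap (mfderiv 𝓘(ℝ, E) 𝓘(ℝ, E') f x)

/-- The form `η` read in the preferred chart around `c`: the pullback of `η` along the inverse of
that chart, a form on the target of the chart. -/
def chartRep {k : ℕ} (c : M) (η : Form E M k) : E → E [⋀^Fin k]→L[ℝ] ℝ := fun y =>
  (η ((extChartAt 𝓘(ℝ, E) c).symm y)).compContinuousLinearMap
    (mfderiv 𝓘(ℝ, E) 𝓘(ℝ, E) (extChartAt 𝓘(ℝ, E) c).symm y)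

/-- Smoothness of a form: its representatives in charts are smooth. -/
def IsSmoothForm {k : ℕ} (η : Form E M k) : Prop :=
  ∀ c : M, ContDiffOn ℝ ∞ (chartRep c η) (extChartAt 𝓘(ℝ, E) c).target

/-- The exterior derivative, computed at `x` in the preferred chart around `x`. -/
def extd {k : ℕ} (η : Form E M k) : Form E M (k + 1) := fun x =>
  (extDeriv (chartRep x η) (extChartAt 𝓘(ℝ, E) x x)).compContinuousLinearMap
    (mfderiv 𝓘(ℝ, E) 𝓘(ℝ, E) (extChartAt 𝓘(ℝ, E) x) x)

/-- Wedge product of an alternating 1-form and an alternating `k`-form: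
`(a ∧ b)(v₀, …, v_k) = ∑ᵢ (-1)^i a(vᵢ) b(v₀, …, v̂ᵢ, …, v_k)`. -/
def wedgeAlt {k : ℕ} (a : E [⋀^Fin 1]→L[ℝ] ℝ) (b : E [⋀^Fin k]→L[ℝ] ℝ) :
    E [⋀^Fin (k + 1)]→L[ℝ] ℝ :=
  ContinuousAlternatingMap.alternatizeUncurryFin
    (((ContinuousAlternatingMap.ofSubsingleton ℝ E ℝ (0 : Fin 1)).symm a).smulRight b)

/-- Wedge product of a 1-form and a `k`-form on a manifold. -/
def wedge {k : ℕ} (a : Form E M 1) (b : Form E M k) : Form E M (k + 1) := fun x =>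
  wedgeAlt (E := E) (a x) (b x)

end Forms

/-! ## Integration of 3-forms over oriented 3-manifolds -/

/-- The model space of 3-manifolds. -/
abbrev E3 : Type := EuclideanSpace ℝ (Fin 3)

section Integration

variable (X : Type*) [TopologicalSpace X] [ChartedSpace E3 X]

/-- The atlas of `X` is oriented: all transition maps have positive Jacobian determinant. -/
class OrientedAtlas : Prop where
  det_pos : ∀ e ∈ atlas E3 X, ∀ e' ∈ atlas E3 X, ∀ y ∈ (e.symm.trans e').source,
    0 < (fderiv ℝ (e.symm.trans e') y).det

variable {X}

/-- A map `f : X → X` preserves the orientation given by the atlas: its Jacobian determinant, in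
the preferred charts around `x` and `f x`, is positive at every point `x`. -/
def OrientationPreserving (f : X → X) : Prop :=
  ∀ x : X, 0 < ContinuousLinearMap.det
    (show E3 →L[ℝ] E3 from mfderiv 𝓘(ℝ, E3) 𝓘(ℝ, E3) f x)

variable (X) in
/-- A smooth partition of unity subordinate to the cover of `X` by the domains of the preferred
charts. -/
def chartPartition [IsManifold 𝓘(ℝ, E3) ∞ X] [T2Space X] [SigmaCompactSpace X] :
    SmoothPartitionOfUnity X 𝓘(ℝ, E3) X Set.univ :=
  (SmoothPartitionOfUnity.exists_isSubordinate_chartAt_source 𝓘(ℝ, E3) X).choose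

/-- The integral `∫_K η` of a 3-form over a subset `K` of the oriented 3-manifold `X`, by means of
a partition of unity (it is used for compact `K`, for which only finitely many summands are
nonzero). -/
def formIntegral [IsManifold 𝓘(ℝ, E3) ∞ X] [T2Space X] [SigmaCompactSpace X]
    (K : Set X) (η : Form E3 X 3) : ℝ :=
  ∑ᶠ c : X, ∫ y in (extChartAt 𝓘(ℝ, E3) c).target ∩ (extChartAt 𝓘(ℝ, E3) c).symm ⁻¹' K,
    chartPartition X c ((extChartAt 𝓘(ℝ, E3) c).symm y) *
      chartRep c η y (fun i => EuclideanSpace.single i (1 : ℝ))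

end Integration

/-! ## Poisson structures, local symplectic groupoids -/

section Groupoids

/-- A Poisson structure on a manifold: a Poisson bracket on its algebra of smooth functions. -/
structure PoissonStructure (X : Type*) [TopologicalSpace X] [ChartedSpace E3 X] where
  /-- the Poisson bracket -/
  bracket : C^∞⟮𝓘(ℝ, E3), X; ℝ⟯ →ₗ[ℝ] C^∞⟮𝓘(ℝ, E3), X; ℝ⟯ →ₗ[ℝ] C^∞⟮𝓘(ℝ, E3), X; ℝ⟯
  bracket_self : ∀ f, bracket f f = 0
  leibniz : ∀ f g h, bracket f (g * h) = bracket f g * h + g * bracket f h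
  jacobi : ∀ f g h,
    bracket f (bracket g h) + bracket g (bracket h f) + bracket h (bracket f g) = 0

variable (X : Type*) [TopologicalSpace X] [ChartedSpace E3 X]
variable (F : Type*) [NormedAddCommGroup F] [NormedSpace ℝ F]
variable (G : Type*) [TopologicalSpace G] [ChartedSpace F G]

/-- A local Lie groupoid `G ⇉ X`. The multiplication is defined on `composable`, an open
neighbourhood of the units in the set of pairs `(β, α)` with `src β = tgt α`; the values of `mul`
elsewhere are irrelevant. Lie groupoids are the case in which every such pair is composable. -/
structure LocalLieGroupoid where
  /-- source -/
  src : G → X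
  /-- target -/
  tgt : G → X
  /-- inclusion of the units -/
  unit : X → G
  /-- inversion -/
  inv : Diffeomorph 𝓘(ℝ, F) 𝓘(ℝ, F) G G ∞
  /-- the domain of the multiplication -/
  composable : Set (G × G)
  /-- multiplication -/
  mul : G → G → G
  contMDiff_src : ContMDiff 𝓘(ℝ, F) 𝓘(ℝ, E3) ∞ src
  contMDiff_tgt : ContMDiff 𝓘(ℝ, F) 𝓘(ℝ, E3) ∞ tgt
  contMDiff_unit : ContMDiff 𝓘(ℝ, E3) 𝓘(ℝ, F) ∞ unit
  submersion_src : ∀ α, Function.Surjective (mfderiv 𝓘(ℝ, F) 𝓘(ℝ, E3) src α)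
  submersion_tgt : ∀ α, Function.Surjective (mfderiv 𝓘(ℝ, F) 𝓘(ℝ, E3) tgt α)
  composable_open : ∃ U : Set (G × G), IsOpen U ∧
    composable = U ∩ {p | src p.1 = tgt p.2}
  contMDiffOn_mul : ContMDiffOn (𝓘(ℝ, F).prod 𝓘(ℝ, F)) 𝓘(ℝ, F) ∞
    (fun p : G × G => mul p.1 p.2) composable
  src_unit : ∀ x, src (unit x) = x
  tgt_unit : ∀ x, tgt (unit x) = x
  src_mul : ∀ β α, (β, α) ∈ composable → src (mul β α) = src α
  tgt_mul : ∀ β α, (β, α) ∈ composable → tgt (mul β α) = tgt β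
  composable_src : ∀ α, (α, unit (src α)) ∈ composable
  composable_tgt : ∀ α, (unit (tgt α), α) ∈ composable
  mul_unit : ∀ α, mul α (unit (src α)) = α
  unit_mul : ∀ α, mul (unit (tgt α)) α = α
  composable_inv : ∀ α, (α, inv α) ∈ composable
  inv_composable : ∀ α, (inv α, α) ∈ composable
  mul_inv : ∀ α, mul α (inv α) = unit (tgt α)
  inv_mul : ∀ α, mul (inv α) α = unit (src α)
  mul_assoc : ∀ γ β α, (β, α) ∈ composable → (γ, mul β α) ∈ composable →
    (γ, β) ∈ composable → (mul γ β, α) ∈ composable →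
    mul γ (mul β α) = mul (mul γ β) α

variable {X F G}

namespace LocalLieGroupoid

variable (𝒢 : LocalLieGroupoid X F G)

/-- The tangent map of the multiplication at `(β, α)`. It is meaningful on pairs `(v, w)` that are
tangent to the domain of the multiplication, i.e. `T src v = T tgt w`. -/
def tmul (β α : G) (v : TangentSpace 𝓘(ℝ, F) β) (w : TangentSpace 𝓘(ℝ, F) α) :
    TangentSpace 𝓘(ℝ, F) (𝒢.mul β α) :=
  mfderivWithin (𝓘(ℝ, F).prod 𝓘(ℝ, F)) 𝓘(ℝ, F) (fun p : G × G => 𝒢.mul p.1 p.2)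
    𝒢.composable (β, α) (v, w)

/-- `T src v = T tgt w`: the pair `(v, w)` is tangent to the set of composable pairs.
(Tangent spaces of `X` at the equal points `src β` and `tgt α` are identified with the model
space through the same preferred chart.) -/
def TangentComposable (β α : G) (v : TangentSpace 𝓘(ℝ, F) β) (w : TangentSpace 𝓘(ℝ, F) α) : Prop :=
  (show E3 from mfderiv 𝓘(ℝ, F) 𝓘(ℝ, E3) 𝒢.src β v) =
    (show E3 from mfderiv 𝓘(ℝ, F) 𝓘(ℝ, E3) 𝒢.tgt α w)

end LocalLieGroupoid

/-- A local symplectic groupoid `(G, ω) ⇉ X` of the Poisson manifold `(X, Θ)`: a local Lie groupoid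
with a symplectic form `ω` such that the graph of the multiplication is Lagrangian in
`(G × G × G, -ω ⊕ ω ⊕ ω)`, and such that the source is a Poisson map. -/
structure LocalSymplecticGroupoid (Θ : PoissonStructure X) extends LocalLieGroupoid X F G where
  /-- the symplectic form -/
  symp : Form F G 2
  smooth_symp : IsSmoothForm symp
  closed_symp : extd symp = 0
  nondegenerate_symp : ∀ (α : G) (u : TangentSpace 𝓘(ℝ, F) α), (∀ v, symp α ![u, v] = 0) → u = 0
  /-- The tangent space of the graph, the set of all `(T mul (v, w), v, w)`, is equal to its own
  orthogonal. -/
  graph_lagrangian : ∀ β α : G, (β, α) ∈ composable →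
    ∀ (u : TangentSpace 𝓘(ℝ, F) (mul β α)) (v : TangentSpace 𝓘(ℝ, F) β)
      (w : TangentSpace 𝓘(ℝ, F) α),
    (toLocalLieGroupoid.TangentComposable β α v w ∧ u = toLocalLieGroupoid.tmul β α v w) ↔
      ∀ (v' : TangentSpace 𝓘(ℝ, F) β) (w' : TangentSpace 𝓘(ℝ, F) α),
        toLocalLieGroupoid.TangentComposable β α v' w' →
        - symp (mul β α) ![u, toLocalLieGroupoid.tmul β α v' w'] + symp β ![v, v'] + symp α ![w, w'] = 0
  /-- `{f ∘ src, g ∘ src}_ω = {f, g} ∘ src`, where `{φ, ψ}_ω = ω(v, u)` for the vectors `u`, `v`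
  with `ω(u, ·) = dφ`, `ω(v, ·) = dψ` (so that `{q, p} = 1` for `ω = dp ∧ dq`). -/
  source_poisson : ∀ (f g : C^∞⟮𝓘(ℝ, E3), X; ℝ⟯) (α : G) (u v : TangentSpace 𝓘(ℝ, F) α),
    (∀ w, symp α ![u, w] = mvfderiv 𝓘(ℝ, F) (fun γ => f (src γ)) α w) →
    (∀ w, symp α ![v, w] = mvfderiv 𝓘(ℝ, F) (fun γ => g (src γ)) α w) →
    Θ.bracket f g (src α) = symp α ![v, u]

/-! ## Bisections -/

/-- A bisection `Σ` of `G ⇉ X`, given by the section `Σ_s = (src|_Σ)⁻¹ : X → G` of the source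
whose image it is. As both `src|_Σ` and `tgt|_Σ` are diffeomorphisms onto `X`, the induced map
`l_Σ = tgt ∘ Σ_s` is a diffeomorphism of `X`. -/
structure Bisection (𝒢 : LocalLieGroupoid X F G) where
  /-- the map `Σ_s` -/
  sec : X → G
  /-- the diffeomorphism `l_Σ` -/
  l : Diffeomorph 𝓘(ℝ, E3) 𝓘(ℝ, E3) X X ∞
  contMDiff_sec : ContMDiff 𝓘(ℝ, E3) 𝓘(ℝ, F) ∞ sec
  src_sec : ∀ x, 𝒢.src (sec x) = x
  tgt_sec : ∀ x, 𝒢.tgt (sec x) = l x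

namespace Bisection

/-- The bisection of units. -/
def one (𝒢 : LocalLieGroupoid X F G) : Bisection 𝒢 where
  sec := 𝒢.unit
  l := Diffeomorph.refl 𝓘(ℝ, E3) X ∞
  contMDiff_sec := 𝒢.contMDiff_unit
  src_sec := 𝒢.src_unit
  tgt_sec := fun x => by simpa using 𝒢.tgt_unit x

variable {𝒢 : LocalLieGroupoid X F G}

/-- The product `Σ ∘ Λ` is defined: all the products of arrows that occur in it are. In a Lie
groupoid this is always the case. -/
def Composable (σ Λ : Bisection 𝒢) : Prop :=
  ∀ x, (σ.sec (Λ.l x), Λ.sec x) ∈ 𝒢.composable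

/-- The product `Σ ∘ Λ` of bisections, i.e. the right action of `Λ` on `Σ`. -/
def mul (σ Λ : Bisection 𝒢) (h : Composable σ Λ) : Bisection 𝒢 where
  sec := fun x => 𝒢.mul (σ.sec (Λ.l x)) (Λ.sec x)
  l := Λ.l.trans σ.l
  contMDiff_sec :=
    𝒢.contMDiffOn_mul.comp_contMDiff
      ((σ.contMDiff_sec.comp Λ.l.contMDiff_toFun).prodMk Λ.contMDiff_sec) h
  src_sec := fun x => (𝒢.src_mul _ _ (h x)).trans (Λ.src_sec x)
  tgt_sec := fun x => (𝒢.tgt_mul _ _ (h x)).trans (σ.tgt_sec (Λ.l x))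

/-- `fam` is a smooth one-parameter family of bisections which is `σ` at parameter `0`, and which
does not depend on the parameter outside of `K`. -/
structure IsVariation (σ : Bisection 𝒢) (fam : ℝ → Bisection 𝒢) (K : Set X) : Prop where
  smooth : ContMDiff (𝓘(ℝ, ℝ).prod 𝓘(ℝ, E3)) 𝓘(ℝ, F) ∞ (fun p : ℝ × X => (fam p.1).sec p.2)
  zero : ∀ x, (fam 0).sec x = σ.sec x
  eq_off : ∀ ε, ∀ x ∉ K, (fam ε).sec x = σ.sec x

end Bisection

end Groupoids

/-! ## The Poisson Chern–Simons action -/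

section Action

variable {X : Type*} [TopologicalSpace X] [ChartedSpace E3 X]
variable {F : Type*} [NormedAddCommGroup F] [NormedSpace ℝ F]
variable {G : Type*} [TopologicalSpace G] [ChartedSpace F G]
variable {Θ : PoissonStructure X} (𝒢 : LocalSymplecticGroupoid (F := F) (G := G) Θ)

/-- Bisections of a local symplectic groupoid. -/
abbrev LocalSymplecticGroupoid.Bisec : Type _ := Bisection 𝒢.toLocalLieGroupoid

/-- `Σ` is a Lagrangian submanifold: every tangent space of `Σ`, the range of `T Σ_s`, is equal to
its own symplectic orthogonal. -/
def IsLagrangian (σ : 𝒢.Bisec) : Prop :=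
  ∀ (x : X) (u : TangentSpace 𝓘(ℝ, F) (σ.sec x)),
    (∃ v, mfderiv 𝓘(ℝ, E3) 𝓘(ℝ, F) σ.sec x v = u) ↔
      ∀ v, 𝒢.symp (σ.sec x) ![u, mfderiv 𝓘(ℝ, E3) 𝓘(ℝ, F) σ.sec x v] = 0

/-- The covariant field strength `F^s = Σ_s^* ω`. -/
def fieldStrength (σ : 𝒢.Bisec) : Form E3 X 2 := pullback σ.sec 𝒢.symp

/-- `ϑ(A) = Σ_s^* ϑ`. -/
def potential (ϑ : Form F G 1) (σ : 𝒢.Bisec) : Form E3 X 1 := pullback σ.sec ϑ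

/-- The Chern–Simons density `ϑ(A) ∧ F^s`. -/
def density (ϑ : Form F G 1) (σ : 𝒢.Bisec) : Form E3 X 3 :=
  wedge (potential 𝒢 ϑ σ) (fieldStrength 𝒢 σ)

variable [IsManifold 𝓘(ℝ, E3) ∞ X] [T2Space X] [SigmaCompactSpace X]

/-- The action `S_K(Σ) = ∫_K ϑ(A) ∧ F^s` over the region `K`. -/
def action (ϑ : Form F G 1) (K : Set X) (σ : 𝒢.Bisec) : ℝ := formIntegral K (density 𝒢 ϑ σ)

/-- `Σ` solves the equations of motion: the action is stationary at `Σ` under all smooth variations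
of `Σ` with compact support. -/
def IsCritical (ϑ : Form F G 1) (σ : 𝒢.Bisec) : Prop :=
  ∀ (K : Set X) (fam : ℝ → 𝒢.Bisec), IsCompact K → σ.IsVariation fam K →
    HasDerivAt (fun ε => action 𝒢 ϑ K (fam ε)) 0 0

/-- The action is stationary at `Σ` under the variations `Σ ∘ δΣ_ε`, for smooth families `δΣ_ε` of
bisections with compact support that start at the bisection of units. -/
def IsCriticalRight (ϑ : Form F G 1) (σ : 𝒢.Bisec) : Prop :=
  ∀ (K : Set X) (δ : ℝ → 𝒢.Bisec), IsCompact K →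
    (Bisection.one 𝒢.toLocalLieGroupoid).IsVariation δ K →
    ∀ h : ∀ ε, σ.Composable (δ ε),
      HasDerivAt (fun ε => action 𝒢 ϑ K (σ.mul (δ ε) (h ε))) 0 0

end Action

end

end PoissonCS

open PoissonCS

/-! Since $\omega=d\vartheta$, the field strength is $F=d\vartheta_\Sigma$ and the action is the
abelian Chern–Simons functional $\int A\wedge dA$ of $A=\vartheta_\Sigma$.

Equations of motion. For a variation supported in $K$, Stokes gives $\delta\int A\wedge
dA=2\int\delta A\wedge dA$ (`IsSmoothFamily.hasDerivAt_chernSimons`). If the sections move with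
velocity $V$, Cartan's formula (`velocity_pullback`) gives $\delta
A=\Sigma_s^*\iota_V\omega+d(\vartheta(V))$. The exact part contributes $\int d(\vartheta(V)F)=0$, so
the first variation is $2\int(\Sigma_s^*\iota_V\omega)\wedge F$ (`hasDerivAt_action`), and $F=0$
implies stationarity.

For the converse, right variations have to realise every covector $a$ at a point $x_0$ as
$\Sigma_s^*\iota_V\omega$. This is linear algebra (`exists_right_translation`). The Lagrangian graph
of $m$ forces the source and target fibres to be each other's symplectic orthogonals. The vector $V$
with $\omega(V,\cdot)=a\circ(Tl_\Sigma)^{-1}\circ Tt$ is then tangent to the source fibre, and it is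
the velocity of the product of $\Sigma$ with a deformation of the units whose velocity $W$ at $x_0$
lies in $\ker Ts$. Such a deformation exists because $s$ is a submersion
(`exists_fiber_deformation`). Cut off by a bump function and taken at small parameters, it consists
of bisections whose products with $\Sigma$ are defined (`exists_bisection_family`). If $F\neq0$ at
$x_0$, some $a$ has $a\wedge F>0$ there; with a small bump the first variation is then a positive
integral, a contradiction (`fieldStrength_eq_zero_of_isCriticalRight`).

That $F=0$ already makes $\Sigma$ Lagrangian, and not merely isotropic, follows from the
orthogonality of the fibres (`isLagrangian_iff`); no assumption on $\dim\mathcal G$ enters.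

Gauge invariance. Isotropy of the graph of $m$ gives
$F^s(\Sigma\circ\Lambda)=l_\Lambda^*F^s(\Sigma)+F^s(\Lambda)$, and the last term vanishes. Hence
$A=l_\Lambda^*\vartheta_\Sigma$ and $B=\vartheta_{\Sigma\circ\Lambda}$ have the same exterior
derivative $F'$, and $d(A\wedge B)=B\wedge F'-A\wedge F'$ is the difference of the two densities. If
$\Lambda$ is the unit bisection off $K$, then $A=B$ there, so $A\wedge B$ is supported in $K$ and
Stokes removes the boundary term. -/

namespace PoissonCS

set_option linter.unusedSectionVars false

/-! ### Alternating forms on normed spaces -/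

section AlternatingCalculus

variable {E : Type*} [NormedAddCommGroup E] [NormedSpace ℝ E]
variable {E' : Type*} [NormedAddCommGroup E'] [NormedSpace ℝ E']
variable {A : Type*} [NormedAddCommGroup A] [NormedSpace ℝ A]

variable (E) in
/-- The normalized alternatization, a left inverse of the inclusion of the alternating maps into
the multilinear maps. -/
noncomputable def alternatizeCLM (k : ℕ) :
    ContinuousMultilinearMap ℝ (fun _ : Fin k => E) ℝ →L[ℝ] E [⋀^Fin k]→L[ℝ] ℝ :=
  LinearMap.mkContinuous
    { toFun := fun f => ((k.factorial : ℝ)⁻¹) • ContinuousMultilinearMap.alternatization f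
      map_add' := fun f g => by rw [map_add, smul_add]
      map_smul' := fun c f => by
        ext v
        simp only [ContinuousAlternatingMap.smul_apply, RingHom.id_apply,
          ContinuousMultilinearMap.alternatization_apply_apply, smul_apply,
          Finset.smul_sum]
        refine Finset.sum_congr rfl fun σ _ => ?_
        rw [smul_comm c, smul_comm c] }
    1 (fun f => by
      refine ContinuousAlternatingMap.opNorm_le_bound _ (by positivity) fun v => ?_
      simp only [LinearMap.coe_mk, AddHom.coe_mk, ContinuousAlternatingMap.smul_apply,
        ContinuousMultilinearMap.alternatization_apply_apply, one_mul]
      rw [norm_smul, norm_inv, Real.norm_natCast, inv_mul_le_iff₀ (by positivity)]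
      refine (norm_sum_le _ _).trans ?_
      have h : ∀ σ ∈ (Finset.univ : Finset (Equiv.Perm (Fin k))),
          ‖Equiv.Perm.sign σ • f (v ∘ σ)‖ ≤ ‖f‖ * ∏ i, ‖v i‖ := by
        intro σ _
        have h1 : ‖Equiv.Perm.sign σ • f (v ∘ σ)‖ = ‖f (v ∘ σ)‖ := by
          rcases Int.units_eq_one_or (Equiv.Perm.sign σ) with h | h <;> simp [h]
        rw [h1]
        refine (f.le_opNorm _).trans_eq ?_
        congr 1
        exact Equiv.prod_comp σ (fun i => ‖v i‖)
      refine (Finset.sum_le_sum h).trans_eq ?_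
      simp [Fintype.card_perm])

theorem alternatizeCLM_coe {k : ℕ} (f : E [⋀^Fin k]→L[ℝ] ℝ) :
    alternatizeCLM E k f.toContinuousMultilinearMap = f := by
  ext v
  have h := AlternatingMap.coe_alternatization f.toAlternatingMap
  have h2 := congrArg (fun g => g v) h
  have h3 : ContinuousMultilinearMap.alternatization f.toContinuousMultilinearMap v =
      (k.factorial : ℝ) * f v := by
    rw [ContinuousMultilinearMap.alternatization_apply_apply]
    simp only [MultilinearMap.alternatization_apply, AlternatingMap.smul_apply] at h2
    simpa [Function.comp_def] using h2
  change ((k.factorial : ℝ)⁻¹) • ContinuousMultilinearMap.alternatization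
    f.toContinuousMultilinearMap v = f v
  rw [h3, smul_eq_mul, inv_mul_cancel_left₀ (by positivity)]

/-- On multilinear maps, composition is itself continuous multilinear in the inserted maps and
linear in the form, hence smooth. `alternatizeCLM` carries the smoothness back to alternating maps.
-/
theorem contDiffAt_compContinuousLinearMap
    {k : ℕ} {f : A → E' [⋀^Fin k]→L[ℝ] ℝ} {g : A → E →L[ℝ] E'} {x : A}
    (hf : ContDiffAt ℝ ∞ f x) (hg : ContDiffAt ℝ ∞ g x) :
    ContDiffAt ℝ ∞ (fun y => (f y).compContinuousLinearMap (g y)) x := by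
  have h1 : ContDiffAt ℝ ∞ (fun y =>
      ContinuousMultilinearMap.compContinuousLinearMapContinuousMultilinear ℝ
        (fun _ : Fin k => E) (fun _ => E') ℝ (fun _ => g y)) x :=
    (ContinuousMultilinearMap.contDiff _).contDiffAt.comp x (contDiffAt_pi.2 fun _ => hg)
  have h2 : ContDiffAt ℝ ∞ (fun y => (f y).toContinuousMultilinearMap) x :=
    (ContinuousAlternatingMap.toContinuousMultilinearMapCLM (E := E') (F := ℝ) (ι := Fin k)
      (𝕜 := ℝ) ℝ).contDiff.contDiffAt.comp x hf
  have h3 := (alternatizeCLM E k).contDiff.contDiffAt.comp x (h1.clm_apply h2)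
  refine h3.congr_of_eventuallyEq (Filter.Eventually.of_forall fun y => ?_)
  exact (alternatizeCLM_coe _).symm

theorem wedgeAlt_apply {k : ℕ} (a : E [⋀^Fin 1]→L[ℝ] ℝ) (b : E [⋀^Fin k]→L[ℝ] ℝ)
    (v : Fin (k + 1) → E) :
    wedgeAlt a b v = ∑ i, (-1 : ℝ) ^ i.val * (a (fun _ => v i) * b (i.removeNth v)) := by
  rw [wedgeAlt, ContinuousAlternatingMap.alternatizeUncurryFin_apply]
  refine Finset.sum_congr rfl fun i _ => ?_
  simp

variable (E) in
/-- The wedge product as a continuous bilinear map. -/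
noncomputable def wedgeCLM (k : ℕ) :
    (E [⋀^Fin 1]→L[ℝ] ℝ) →L[ℝ] (E [⋀^Fin k]→L[ℝ] ℝ) →L[ℝ] (E [⋀^Fin (k + 1)]→L[ℝ] ℝ) :=
  (ContinuousLinearMap.compL ℝ (E [⋀^Fin k]→L[ℝ] ℝ) (E →L[ℝ] E [⋀^Fin k]→L[ℝ] ℝ)
      (E [⋀^Fin (k + 1)]→L[ℝ] ℝ)
      (ContinuousAlternatingMap.alternatizeUncurryFinCLM ℝ E ℝ)) ∘L
    (ContinuousLinearMap.smulRightL ℝ E (E [⋀^Fin k]→L[ℝ] ℝ)) ∘L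
    ((ContinuousAlternatingMap.ofSubsingletonLIE (𝕜 := ℝ) (E := E) (F := ℝ)
      (0 : Fin 1)).symm.toContinuousLinearEquiv :
      (E [⋀^Fin 1]→L[ℝ] ℝ) →L[ℝ] (E →L[ℝ] ℝ))

theorem wedgeCLM_apply {k : ℕ} (a : E [⋀^Fin 1]→L[ℝ] ℝ) (b : E [⋀^Fin k]→L[ℝ] ℝ) :
    wedgeCLM E k a b = wedgeAlt a b := rfl

theorem wedgeAlt_comp {k : ℕ} (a : E' [⋀^Fin 1]→L[ℝ] ℝ) (b : E' [⋀^Fin k]→L[ℝ] ℝ) (g : E →L[ℝ] E') :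
    (wedgeAlt a b).compContinuousLinearMap g =
      wedgeAlt (a.compContinuousLinearMap g) (b.compContinuousLinearMap g) := by
  ext v
  simp [wedgeAlt_apply, ContinuousAlternatingMap.compContinuousLinearMap_apply, Fin.removeNth_apply, Function.comp_def]
  rfl

theorem extDeriv_one_apply {a : E → E [⋀^Fin 1]→L[ℝ] ℝ} {x : E} (v : Fin 2 → E) :
    extDeriv a x v = fderiv ℝ a x (v 0) (fun _ => v 1) - fderiv ℝ a x (v 1) (fun _ => v 0) := by
  rw [extDeriv, ContinuousAlternatingMap.alternatizeUncurryFin_apply, Fin.sum_univ_two]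
  have h0 : Fin.removeNth 0 v = fun _ => v 1 := by
    ext i; rw [Subsingleton.elim i 0]; rfl
  have h1 : Fin.removeNth 1 v = fun _ => v 0 := by
    ext i; rw [Subsingleton.elim i 0]; rfl
  simp [h0, h1, sub_eq_add_neg]

/-- The Leibniz rule for the product of two 1-forms -/
theorem extDeriv_wedgeAlt {a b : E → E [⋀^Fin 1]→L[ℝ] ℝ} {x : E}
    (ha : DifferentiableAt ℝ a x) (hb : DifferentiableAt ℝ b x) :
    extDeriv (fun y => wedgeAlt (a y) (b y)) x =
      wedgeAlt (b x) (extDeriv a x) - wedgeAlt (a x) (extDeriv b x) := by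
  have h : HasFDerivAt (fun y => wedgeAlt (a y) (b y)) _ x :=
    (wedgeCLM E 1).hasFDerivAt_of_bilinear ha.hasFDerivAt hb.hasFDerivAt
  ext v
  rw [extDeriv, h.fderiv, ContinuousAlternatingMap.alternatizeUncurryFin_apply]
  simp [wedgeAlt_apply, Fin.sum_univ_three, Fin.sum_univ_two, extDeriv_one_apply, wedgeCLM_apply, Fin.removeNth_apply]
  have e : (Fin.succAbove 2 1 : Fin 3) = 1 := rfl
  -- After `simp` the arguments are iterated `Fin.tail` and `Fin.removeNth` of `v`. A tuple indexed
  -- by `Fin 1` is the constant at its only entry, which brings both sides to the same six terms.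
  have key : ∀ (w : Fin 1 → E) (u : E), w 0 = u → w = fun _ => u := fun w u h => by
    ext i; rw [Subsingleton.elim i 0, h]
  rw [key (Fin.tail (Fin.tail v)) (v 2) rfl, key (Fin.removeNth 1 (Fin.tail v)) (v 1) rfl,
    key (Fin.removeNth 1 (Fin.removeNth 1 v)) (v 0) rfl,
    key (Fin.tail (Fin.removeNth 1 v)) (v 2) rfl, key (Fin.tail (Fin.removeNth 2 v)) (v 1) rfl,
    key (Fin.removeNth 1 (Fin.removeNth 2 v)) (v 0) rfl, e]
  ring

theorem extDeriv_smul_form {k : ℕ} {h : E → ℝ} {b : E → E [⋀^Fin k]→L[ℝ] ℝ} {x : E}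
    (hh : DifferentiableAt ℝ h x) (hb : DifferentiableAt ℝ b x) :
    extDeriv (fun y => h y • b y) x =
      wedgeAlt (ContinuousAlternatingMap.ofSubsingleton ℝ E ℝ (0 : Fin 1) (fderiv ℝ h x)) (b x) +
        h x • extDeriv b x := by
  ext v
  have h1 : fderiv ℝ (fun y => h y • b y) x = _ := (hh.hasFDerivAt.smul hb.hasFDerivAt).fderiv
  rw [extDeriv, h1]
  simp [wedgeAlt_apply, extDeriv, ContinuousAlternatingMap.alternatizeUncurryFin_apply,
    Finset.mul_sum]
  rw [add_comm]

end AlternatingCalculus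

/-! ### Exterior calculus on manifolds, read in charts -/

section FormCalculus

variable (E : Type*) [NormedAddCommGroup E] [NormedSpace ℝ E]
variable {M : Type*} [TopologicalSpace M] [ChartedSpace E M]
variable (E' : Type*) [NormedAddCommGroup E'] [NormedSpace ℝ E']
variable {N : Type*} [TopologicalSpace N] [ChartedSpace E' N]
variable (E'' : Type*) [NormedAddCommGroup E''] [NormedSpace ℝ E'']
variable {P : Type*} [TopologicalSpace P] [ChartedSpace E'' P]

/-- The tangent map, as a linear map between the model spaces. -/
noncomputable def tder (f : M → N) (x : M) : E →L[ℝ] E' := mfderiv 𝓘(ℝ, E) 𝓘(ℝ, E') f x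

/-- The value of a form at a point, on the model space. -/
def Form.at {E : Type*} [NormedAddCommGroup E] [NormedSpace ℝ E]
    {M : Type*} [TopologicalSpace M] [ChartedSpace E M] {k : ℕ} (η : Form E M k) (x : M) :
    E [⋀^Fin k]→L[ℝ] ℝ := η x

variable {E E' E''}

theorem tder_comp {g : N → P} {f : M → N} (x : M)
    (hg : MDifferentiableAt 𝓘(ℝ, E') 𝓘(ℝ, E'') g (f x))
    (hf : MDifferentiableAt 𝓘(ℝ, E) 𝓘(ℝ, E') f x) :
    tder E E'' (g ∘ f) x = (tder E' E'' g (f x)).comp (tder E E' f x) :=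
  mfderiv_comp x hg hf

theorem tder_eq_fderiv (f : E → E') (x : E) : tder E E' f x = fderiv ℝ f x := mfderiv_eq_fderiv

theorem tder_id (x : M) : tder E E (id : M → M) x = ContinuousLinearMap.id ℝ E := mfderiv_id

theorem _root_.Filter.EventuallyEq.tder_eq {f g : M → N} {x : M} (h : f =ᶠ[𝓝 x] g) :
    tder E E' f x = tder E E' g x := h.mfderiv_eq

theorem pullback_at {k : ℕ} (f : M → N) (η : Form E' N k) (x : M) :
    (pullback f η : Form E M k).at x = (η.at (f x)).compContinuousLinearMap (tder E E' f x) := rfl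

theorem chartRep_eq {k : ℕ} (c : M) (η : Form E M k) (y : E) :
    chartRep c η y = (η.at ((extChartAt 𝓘(ℝ, E) c).symm y)).compContinuousLinearMap
      (tder E E (extChartAt 𝓘(ℝ, E) c).symm y) := rfl

theorem extd_at {k : ℕ} (η : Form E M k) (x : M) :
    (extd η).at x = (extDeriv (chartRep x η) (extChartAt 𝓘(ℝ, E) x x)).compContinuousLinearMap
      (tder E E (extChartAt 𝓘(ℝ, E) x) x) := rfl

theorem wedge_at {k : ℕ} (a : Form E M 1) (b : Form E M k) (x : M) :
    (wedge a b).at x = wedgeAlt (a.at x) (b.at x) := rfl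

theorem add_at {k : ℕ} (a b : Form E M k) (x : M) : (a + b).at x = a.at x + b.at x := rfl

theorem zero_at {k : ℕ} (x : M) : (0 : Form E M k).at x = 0 := rfl

theorem smul_fun_at {k : ℕ} (h : M → ℝ) (a : Form E M k) (x : M) :
    Form.at (fun x => h x • a x : Form E M k) x = h x • a.at x := rfl

theorem Form.ext_at {k : ℕ} {η η' : Form E M k} (h : ∀ x, η.at x = η'.at x) : η = η' := funext h

variable (E E') in
/-- The map `f` read in the preferred charts around `c` and `c'`. -/
noncomputable def readIn (c : M) (c' : N) (f : M → N) : E → E' :=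
  extChartAt 𝓘(ℝ, E') c' ∘ f ∘ (extChartAt 𝓘(ℝ, E) c).symm

theorem chart_target_mem_nhds {c : M} {y : E} (hy : y ∈ (extChartAt 𝓘(ℝ, E) c).target) :
    (extChartAt 𝓘(ℝ, E) c).target ∈ 𝓝 y :=
  (isOpen_extChartAt_target c).mem_nhds hy

theorem contMDiffAt_extChartAt_symm [IsManifold 𝓘(ℝ, E) ∞ M] {c : M} {y : E}
    (hy : y ∈ (extChartAt 𝓘(ℝ, E) c).target) :
    ContMDiffAt 𝓘(ℝ, E) 𝓘(ℝ, E) ∞ (extChartAt 𝓘(ℝ, E) c).symm y :=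
  (contMDiffOn_extChartAt_symm c).contMDiffAt (chart_target_mem_nhds hy)

theorem mdifferentiableAt_extChartAt_symm [IsManifold 𝓘(ℝ, E) ∞ M] {c : M} {y : E}
    (hy : y ∈ (extChartAt 𝓘(ℝ, E) c).target) :
    MDifferentiableAt 𝓘(ℝ, E) 𝓘(ℝ, E) (extChartAt 𝓘(ℝ, E) c).symm y :=
  (contMDiffAt_extChartAt_symm hy).mdifferentiableAt (by simp)

theorem contMDiffAt_extChartAt_of_mem [IsManifold 𝓘(ℝ, E) ∞ M] {c x : M}
    (hx : x ∈ (extChartAt 𝓘(ℝ, E) c).source) :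
    ContMDiffAt 𝓘(ℝ, E) 𝓘(ℝ, E) ∞ (extChartAt 𝓘(ℝ, E) c) x :=
  contMDiffAt_extChartAt' (by simpa using hx)

theorem mdifferentiableAt_extChartAt_of_mem [IsManifold 𝓘(ℝ, E) ∞ M] {c x : M}
    (hx : x ∈ (extChartAt 𝓘(ℝ, E) c).source) :
    MDifferentiableAt 𝓘(ℝ, E) 𝓘(ℝ, E) (extChartAt 𝓘(ℝ, E) c) x :=
  (contMDiffAt_extChartAt_of_mem hx).mdifferentiableAt (by simp)

theorem tder_symm_comp_tder_chart [IsManifold 𝓘(ℝ, E) ∞ M] {c x : M}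
    (hx : x ∈ (extChartAt 𝓘(ℝ, E) c).source) :
    (tder E E (extChartAt 𝓘(ℝ, E) c).symm (extChartAt 𝓘(ℝ, E) c x)).comp
      (tder E E (extChartAt 𝓘(ℝ, E) c) x) = ContinuousLinearMap.id ℝ E := by
  rw [← tder_comp x (mdifferentiableAt_extChartAt_symm ((extChartAt 𝓘(ℝ, E) c).map_source hx))
    (mdifferentiableAt_extChartAt_of_mem hx), ← tder_id x]
  apply Filter.EventuallyEq.tder_eq
  filter_upwards [(isOpen_extChartAt_source (I := 𝓘(ℝ, E)) c).mem_nhds hx] with z hz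
  exact (extChartAt 𝓘(ℝ, E) c).left_inv hz

/-- The tangent space at `x` is the model space read through the preferred chart around `x`, so this
chart has the identity as its derivative at `x`. Pointwise values of forms can therefore be computed
in that chart without correction factors. -/
theorem tder_chart_self [IsManifold 𝓘(ℝ, E) ∞ M] (x : M) :
    tder E E (extChartAt 𝓘(ℝ, E) x) x = ContinuousLinearMap.id ℝ E := by
  have : IsManifold 𝓘(ℝ, E) 1 M := IsManifold.of_le (n := ∞) (by simp)
  exact mfderiv_extChartAt_self

theorem tder_chart_symm_self [IsManifold 𝓘(ℝ, E) ∞ M] (x : M) :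
    tder E E (extChartAt 𝓘(ℝ, E) x).symm (extChartAt 𝓘(ℝ, E) x x) =
      ContinuousLinearMap.id ℝ E := by
  have h := tder_symm_comp_tder_chart (mem_extChartAt_source (I := 𝓘(ℝ, E)) x)
  rwa [tder_chart_self, ContinuousLinearMap.comp_id] at h

theorem contDiffAt_readIn [IsManifold 𝓘(ℝ, E) ∞ M] [IsManifold 𝓘(ℝ, E') ∞ N]
    {c : M} {c' : N} {f : M → N} {y : E}
    (hy : y ∈ (extChartAt 𝓘(ℝ, E) c).target)
    (hf : ContMDiffAt 𝓘(ℝ, E) 𝓘(ℝ, E') ∞ f ((extChartAt 𝓘(ℝ, E) c).symm y))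
    (hy' : f ((extChartAt 𝓘(ℝ, E) c).symm y) ∈ (extChartAt 𝓘(ℝ, E') c').source) :
    ContDiffAt ℝ ∞ (readIn E E' c c' f) y := by
  rw [← contMDiffAt_iff_contDiffAt]
  exact (contMDiffAt_extChartAt_of_mem hy').comp y (hf.comp y (contMDiffAt_extChartAt_symm hy))

theorem eventually_mem_chart_source {c : M} {c' : N} {f : M → N} {y : E}
    (hy : y ∈ (extChartAt 𝓘(ℝ, E) c).target)
    (hf : ContinuousAt f ((extChartAt 𝓘(ℝ, E) c).symm y))
    (hy' : f ((extChartAt 𝓘(ℝ, E) c).symm y) ∈ (extChartAt 𝓘(ℝ, E') c').source) :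
    ∀ᶠ z in 𝓝 y, f ((extChartAt 𝓘(ℝ, E) c).symm z) ∈ (extChartAt 𝓘(ℝ, E') c').source := by
  have hc : ContinuousAt (f ∘ (extChartAt 𝓘(ℝ, E) c).symm) y :=
    ContinuousAt.comp hf (continuousAt_extChartAt_symm'' hy)
  exact hc.preimage_mem_nhds ((isOpen_extChartAt_source c').mem_nhds hy')

/-- The chain rule for `c'⁻¹ ∘ readIn c c' f = f ∘ c⁻¹`. -/
theorem tder_symm_readIn [IsManifold 𝓘(ℝ, E) ∞ M] [IsManifold 𝓘(ℝ, E') ∞ N]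
    {c : M} {c' : N} {f : M → N} {y : E}
    (hy : y ∈ (extChartAt 𝓘(ℝ, E) c).target)
    (hf : ContMDiffAt 𝓘(ℝ, E) 𝓘(ℝ, E') ∞ f ((extChartAt 𝓘(ℝ, E) c).symm y))
    (hy' : f ((extChartAt 𝓘(ℝ, E) c).symm y) ∈ (extChartAt 𝓘(ℝ, E') c').source) :
    (tder E' E' (extChartAt 𝓘(ℝ, E') c').symm (readIn E E' c c' f y)).comp
      (fderiv ℝ (readIn E E' c c' f) y) =
    (tder E E' f ((extChartAt 𝓘(ℝ, E) c).symm y)).comp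
      (tder E E (extChartAt 𝓘(ℝ, E) c).symm y) := by
  rw [← tder_comp y (hf.mdifferentiableAt (by simp)) (mdifferentiableAt_extChartAt_symm hy),
    ← tder_eq_fderiv, ← tder_comp y]
  · apply Filter.EventuallyEq.tder_eq
    filter_upwards [eventually_mem_chart_source hy hf.continuousAt hy'] with z hz
    exact (extChartAt 𝓘(ℝ, E') c').left_inv hz
  · exact mdifferentiableAt_extChartAt_symm ((extChartAt 𝓘(ℝ, E') c').map_source hy')
  · exact ((contDiffAt_readIn hy hf hy').differentiableAt (by simp)).mdifferentiableAt

/-- By the chain rule `tder_symm_readIn`. Pullbacks on manifolds become pullbacks between normed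
spaces, where `extDeriv` is known to be natural. -/
theorem chartRep_pullback [IsManifold 𝓘(ℝ, E) ∞ M] [IsManifold 𝓘(ℝ, E') ∞ N] {k : ℕ}
    {c : M} {c' : N} {f : M → N} {y : E} (η : Form E' N k)
    (hy : y ∈ (extChartAt 𝓘(ℝ, E) c).target)
    (hf : ContMDiffAt 𝓘(ℝ, E) 𝓘(ℝ, E') ∞ f ((extChartAt 𝓘(ℝ, E) c).symm y))
    (hy' : f ((extChartAt 𝓘(ℝ, E) c).symm y) ∈ (extChartAt 𝓘(ℝ, E') c').source) :
    chartRep c (pullback f η) y = (chartRep c' η (readIn E E' c c' f y)).compContinuousLinearMap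
      (fderiv ℝ (readIn E E' c c' f) y) := by
  have hp : (extChartAt 𝓘(ℝ, E') c').symm (readIn E E' c c' f y) =
      f ((extChartAt 𝓘(ℝ, E) c).symm y) := (extChartAt 𝓘(ℝ, E') c').left_inv hy'
  have h := tder_symm_readIn hy hf hy'
  rw [chartRep_eq, chartRep_eq, pullback_at, hp]
  ext v
  have h' := fun i => congrArg (fun L => L (v i)) h
  simp only [ContinuousLinearMap.comp_apply] at h'
  simp only [ContinuousAlternatingMap.compContinuousLinearMap_apply, Function.comp_def, h']

theorem pullback_id {k : ℕ} (η : Form E M k) : pullback (id : M → M) η = η := by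
  apply Form.ext_at
  intro x
  rw [pullback_at, tder_id]
  rfl

theorem readIn_id_of_mem [IsManifold 𝓘(ℝ, E) ∞ M] {k : ℕ} {c c' : M} {y : E} (η : Form E M k)
    (hy : y ∈ (extChartAt 𝓘(ℝ, E) c).target)
    (hy' : (extChartAt 𝓘(ℝ, E) c).symm y ∈ (extChartAt 𝓘(ℝ, E) c').source) :
    chartRep c η y = (chartRep c' η (readIn E E c c' id y)).compContinuousLinearMap
      (fderiv ℝ (readIn E E c c' id) y) := by
  conv_lhs => rw [← pullback_id η]
  exact chartRep_pullback η hy contMDiffAt_id hy'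

/-- A form is determined by its chart representatives. -/
theorem at_eq_chartRep [IsManifold 𝓘(ℝ, E) ∞ M] {k : ℕ} {c x : M} (η : Form E M k)
    (hx : x ∈ (extChartAt 𝓘(ℝ, E) c).source) :
    η.at x = (chartRep c η (extChartAt 𝓘(ℝ, E) c x)).compContinuousLinearMap
      (tder E E (extChartAt 𝓘(ℝ, E) c) x) := by
  have h := tder_symm_comp_tder_chart hx
  rw [chartRep_eq, (extChartAt 𝓘(ℝ, E) c).left_inv hx]
  ext v
  have h' := fun i => congrArg (fun L => L (v i)) h
  simp only [ContinuousLinearMap.comp_apply] at h'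
  simp only [ContinuousAlternatingMap.compContinuousLinearMap_apply, Function.comp_def, h']
  rfl

theorem IsSmoothForm.contDiffAt {k : ℕ} {η : Form E M k} (hη : IsSmoothForm η) {c : M} {y : E}
    (hy : y ∈ (extChartAt 𝓘(ℝ, E) c).target) : ContDiffAt ℝ ∞ (chartRep c η) y :=
  (hη c).contDiffAt (chart_target_mem_nhds hy)

theorem isSmoothForm_iff {k : ℕ} {η : Form E M k} : IsSmoothForm η ↔
    ∀ c, ∀ y ∈ (extChartAt 𝓘(ℝ, E) c).target, ContDiffAt ℝ ∞ (chartRep c η) y :=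
  ⟨fun h _ _ hy => h.contDiffAt hy, fun h c y hy => (h c y hy).contDiffWithinAt⟩

theorem minSmoothness_le_infty : minSmoothness ℝ 2 ≤ (∞ : WithTop ℕ∞) := by
  rw [minSmoothness_of_isRCLikeNormedField]
  exact WithTop.coe_le_coe.2 (le_top : (2 : ℕ∞) ≤ ⊤)

theorem extDeriv_contDiffAt {k : ℕ} {f : E → E [⋀^Fin k]→L[ℝ] ℝ} {x : E}
    (hf : ContDiffAt ℝ ∞ f x) : ContDiffAt ℝ ∞ (extDeriv f) x := by
  have h : ContDiffAt ℝ ∞ (fderiv ℝ f) x := hf.fderiv_right (by simp)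
  exact (ContinuousAlternatingMap.alternatizeUncurryFinCLM ℝ E ℝ).contDiff.contDiffAt.comp x h

/-- `extd` uses a different chart at every point. Naturality of `extDeriv` under the transition map
to the chart around the point makes the result independent of the chart, so identities for `extd`
can be checked in one fixed chart. -/
theorem chartRep_extd [IsManifold 𝓘(ℝ, E) ∞ M] {k : ℕ} {c : M} {y : E} {η : Form E M k}
    (hη : IsSmoothForm η) (hy : y ∈ (extChartAt 𝓘(ℝ, E) c).target) :
    chartRep c (extd η) y = extDeriv (chartRep c η) y := by
  set x := (extChartAt 𝓘(ℝ, E) c).symm y with hx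
  have hxs : x ∈ (extChartAt 𝓘(ℝ, E) x).source := mem_extChartAt_source x
  have e1 : chartRep c η =ᶠ[𝓝 y] fun z => (chartRep x η (readIn E E c x id z)).compContinuousLinearMap
      (fderiv ℝ (readIn E E c x id) z) := by
    filter_upwards [chart_target_mem_nhds hy,
      eventually_mem_chart_source (c' := x) hy continuousAt_id hxs] with z hz hz'
    exact readIn_id_of_mem η hz hz'
  have hsm : ContDiffAt ℝ ∞ (readIn E E c x id) y := contDiffAt_readIn hy contMDiffAt_id hxs
  have hrx : readIn E E c x id y = extChartAt 𝓘(ℝ, E) x x := rfl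
  rw [e1.extDeriv_eq, extDeriv_pullback ?_ hsm minSmoothness_le_infty, chartRep_eq, extd_at, ← hx, hrx]
  · have h := tder_comp y (mdifferentiableAt_extChartAt_of_mem hxs)
      (mdifferentiableAt_extChartAt_symm hy)
    have h2 : fderiv ℝ (readIn E E c x id) y = _ := (tder_eq_fderiv _ _).symm.trans h
    rw [h2]
    rfl
  · exact (hη.contDiffAt (by rw [hrx]; exact (extChartAt 𝓘(ℝ, E) x).map_source hxs)).differentiableAt
      (by simp)

theorem form_eq_of_chartRep [IsManifold 𝓘(ℝ, E) ∞ M] {k : ℕ} {η η' : Form E M k}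
    (h : ∀ c, ∀ y ∈ (extChartAt 𝓘(ℝ, E) c).target, chartRep c η y = chartRep c η' y) : η = η' := by
  apply Form.ext_at
  intro x
  rw [at_eq_chartRep η (mem_extChartAt_source x), at_eq_chartRep η' (mem_extChartAt_source x),
    h x _ (mem_extChartAt_target x)]

theorem IsSmoothForm.extd [IsManifold 𝓘(ℝ, E) ∞ M] {k : ℕ} {η : Form E M k}
    (hη : IsSmoothForm η) : IsSmoothForm (extd η) := by
  rw [isSmoothForm_iff]
  intro c y hy
  refine (extDeriv_contDiffAt (hη.contDiffAt hy)).congr_of_eventuallyEq ?_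
  filter_upwards [chart_target_mem_nhds hy] with z hz
  exact chartRep_extd hη hz

theorem chartRep_pullback_eventuallyEq [IsManifold 𝓘(ℝ, E) ∞ M] [IsManifold 𝓘(ℝ, E') ∞ N] {k : ℕ}
    {c : M} {c' : N} {f : M → N} {y : E} (η : Form E' N k)
    (hy : y ∈ (extChartAt 𝓘(ℝ, E) c).target) (hf : ContMDiff 𝓘(ℝ, E) 𝓘(ℝ, E') ∞ f)
    (hy' : f ((extChartAt 𝓘(ℝ, E) c).symm y) ∈ (extChartAt 𝓘(ℝ, E') c').source) :
    chartRep c (pullback f η) =ᶠ[𝓝 y] fun z =>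
      (chartRep c' η (readIn E E' c c' f z)).compContinuousLinearMap
        (fderiv ℝ (readIn E E' c c' f) z) := by
  filter_upwards [chart_target_mem_nhds hy,
    eventually_mem_chart_source hy hf.continuous.continuousAt hy'] with z hz hz'
  exact chartRep_pullback η hz hf.contMDiffAt hz'

theorem IsSmoothForm.pullback [IsManifold 𝓘(ℝ, E) ∞ M] [IsManifold 𝓘(ℝ, E') ∞ N] {k : ℕ}
    {f : M → N} {η : Form E' N k} (hη : IsSmoothForm η) (hf : ContMDiff 𝓘(ℝ, E) 𝓘(ℝ, E') ∞ f) :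
    IsSmoothForm (pullback f η : Form E M k) := by
  rw [isSmoothForm_iff]
  intro c y hy
  set c' := f ((extChartAt 𝓘(ℝ, E) c).symm y) with hc'
  have hy' : f ((extChartAt 𝓘(ℝ, E) c).symm y) ∈ (extChartAt 𝓘(ℝ, E') c').source :=
    mem_extChartAt_source c'
  have hr := contDiffAt_readIn hy hf.contMDiffAt hy'
  refine (contDiffAt_compContinuousLinearMap ?_ (hr.fderiv_right (by simp))).congr_of_eventuallyEq
    (chartRep_pullback_eventuallyEq η hy hf hy')
  exact (hη.contDiffAt ((extChartAt 𝓘(ℝ, E') c').map_source hy')).comp y hr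

theorem extd_pullback [IsManifold 𝓘(ℝ, E) ∞ M] [IsManifold 𝓘(ℝ, E') ∞ N] {k : ℕ}
    {f : M → N} {η : Form E' N k} (hη : IsSmoothForm η) (hf : ContMDiff 𝓘(ℝ, E) 𝓘(ℝ, E') ∞ f) :
    extd (pullback f η : Form E M k) = pullback f (extd η) := by
  apply form_eq_of_chartRep
  intro c y hy
  have hy' := mem_extChartAt_source (I := 𝓘(ℝ, E')) (f ((extChartAt 𝓘(ℝ, E) c).symm y))
  have ht := (extChartAt 𝓘(ℝ, E') (f ((extChartAt 𝓘(ℝ, E) c).symm y))).map_source hy'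
  rw [chartRep_extd (hη.pullback hf) hy, (chartRep_pullback_eventuallyEq η hy hf hy').extDeriv_eq,
    chartRep_pullback _ hy hf.contMDiffAt hy', extDeriv_pullback _
      (contDiffAt_readIn hy hf.contMDiffAt hy') minSmoothness_le_infty]
  · congr 1
    exact (chartRep_extd hη ht).symm
  · exact (hη.contDiffAt ht).differentiableAt (by simp)

theorem extd_extd [IsManifold 𝓘(ℝ, E) ∞ M] {k : ℕ} {η : Form E M k} (hη : IsSmoothForm η) :
    extd (extd η) = 0 := by
  apply form_eq_of_chartRep
  intro c y hy
  have h : chartRep c (extd η) =ᶠ[𝓝 y] extDeriv (chartRep c η) := by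
    filter_upwards [chart_target_mem_nhds hy] with z hz
    exact chartRep_extd hη hz
  rw [chartRep_extd hη.extd hy, h.extDeriv_eq,
    extDeriv_extDeriv_apply (hη.contDiffAt hy) minSmoothness_le_infty]
  rfl

theorem chartRep_wedge {k : ℕ} (c : M) (a : Form E M 1) (b : Form E M k) (y : E) :
    chartRep c (wedge a b) y = wedgeAlt (chartRep c a y) (chartRep c b y) :=
  wedgeAlt_comp (a.at ((extChartAt 𝓘(ℝ, E) c).symm y)) (b.at ((extChartAt 𝓘(ℝ, E) c).symm y)) _

theorem chartRep_add {k : ℕ} (c : M) (a b : Form E M k) :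
    chartRep c (a + b) = chartRep c a + chartRep c b := rfl

theorem chartRep_sub {k : ℕ} (c : M) (a b : Form E M k) :
    chartRep c (a - b) = chartRep c a - chartRep c b := rfl

theorem pullback_wedge {k : ℕ} (f : M → N) (a : Form E' N 1) (b : Form E' N k) :
    (pullback f (wedge a b) : Form E M (k + 1)) = wedge (pullback f a) (pullback f b) :=
  Form.ext_at fun x => wedgeAlt_comp (a.at (f x)) (b.at (f x)) (tder E E' f x)

theorem wedge_add_left {k : ℕ} (a a' : Form E M 1) (b : Form E M k) :
    wedge (a + a') b = wedge a b + wedge a' b := by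
  apply Form.ext_at
  intro x
  simp only [add_at, wedge_at, ← wedgeCLM_apply, map_add]
  rfl

theorem IsSmoothForm.wedge {k : ℕ} {a : Form E M 1} {b : Form E M k}
    (ha : IsSmoothForm a) (hb : IsSmoothForm b) : IsSmoothForm (wedge a b) := by
  rw [isSmoothForm_iff]
  intro c y hy
  refine (((wedgeCLM E k).contDiff.contDiffAt.comp y (ha.contDiffAt hy)).clm_apply
    (hb.contDiffAt hy)).congr_of_eventuallyEq (Filter.Eventually.of_forall fun z => ?_)
  exact chartRep_wedge c a b z

theorem IsSmoothForm.add {k : ℕ} {a b : Form E M k}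
    (ha : IsSmoothForm a) (hb : IsSmoothForm b) : IsSmoothForm (a + b) :=
  fun c => (ha c).add (hb c)

theorem IsSmoothForm.sub {k : ℕ} {a b : Form E M k}
    (ha : IsSmoothForm a) (hb : IsSmoothForm b) : IsSmoothForm (a - b) :=
  fun c => (ha c).sub (hb c)

theorem extd_sub [IsManifold 𝓘(ℝ, E) ∞ M] {k : ℕ} {a b : Form E M k}
    (ha : IsSmoothForm a) (hb : IsSmoothForm b) : extd (a - b) = extd a - extd b := by
  apply form_eq_of_chartRep
  intro c y hy
  rw [chartRep_extd (ha.sub hb) hy, chartRep_sub, chartRep_sub, Pi.sub_apply, chartRep_extd ha hy,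
    chartRep_extd hb hy, extDeriv, fderiv_sub ((ha.contDiffAt hy).differentiableAt (by simp))
    ((hb.contDiffAt hy).differentiableAt (by simp)), sub_eq_add_neg, ← neg_one_smul ℝ,
    ContinuousAlternatingMap.alternatizeUncurryFin_add,
    ContinuousAlternatingMap.alternatizeUncurryFin_smul, neg_one_smul, sub_eq_add_neg]
  rfl

theorem extd_add [IsManifold 𝓘(ℝ, E) ∞ M] {k : ℕ} {a b : Form E M k}
    (ha : IsSmoothForm a) (hb : IsSmoothForm b) : extd (a + b) = extd a + extd b := by
  apply form_eq_of_chartRep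
  intro c y hy
  rw [chartRep_extd (ha.add hb) hy, chartRep_add, chartRep_add, Pi.add_apply, chartRep_extd ha hy,
    chartRep_extd hb hy, extDeriv_add ((ha.contDiffAt hy).differentiableAt (by simp))
    ((hb.contDiffAt hy).differentiableAt (by simp))]

theorem chartRep_eq_zero {k : ℕ} {c : M} {η : Form E M k} {y : E}
    (h : η.at ((extChartAt 𝓘(ℝ, E) c).symm y) = 0) : chartRep c η y = 0 := by
  rw [chartRep_eq, h]
  rfl

theorem isSmoothForm_zero {k : ℕ} : IsSmoothForm (0 : Form E M k) := fun c =>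
  contDiffOn_const.congr fun y _ => (chartRep_eq_zero rfl : chartRep c (0 : Form E M k) y = 0)

theorem extDeriv_zero_apply {k : ℕ} (y : E) :
    extDeriv (0 : E → E [⋀^Fin k]→L[ℝ] ℝ) y = 0 := by
  rw [extDeriv, fderiv_zero]
  exact map_zero (ContinuousAlternatingMap.alternatizeUncurryFinCLM ℝ E ℝ)

theorem extd_at_eq_zero {k : ℕ} {η : Form E M k} {x : M} (h : ∀ᶠ z in 𝓝 x, η.at z = 0) :
    (extd η).at x = 0 := by
  have hc : ContinuousAt (extChartAt 𝓘(ℝ, E) x).symm (extChartAt 𝓘(ℝ, E) x x) :=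
    continuousAt_extChartAt_symm'' (mem_extChartAt_target x)
  have h2 : chartRep x η =ᶠ[𝓝 (extChartAt 𝓘(ℝ, E) x x)] 0 := by
    have h3 := hc.eventually (p := fun z => η.at z = 0) (by simpa using h)
    filter_upwards [h3] with y hy using chartRep_eq_zero hy
  rw [extd_at, h2.extDeriv_eq, extDeriv_zero_apply]
  rfl

theorem extd_zero {k : ℕ} : extd (0 : Form E M k) = 0 :=
  Form.ext_at fun _ => extd_at_eq_zero (Filter.Eventually.of_forall fun _ => rfl)

/-- This is $d(a\wedge b)=da\wedge b-a\wedge db$. Since `wedge` takes its 1-form on the left, the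
first term appears as $b\wedge da$, which is equal to it because a 2-form commutes with every form.
-/
theorem extd_wedge [IsManifold 𝓘(ℝ, E) ∞ M] {a b : Form E M 1}
    (ha : IsSmoothForm a) (hb : IsSmoothForm b) :
    extd (wedge a b) = wedge b (extd a) - wedge a (extd b) := by
  apply form_eq_of_chartRep
  intro c y hy
  have h : chartRep c (wedge a b) = fun z => wedgeAlt (chartRep c a z) (chartRep c b z) :=
    funext fun z => chartRep_wedge c a b z
  rw [chartRep_extd (ha.wedge hb) hy, h, extDeriv_wedgeAlt
    ((ha.contDiffAt hy).differentiableAt (by simp))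
    ((hb.contDiffAt hy).differentiableAt (by simp)), chartRep_sub, Pi.sub_apply, chartRep_wedge,
    chartRep_wedge, chartRep_extd ha hy, chartRep_extd hb hy]

theorem chartRep_smul_fun {k : ℕ} (c : M) (h : M → ℝ) (a : Form E M k) (y : E) :
    chartRep c (fun x => h x • a x : Form E M k) y =
      h ((extChartAt 𝓘(ℝ, E) c).symm y) • chartRep c a y := rfl

theorem contDiffAt_comp_chart [IsManifold 𝓘(ℝ, E) ∞ M] {h : M → ℝ} {c : M} {y : E}
    (hh : ContMDiff 𝓘(ℝ, E) 𝓘(ℝ, ℝ) ∞ h) (hy : y ∈ (extChartAt 𝓘(ℝ, E) c).target) :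
    ContDiffAt ℝ ∞ (fun z => h ((extChartAt 𝓘(ℝ, E) c).symm z)) y := by
  rw [← contMDiffAt_iff_contDiffAt]
  exact hh.contMDiffAt.comp y (contMDiffAt_extChartAt_symm hy)

theorem IsSmoothForm.smul_fun [IsManifold 𝓘(ℝ, E) ∞ M] {k : ℕ} {h : M → ℝ} {a : Form E M k}
    (ha : IsSmoothForm a) (hh : ContMDiff 𝓘(ℝ, E) 𝓘(ℝ, ℝ) ∞ h) :
    IsSmoothForm (fun x => h x • a x : Form E M k) := by
  rw [isSmoothForm_iff]
  intro c y hy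
  exact (contDiffAt_comp_chart hh hy).smul (ha.contDiffAt hy)

/-- The value of a form at `x`, read in the preferred chart around `x`. -/
theorem chartRep_self [IsManifold 𝓘(ℝ, E) ∞ M] {k : ℕ} (η : Form E M k) (x : M) :
    chartRep x η (extChartAt 𝓘(ℝ, E) x x) = η.at x := by
  rw [chartRep_eq, tder_chart_symm_self, extChartAt_to_inv]
  rfl

variable (E) in
/-- The differential of a function, as a 1-form. -/
noncomputable def differential (h : M → ℝ) : Form E M 1 := fun x =>
  ContinuousAlternatingMap.ofSubsingleton ℝ E ℝ (0 : Fin 1) (tder E ℝ h x)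

theorem chartRep_differential [IsManifold 𝓘(ℝ, E) ∞ M] {h : M → ℝ} {c : M} {y : E}
    (hh : ContMDiff 𝓘(ℝ, E) 𝓘(ℝ, ℝ) ∞ h) (hy : y ∈ (extChartAt 𝓘(ℝ, E) c).target) :
    chartRep c (differential E h) y = ContinuousAlternatingMap.ofSubsingleton ℝ E ℝ (0 : Fin 1)
      (fderiv ℝ (fun z => h ((extChartAt 𝓘(ℝ, E) c).symm z)) y) := by
  have h1 := tder_comp y (hh.mdifferentiable (by simp) _) (mdifferentiableAt_extChartAt_symm hy)
  rw [tder_eq_fderiv] at h1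
  have h2 : fderiv ℝ (fun z => h ((extChartAt 𝓘(ℝ, E) c).symm z)) y = _ := h1
  rw [h2]
  rfl

theorem isSmoothForm_differential [IsManifold 𝓘(ℝ, E) ∞ M] {h : M → ℝ}
    (hh : ContMDiff 𝓘(ℝ, E) 𝓘(ℝ, ℝ) ∞ h) : IsSmoothForm (differential E h : Form E M 1) := by
  rw [isSmoothForm_iff]
  intro c y hy
  have h1 : ContDiffAt ℝ ∞ (fderiv ℝ (fun z => h ((extChartAt 𝓘(ℝ, E) c).symm z))) y :=
    (contDiffAt_comp_chart hh hy).fderiv_right (by simp)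
  refine ((ContinuousAlternatingMap.ofSubsingletonLIE (𝕜 := ℝ) (E := E) (F := ℝ)
    (0 : Fin 1)).contDiff.contDiffAt.comp y h1).congr_of_eventuallyEq ?_
  filter_upwards [chart_target_mem_nhds hy] with z hz
  exact chartRep_differential hh hz

theorem extd_smul_fun [IsManifold 𝓘(ℝ, E) ∞ M] {k : ℕ} {h : M → ℝ} {a : Form E M k}
    (hh : ContMDiff 𝓘(ℝ, E) 𝓘(ℝ, ℝ) ∞ h) (ha : IsSmoothForm a) :
    extd (fun x => h x • a x : Form E M k) =
      wedge (differential E h) a + (fun x => h x • extd a x : Form E M (k + 1)) := by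
  apply form_eq_of_chartRep
  intro c y hy
  rw [chartRep_extd (ha.smul_fun hh) hy, chartRep_add, Pi.add_apply, chartRep_wedge,
    chartRep_differential hh hy, chartRep_smul_fun, chartRep_extd ha hy]
  exact extDeriv_smul_form ((contDiffAt_comp_chart hh hy).differentiableAt (by simp))
    ((ha.contDiffAt hy).differentiableAt (by simp))

end FormCalculus

/-! ### 3-forms and determinants -/

section TopForms

/-- Every alternating 3-form on `E3` is a multiple of the determinant in the standard basis. This
produces the Jacobian in changes of variables. -/
theorem compContinuousLinearMap_apply_basis (η : E3 [⋀^Fin 3]→L[ℝ] ℝ) (L : E3 →L[ℝ] E3) :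
    η.compContinuousLinearMap L (fun i => EuclideanSpace.single i (1 : ℝ)) =
      L.det * η (fun i => EuclideanSpace.single i (1 : ℝ)) := by
  have h := AlternatingMap.eq_smul_basis_det (EuclideanSpace.basisFun (Fin 3) ℝ).toBasis
    η.toAlternatingMap
  have hb : (EuclideanSpace.basisFun (Fin 3) ℝ).toBasis =
      (fun i => EuclideanSpace.single i (1 : ℝ) : Fin 3 → E3) := by
    ext i; simp
  have h2 := congrArg (fun g => g (L ∘ (EuclideanSpace.basisFun (Fin 3) ℝ).toBasis)) h
  have h3 : (EuclideanSpace.basisFun (Fin 3) ℝ).toBasis.det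
      ((L : E3 →ₗ[ℝ] E3) ∘ (EuclideanSpace.basisFun (Fin 3) ℝ).toBasis) =
        LinearMap.det (L : E3 →ₗ[ℝ] E3) := by
    rw [Module.Basis.det_comp, Module.Basis.det_self, mul_one]
  simp only [AlternatingMap.smul_apply, smul_eq_mul] at h2
  have h4 : (L : E3 →ₗ[ℝ] E3) ∘ (EuclideanSpace.basisFun (Fin 3) ℝ).toBasis =
    L ∘ (EuclideanSpace.basisFun (Fin 3) ℝ).toBasis := rfl
  rw [h4] at h3
  rw [h3, hb] at h2
  rw [ContinuousLinearMap.det, mul_comm]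
  exact h2

end TopForms

/-! ### Integration of 3-forms: change of variables and Stokes' theorem -/

section Integration

open MeasureTheory

variable {X : Type*} [TopologicalSpace X] [ChartedSpace E3 X] [IsManifold 𝓘(ℝ, E3) ∞ X]

/-- The preferred chart around the image point has the identity as derivative there, so the
derivative of the inverse chart is that of a transition map. The positivity in `OrientedAtlas` then
applies to it. -/
theorem tder_chart_symm_eq {c : X} {y : E3} (hy : y ∈ (extChartAt 𝓘(ℝ, E3) c).target) :
    tder E3 E3 (extChartAt 𝓘(ℝ, E3) c).symm y =
      fderiv ℝ (readIn E3 E3 c ((extChartAt 𝓘(ℝ, E3) c).symm y) id) y := by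
  have h := tder_symm_readIn (f := (id : X → X)) hy contMDiffAt_id
    (mem_extChartAt_source (I := 𝓘(ℝ, E3)) _)
  have h2 : readIn E3 E3 c ((extChartAt 𝓘(ℝ, E3) c).symm y) id y =
      extChartAt 𝓘(ℝ, E3) ((extChartAt 𝓘(ℝ, E3) c).symm y) ((extChartAt 𝓘(ℝ, E3) c).symm y) := rfl
  rw [tder_id] at h
  simp only [id] at h
  rw [h2, tder_chart_symm_self] at h
  simpa using h.symm

variable [OrientedAtlas X]

theorem det_tder_chart_symm_pos {c : X} {y : E3} (hy : y ∈ (extChartAt 𝓘(ℝ, E3) c).target) :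
    0 < (tder E3 E3 (extChartAt 𝓘(ℝ, E3) c).symm y).det := by
  rw [tder_chart_symm_eq hy]
  refine OrientedAtlas.det_pos (chartAt E3 c) (chart_mem_atlas E3 c)
    (chartAt E3 ((extChartAt 𝓘(ℝ, E3) c).symm y)) (chart_mem_atlas E3 _) y ?_
  rw [OpenPartialHomeomorph.trans_source]
  exact ⟨by simpa using hy, mem_chart_source E3 ((extChartAt 𝓘(ℝ, E3) c).symm y)⟩

/-- Determinants of both sides of `tder_symm_readIn`: the other three factors are positive, by the
orientation of the atlas and of `f`. -/
theorem det_fderiv_readIn_pos {f : X → X} {c c' : X} {y : E3}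
    (hf : ContMDiff 𝓘(ℝ, E3) 𝓘(ℝ, E3) ∞ f) (hof : OrientationPreserving f)
    (hy : y ∈ (extChartAt 𝓘(ℝ, E3) c).target)
    (hy' : f ((extChartAt 𝓘(ℝ, E3) c).symm y) ∈ (extChartAt 𝓘(ℝ, E3) c').source) :
    0 < (fderiv ℝ (readIn E3 E3 c c' f) y).det := by
  have h := congrArg ContinuousLinearMap.det (tder_symm_readIn hy hf.contMDiffAt hy')
  have hdet : ∀ A B : E3 →L[ℝ] E3, (A.comp B).det = A.det * B.det := fun A B => by
    simp [ContinuousLinearMap.det]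
  rw [hdet, hdet] at h
  have h1 := det_tder_chart_symm_pos ((extChartAt 𝓘(ℝ, E3) c').map_source hy')
  have h2 := det_tder_chart_symm_pos hy
  have h3 : 0 < (tder E3 E3 f ((extChartAt 𝓘(ℝ, E3) c).symm y)).det := hof _
  have h4 := mul_pos h3 h2
  rw [← h] at h4
  exact (pos_iff_pos_of_mul_pos h4).1 h1

theorem orientationPreserving_id : OrientationPreserving (id : X → X) := by
  intro x
  have h := tder_id (E := E3) x
  change 0 < ContinuousLinearMap.det (tder E3 E3 (id : X → X) x)
  rw [h]
  simp [ContinuousLinearMap.det]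

/-- The contribution of the chart around `c` to the integral of the 3-form `η` with weight `u`. -/
noncomputable def chartIntegral (c : X) (K : Set X) (u : X → ℝ) (η : Form E3 X 3) : ℝ :=
  ∫ y in (extChartAt 𝓘(ℝ, E3) c).target ∩ (extChartAt 𝓘(ℝ, E3) c).symm ⁻¹' K,
    u ((extChartAt 𝓘(ℝ, E3) c).symm y) *
      chartRep c η y (fun i => EuclideanSpace.single i (1 : ℝ))

theorem measurableSet_chart_preimage (c : X) {K : Set X} (hK : IsClosed K) :
    MeasurableSet ((extChartAt 𝓘(ℝ, E3) c).target ∩ (extChartAt 𝓘(ℝ, E3) c).symm ⁻¹' K) := by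
  have h := (continuousOn_extChartAt_symm (I := 𝓘(ℝ, E3)) c).isOpen_inter_preimage
    (isOpen_extChartAt_target c) hK.isOpen_compl
  have h2 : (extChartAt 𝓘(ℝ, E3) c).target ∩ (extChartAt 𝓘(ℝ, E3) c).symm ⁻¹' K =
      (extChartAt 𝓘(ℝ, E3) c).target \
        ((extChartAt 𝓘(ℝ, E3) c).target ∩ (extChartAt 𝓘(ℝ, E3) c).symm ⁻¹' Kᶜ) := by
    ext y; simp
  rw [h2]
  exact (isOpen_extChartAt_target c).measurableSet.diff h.measurableSet

/-- Change of variables from the chart around `c` to the chart around `c'`. -/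
theorem chartIntegral_pullback (f : Diffeomorph 𝓘(ℝ, E3) 𝓘(ℝ, E3) X X ∞)
    (hof : OrientationPreserving f) (c c' : X) {K : Set X} (hK : IsClosed K) {u : X → ℝ}
    (hu : ∀ x, u x ≠ 0 → x ∈ (extChartAt 𝓘(ℝ, E3) c).source ∧
      f x ∈ (extChartAt 𝓘(ℝ, E3) c').source) (η : Form E3 X 3) :
    chartIntegral c K u (pullback f η) = chartIntegral c' (f '' K) (u ∘ f.symm) η := by
  set S := (extChartAt 𝓘(ℝ, E3) c).target ∩ (extChartAt 𝓘(ℝ, E3) c).symm ⁻¹' K with hS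
  -- `U` is the part of the chart around `c` that `f` sends into the chart around `c'`. By `hu` the
  -- weight vanishes off it, so both integrals reduce to `S ∩ U` and its image, between which `φ` is
  -- a smooth bijection.
  set U := (extChartAt 𝓘(ℝ, E3) c).target ∩ (extChartAt 𝓘(ℝ, E3) c).symm ⁻¹'
    (f ⁻¹' (extChartAt 𝓘(ℝ, E3) c').source) with hU
  have hUo : IsOpen U := (continuousOn_extChartAt_symm (I := 𝓘(ℝ, E3)) c).isOpen_inter_preimage
    (isOpen_extChartAt_target c) ((isOpen_extChartAt_source c').preimage f.continuous)
  have hSm : MeasurableSet S := measurableSet_chart_preimage c hK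
  set φ := readIn E3 E3 c c' f with hφ
  have hφy : ∀ y ∈ U, (extChartAt 𝓘(ℝ, E3) c').symm (φ y) =
      f ((extChartAt 𝓘(ℝ, E3) c).symm y) := fun y hy => (extChartAt 𝓘(ℝ, E3) c').left_inv hy.2
  have hinj : Set.InjOn φ (S ∩ U) := by
    intro y hy z hz hyz
    have h1 := congrArg (extChartAt 𝓘(ℝ, E3) c').symm hyz
    rw [hφy y hy.2, hφy z hz.2] at h1
    exact (extChartAt 𝓘(ℝ, E3) c).symm.injOn hy.2.1 hz.2.1 (f.injective h1)
  have himg : φ '' (S ∩ U) = ((extChartAt 𝓘(ℝ, E3) c').target ∩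
      (extChartAt 𝓘(ℝ, E3) c').symm ⁻¹' (f '' K)) ∩
      (extChartAt 𝓘(ℝ, E3) c').symm ⁻¹' (f '' (extChartAt 𝓘(ℝ, E3) c).source) := by
    ext z
    constructor
    · rintro ⟨y, ⟨hy1, hy2⟩, rfl⟩
      refine ⟨⟨(extChartAt 𝓘(ℝ, E3) c').map_source hy2.2, ?_⟩, ?_⟩
      · exact ⟨_, hy1.2, (hφy y hy2).symm⟩
      · exact ⟨_, (extChartAt 𝓘(ℝ, E3) c).map_target hy2.1, (hφy y hy2).symm⟩
    · rintro ⟨⟨hz1, ⟨x, hxK, hx⟩⟩, ⟨x', hx's, hx'⟩⟩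
      obtain rfl : x = x' := f.injective (hx.trans hx'.symm)
      have hl := (extChartAt 𝓘(ℝ, E3) c).left_inv hx's
      have ht := (extChartAt 𝓘(ℝ, E3) c).map_source hx's
      refine ⟨extChartAt 𝓘(ℝ, E3) c x, ⟨⟨ht, ?_⟩, ⟨ht, ?_⟩⟩, ?_⟩
      · simpa only [Set.mem_preimage, hl] using hxK
      · simp only [Set.mem_preimage, hl, hx]
        exact (extChartAt 𝓘(ℝ, E3) c').map_target hz1
      · simp only [hφ, readIn, Function.comp_apply, hl, hx]
        exact (extChartAt 𝓘(ℝ, E3) c').right_inv hz1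
  have e1 : chartIntegral c K u (pullback f η) = ∫ y in S ∩ U,
      u ((extChartAt 𝓘(ℝ, E3) c).symm y) *
      chartRep c (pullback f η) y (fun i => EuclideanSpace.single i (1 : ℝ)) := by
    refine (setIntegral_eq_of_subset_of_forall_sdiff_eq_zero hSm Set.inter_subset_left ?_)
    intro y hy
    by_contra hne
    exact hy.2 ⟨hy.1, hy.1.1, (hu _ (left_ne_zero_of_mul hne)).2⟩
  have hm : MeasurableSet ((extChartAt 𝓘(ℝ, E3) c').target ∩
      (extChartAt 𝓘(ℝ, E3) c').symm ⁻¹' (f '' K)) :=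
    measurableSet_chart_preimage c' (f.toHomeomorph.isClosedMap _ hK)
  have e2 : chartIntegral c' (f '' K) (u ∘ f.symm) η = ∫ z in φ '' (S ∩ U),
      (u ∘ f.symm) ((extChartAt 𝓘(ℝ, E3) c').symm z) *
      chartRep c' η z (fun i => EuclideanSpace.single i (1 : ℝ)) := by
    rw [himg]
    refine (setIntegral_eq_of_subset_of_forall_sdiff_eq_zero hm Set.inter_subset_left ?_)
    intro y hy
    by_contra hne
    exact hy.2 ⟨hy.1, ⟨_, (hu _ (left_ne_zero_of_mul hne)).1, by simp⟩⟩
  rw [e1, e2, integral_image_eq_integral_abs_det_fderiv_smul volume (hSm.inter hUo.measurableSet)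
    (f' := fderiv ℝ φ) _ hinj]
  · refine setIntegral_congr_fun (hSm.inter hUo.measurableSet) ?_
    intro y hy
    simp only
    have hp := det_fderiv_readIn_pos f.contMDiff hof hy.2.1 hy.2.2
    rw [chartRep_pullback η hy.2.1 f.contMDiff.contMDiffAt hy.2.2,
      compContinuousLinearMap_apply_basis, hφy y hy.2]
    -- The change of variables in measure theory involves the absolute value of the Jacobian, the
    -- pullback of a form the Jacobian itself; preservation of orientation makes them equal.
    have hp' : |(fderiv ℝ φ y).det| = (fderiv ℝ φ y).det := abs_of_pos hp
    rw [hp']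
    simp only [Function.comp_apply, Diffeomorph.symm_apply_apply, smul_eq_mul]
    ring
  · intro y hy
    exact ((contDiffAt_readIn hy.2.1 f.contMDiff.contMDiffAt hy.2.2).differentiableAt
      (by simp)).hasFDerivAt.hasFDerivWithinAt

theorem chartIntegrand_continuousOn {u : X → ℝ} (hu : Continuous u) {η : Form E3 X 3}
    (hη : IsSmoothForm η) (c : X) : ContinuousOn (fun y => u ((extChartAt 𝓘(ℝ, E3) c).symm y) *
      chartRep c η y (fun i => EuclideanSpace.single i (1 : ℝ))) (extChartAt 𝓘(ℝ, E3) c).target := by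
  refine (hu.comp_continuousOn (continuousOn_extChartAt_symm c)).mul ?_
  exact ((ContinuousAlternatingMap.apply ℝ E3 ℝ
    (fun i : Fin 3 => EuclideanSpace.single i (1 : ℝ))).continuous.comp_continuousOn
      (hη c).continuousOn)

/-- A closed subset `T` of the chart domain, intersected with a compact set. -/
theorem isCompact_chart_image {T : Set X} {c : X} {K : Set X} (hK : IsCompact K)
    (hT : IsClosed T) (hTs : T ⊆ (extChartAt 𝓘(ℝ, E3) c).source) :
    IsCompact (extChartAt 𝓘(ℝ, E3) c '' (K ∩ T)) :=
  (hK.inter_right hT).image_of_continuousOn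
    ((continuousOn_extChartAt c).mono (Set.inter_subset_right.trans hTs))

theorem chart_image_subset {T : Set X} {c : X} {K : Set X}
    (hTs : T ⊆ (extChartAt 𝓘(ℝ, E3) c).source) :
    extChartAt 𝓘(ℝ, E3) c '' (K ∩ T) ⊆
      (extChartAt 𝓘(ℝ, E3) c).target ∩ (extChartAt 𝓘(ℝ, E3) c).symm ⁻¹' K := by
  rintro _ ⟨x, hx, rfl⟩
  refine ⟨(extChartAt 𝓘(ℝ, E3) c).map_source (hTs hx.2), ?_⟩
  simp only [Set.mem_preimage, (extChartAt 𝓘(ℝ, E3) c).left_inv (hTs hx.2)]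
  exact hx.1

variable [T2Space X]

/-- The domain of integration need not be compact, since `K` may leave the chart. The integrand
vanishes off the image of the compact set `K ∩ T`, on which it is continuous. -/
theorem integrableOn_chartIntegrand {u : X → ℝ} (hu : Continuous u) {η : Form E3 X 3}
    (hη : IsSmoothForm η) {c : X} {K T : Set X} (hK : IsCompact K) (hT : IsClosed T)
    (hTs : T ⊆ (extChartAt 𝓘(ℝ, E3) c).source) (h0 : ∀ x ∉ T, u x • η.at x = 0) :
    IntegrableOn (fun y => u ((extChartAt 𝓘(ℝ, E3) c).symm y) *
      chartRep c η y (fun i => EuclideanSpace.single i (1 : ℝ)))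
      ((extChartAt 𝓘(ℝ, E3) c).target ∩ (extChartAt 𝓘(ℝ, E3) c).symm ⁻¹' K) := by
  have h1 := ((chartIntegrand_continuousOn hu hη c).mono
    ((chart_image_subset (K := K) hTs).trans Set.inter_subset_left)).integrableOn_compact
      (μ := volume) (isCompact_chart_image hK hT hTs)
  refine h1.of_forall_sdiff_eq_zero (measurableSet_chart_preimage c hK.isClosed) ?_
  intro y hy
  have hyT : (extChartAt 𝓘(ℝ, E3) c).symm y ∉ T := fun h =>
    hy.2 ⟨_, ⟨hy.1.2, h⟩, (extChartAt 𝓘(ℝ, E3) c).right_inv hy.1.1⟩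
  exact congrArg (fun g => (g.compContinuousLinearMap
    (tder E3 E3 (extChartAt 𝓘(ℝ, E3) c).symm y)) (fun i => EuclideanSpace.single i (1 : ℝ)))
    (h0 _ hyT)

variable [SigmaCompactSpace X]

theorem tsupport_chartPartition_subset (c : X) :
    tsupport (chartPartition X c) ⊆ (extChartAt 𝓘(ℝ, E3) c).source := by
  rw [extChartAt_source]
  exact (SmoothPartitionOfUnity.exists_isSubordinate_chartAt_source 𝓘(ℝ, E3) X).choose_spec c

theorem continuous_chartPartition (c : X) : Continuous (chartPartition X c) :=
  (chartPartition X c).contMDiff.continuous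

theorem formIntegral_eq_finsum (K : Set X) (η : Form E3 X 3) :
    formIntegral K η = ∑ᶠ c : X, chartIntegral c K (chartPartition X c) η := rfl

/-- Only the products of weight and form are compared, so the weight may be changed freely where the
form vanishes. -/
theorem chartIntegral_congr {c : X} {K : Set X} (hK : IsClosed K) {u u' : X → ℝ} {η η' : Form E3 X 3}
    (hu : ∀ x ∈ K, x ∈ (extChartAt 𝓘(ℝ, E3) c).source → u x • η.at x = u' x • η'.at x) :
    chartIntegral c K u η = chartIntegral c K u' η' := by
  refine setIntegral_congr_fun (measurableSet_chart_preimage c hK) fun y hy => ?_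
  have h := hu _ hy.2 ((extChartAt 𝓘(ℝ, E3) c).map_target hy.1)
  have h2 := congrArg (fun g => (g.compContinuousLinearMap
    (tder E3 E3 (extChartAt 𝓘(ℝ, E3) c).symm y)) (fun i => EuclideanSpace.single i (1 : ℝ))) h
  exact h2

theorem chartIntegral_eq_zero {c : X} {K : Set X} (hK : IsClosed K) {u : X → ℝ} {η : Form E3 X 3}
    (hu : ∀ x ∈ K, u x = 0) : chartIntegral c K u η = 0 := by
  rw [chartIntegral_congr hK (u' := 0) (η' := η) (fun x hx _ => by rw [hu x hx]; rfl)]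
  simp [chartIntegral]

/-- Finitely many charts suffice to integrate over a compact set. -/
theorem exists_finset_chartPartition {K : Set X} (hK : IsCompact K) :
    ∃ s : Finset X, (∀ c ∉ s, ∀ x ∈ K, chartPartition X c x = 0) ∧
      ∀ x ∈ K, ∑ c ∈ s, chartPartition X c x = 1 := by
  classical
  have hf := (chartPartition X).locallyFinite.finite_nonempty_inter_compact hK
  refine ⟨hf.toFinset, ?_, ?_⟩
  · intro c hc x hx
    by_contra hne
    exact hc (hf.mem_toFinset.2 ⟨x, hne, hx⟩)
  · intro x hx
    rw [← (chartPartition X).sum_eq_one (Set.mem_univ x), finsum_eq_sum_of_support_subset]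
    intro c hc
    exact hf.mem_toFinset.2 ⟨x, hc, hx⟩

theorem formIntegral_eq_sum {K : Set X} (hK : IsClosed K) {s : Finset X}
    (hs : ∀ c ∉ s, ∀ x ∈ K, chartPartition X c x = 0) (η : Form E3 X 3) :
    formIntegral K η = ∑ c ∈ s, chartIntegral c K (chartPartition X c) η := by
  rw [formIntegral_eq_finsum, finsum_eq_sum_of_support_subset]
  intro c hc
  by_contra hcs
  exact hc (chartIntegral_eq_zero hK (hs c hcs))

theorem formIntegral_congr {K : Set X} (hK : IsClosed K) {η η' : Form E3 X 3}
    (h : ∀ x ∈ K, η.at x = η'.at x) : formIntegral K η = formIntegral K η' := by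
  rw [formIntegral_eq_finsum, formIntegral_eq_finsum]
  exact finsum_congr fun c => chartIntegral_congr hK fun x hx _ => by rw [h x hx]

theorem integrableOn_partition {η : Form E3 X 3} (hη : IsSmoothForm η) {K : Set X}
    (hK : IsCompact K) (c : X) :
    IntegrableOn (fun y => chartPartition X c ((extChartAt 𝓘(ℝ, E3) c).symm y) *
      chartRep c η y (fun i => EuclideanSpace.single i (1 : ℝ)))
      ((extChartAt 𝓘(ℝ, E3) c).target ∩ (extChartAt 𝓘(ℝ, E3) c).symm ⁻¹' K) :=
  integrableOn_chartIntegrand (continuous_chartPartition c) hη hK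
    (isClosed_tsupport (chartPartition X c))
    (tsupport_chartPartition_subset c) fun x hx => by
      rw [image_eq_zero_of_notMem_tsupport hx, zero_smul]

theorem chartIntegral_sum {ι : Type*} {c : X} {K T : Set X} (hK : IsCompact K) (s : Finset ι)
    {u : ι → X → ℝ} (hu : ∀ i ∈ s, Continuous (u i)) (hT : IsClosed T)
    (hTs : T ⊆ (extChartAt 𝓘(ℝ, E3) c).source) {η : Form E3 X 3}
    (h0 : ∀ i ∈ s, ∀ x ∉ T, u i x • η.at x = 0) (hη : IsSmoothForm η) :
    chartIntegral c K (fun x => ∑ i ∈ s, u i x) η = ∑ i ∈ s, chartIntegral c K (u i) η := by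
  rw [chartIntegral]
  simp only [Finset.sum_mul]
  exact integral_finsetSum s fun i hi =>
    integrableOn_chartIntegrand (hu i hi) hη hK hT hTs (h0 i hi)

theorem formIntegral_add {K : Set X} (hK : IsCompact K) {η η' : Form E3 X 3}
    (hη : IsSmoothForm η) (hη' : IsSmoothForm η') :
    formIntegral K (η + η') = formIntegral K η + formIntegral K η' := by
  obtain ⟨s, hs, -⟩ := exists_finset_chartPartition hK
  simp only [formIntegral_eq_sum hK.isClosed hs, ← Finset.sum_add_distrib]
  refine Finset.sum_congr rfl fun c _ => ?_
  rw [chartIntegral, chartIntegral, chartIntegral, ← integral_add]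
  · refine integral_congr_ae (Filter.Eventually.of_forall fun y => ?_)
    simp only [chartRep_add, Pi.add_apply, ContinuousAlternatingMap.add_apply]
    ring
  · exact integrableOn_partition hη hK c
  · exact integrableOn_partition hη' hK c

theorem formIntegral_smul {K : Set X} (hK : IsCompact K) (r : ℝ) (η : Form E3 X 3) :
    formIntegral K (r • η) = r * formIntegral K η := by
  obtain ⟨s, hs, -⟩ := exists_finset_chartPartition hK
  simp only [formIntegral_eq_sum hK.isClosed hs, Finset.mul_sum]
  refine Finset.sum_congr rfl fun c _ => ?_
  rw [chartIntegral, chartIntegral, ← integral_const_mul]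
  refine integral_congr_ae (Filter.Eventually.of_forall fun y => ?_)
  have h : chartRep c (r • η) y = r • chartRep c η y := rfl
  simp only [h, ContinuousAlternatingMap.smul_apply, smul_eq_mul]
  ring

theorem formIntegral_sub {K : Set X} (hK : IsCompact K) {η η' : Form E3 X 3}
    (hη : IsSmoothForm η) (hη' : IsSmoothForm η') :
    formIntegral K (η - η') = formIntegral K η - formIntegral K η' := by
  have h := formIntegral_add hK (hη.sub hη') hη'
  rw [sub_add_cancel] at h
  linarith

/-- The integral of 3-forms is invariant under orientation preserving diffeomorphisms. -/
theorem formIntegral_pullback (f : Diffeomorph 𝓘(ℝ, E3) 𝓘(ℝ, E3) X X ∞)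
    (hof : OrientationPreserving f) {K : Set X} (hK : IsCompact K) {η : Form E3 X 3}
    (hη : IsSmoothForm η) : formIntegral K (pullback f η) = formIntegral (f '' K) η := by
  have hfK : IsCompact (f '' K) := hK.image f.continuous
  obtain ⟨s, hs, hs1⟩ := exists_finset_chartPartition hK
  obtain ⟨s', hs', hs1'⟩ := exists_finset_chartPartition hfK
  rw [formIntegral_eq_sum hK.isClosed hs, formIntegral_eq_sum hfK.isClosed hs']
  have hcs : ∀ c, Continuous (chartPartition X c) := continuous_chartPartition
  -- Both sides are refined with the partition of unity of the other side, to the weights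
  -- $\rho_c(x)\,\rho_{c'}(f(x))$. Each refined term lies in one pair of charts, where
  -- `chartIntegral_pullback` applies.
  have e1 : ∀ c, chartIntegral c K (chartPartition X c) (pullback f η) = ∑ c' ∈ s',
      chartIntegral c K (fun x => chartPartition X c x * chartPartition X c' (f x)) (pullback f η) := by
    intro c
    rw [← chartIntegral_sum hK s'
      (u := fun c' x => chartPartition X c x * chartPartition X c' (f x)) (fun i _ => (hcs c).mul ((hcs i).comp f.continuous))
      (isClosed_tsupport _) (tsupport_chartPartition_subset c) (fun i _ x hx => by
        rw [image_eq_zero_of_notMem_tsupport hx, zero_mul, zero_smul]) (hη.pullback f.contMDiff)]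
    refine chartIntegral_congr hK.isClosed fun x hx _ => ?_
    rw [← Finset.mul_sum, hs1' (f x) ⟨x, hx, rfl⟩, mul_one]
  have e2 : ∀ c', chartIntegral c' (f '' K) (chartPartition X c') η = ∑ c ∈ s,
      chartIntegral c' (f '' K) (fun x => chartPartition X c (f.symm x) * chartPartition X c' x) η := by
    intro c'
    rw [← chartIntegral_sum hfK s
      (u := fun c x => chartPartition X c (f.symm x) * chartPartition X c' x) (fun i _ => ((hcs i).comp f.symm.continuous).mul (hcs c'))
      (isClosed_tsupport _) (tsupport_chartPartition_subset c') (fun i _ x hx => by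
        rw [image_eq_zero_of_notMem_tsupport hx, mul_zero, zero_smul]) hη]
    refine chartIntegral_congr hfK.isClosed fun x hx _ => ?_
    obtain ⟨z, hz, rfl⟩ := hx
    rw [← Finset.sum_mul, f.symm_apply_apply, hs1 z hz, one_mul]
  simp only [e1, e2]
  rw [Finset.sum_comm]
  refine Finset.sum_congr rfl fun c' _ => Finset.sum_congr rfl fun c _ => ?_
  rw [chartIntegral_pullback f hof c c' hK.isClosed]
  · congr 1
    funext x
    simp
  · intro x hx
    exact ⟨tsupport_chartPartition_subset c (subset_tsupport _ (left_ne_zero_of_mul hx)),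
      tsupport_chartPartition_subset c' (subset_tsupport _ (right_ne_zero_of_mul hx))⟩

/-- The integral of an exact form with compact support over `E3` vanishes. -/
theorem integral_extDeriv_eq_zero {g : E3 → E3 [⋀^Fin 2]→L[ℝ] ℝ} (hg : ContDiff ℝ ∞ g)
    (hc : HasCompactSupport g) (v : Fin 3 → E3) : ∫ y, extDeriv g y v = 0 := by
  have hd : ∀ y, extDeriv g y v =
      ∑ i : Fin 3, (-1 : ℝ) ^ i.val * fderiv ℝ (fun z => g z (i.removeNth v)) y (v i) := fun y => by
    simpa using extDeriv_apply ((hg.differentiable (by simp)) y) v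
  simp only [hd]
  have hgi : ∀ i : Fin 3, ContDiff ℝ ∞ (fun z => g z (i.removeNth v)) := fun i =>
    (ContinuousAlternatingMap.apply ℝ E3 ℝ (i.removeNth v)).contDiff.comp hg
  have hci : ∀ i : Fin 3, HasCompactSupport (fun z => g z (i.removeNth v)) := fun i =>
    hc.comp_left (g := fun w : E3 [⋀^Fin 2]→L[ℝ] ℝ => w (i.removeNth v)) rfl
  have hcd : ∀ i : Fin 3, Continuous (fun y => fderiv ℝ (fun z => g z (i.removeNth v)) y (v i)) :=
    fun i => ((hgi i).continuous_fderiv (by simp)).clm_apply continuous_const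
  have hcc : ∀ i : Fin 3, HasCompactSupport
      (fun y => fderiv ℝ (fun z => g z (i.removeNth v)) y (v i)) := fun i =>
    ((hci i).fderiv ℝ).comp_left (g := fun L : E3 →L[ℝ] ℝ => L (v i)) rfl
  have hint : ∀ i : Fin 3, Integrable
      (fun y => fderiv ℝ (fun z => g z (i.removeNth v)) y (v i)) := fun i =>
    (hcd i).integrable_of_hasCompactSupport (hcc i)
  rw [integral_finsetSum _ fun i _ => (hint i).const_mul _]
  refine Finset.sum_eq_zero fun i _ => ?_
  rw [integral_const_mul]
  -- Integration by parts against the constant function 1: the integral of a directional derivative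
  -- of a compactly supported function is zero.
  have h := integral_bilinear_hasFDerivAt_right_eq_neg_left_of_integrable (μ := volume)
    (f := fun _ : E3 => (1 : ℝ)) (f' := fun _ => 0)
    (g := fun z => g z (i.removeNth v)) (g' := fun y => fderiv ℝ (fun z => g z (i.removeNth v)) y)
    (v := v i) (B := ContinuousLinearMap.mul ℝ ℝ) (by simp) (by simpa using hint i)
    (by simpa using (hgi i).continuous.integrable_of_hasCompactSupport (hci i))
    (fun x _ => hasFDerivAt_const _ _)
    (fun x _ => ((hgi i).differentiable (by simp) x).hasFDerivAt)
  simp at h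
  rw [h, mul_zero]

/-- Stokes' theorem for a form supported in a compact subset of a chart domain. -/
theorem chartIntegral_one_extd {c : X} {η : Form E3 X 2} (hη : IsSmoothForm η) {K T : Set X}
    (hK : IsCompact K) (hT : IsClosed T) (hTs : T ⊆ (extChartAt 𝓘(ℝ, E3) c).source)
    (h0 : ∀ x ∉ K ∩ T, η.at x = 0) :
    chartIntegral c K (fun _ => 1) (extd η) = 0 := by
  classical
  set C := extChartAt 𝓘(ℝ, E3) c '' (K ∩ T) with hC
  have hCc : IsCompact C := isCompact_chart_image hK hT hTs
  have hCt : C ⊆ (extChartAt 𝓘(ℝ, E3) c).target ∩ (extChartAt 𝓘(ℝ, E3) c).symm ⁻¹' K :=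
    chart_image_subset hTs
  -- Extension of the representative by zero to all of `E3`. It is smooth because it agrees with
  -- `chartRep c η` on the open chart target and vanishes on the complement of the closed set `C`,
  -- and these two open sets cover `E3`.
  set g : E3 → E3 [⋀^Fin 2]→L[ℝ] ℝ := C.indicator (chartRep c η) with hg
  have hgt : ∀ y ∈ (extChartAt 𝓘(ℝ, E3) c).target, g y = chartRep c η y := by
    intro y hy
    by_cases hyC : y ∈ C
    · exact Set.indicator_of_mem hyC _
    · rw [hg, Set.indicator_of_notMem hyC, chartRep_eq_zero (h0 _ fun hx => hyC ⟨_, hx, ?_⟩)]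
      exact (extChartAt 𝓘(ℝ, E3) c).right_inv hy
  have hge : ∀ y ∈ (extChartAt 𝓘(ℝ, E3) c).target, g =ᶠ[𝓝 y] chartRep c η := fun y hy => by
    filter_upwards [chart_target_mem_nhds hy] with z hz using hgt z hz
  have hgn : ∀ y ∉ C, g =ᶠ[𝓝 y] 0 := fun y hy => by
    filter_upwards [hCc.isClosed.isOpen_compl.mem_nhds hy] with z hz
    exact Set.indicator_of_notMem hz _
  have hgs : ContDiff ℝ ∞ g := by
    rw [contDiff_iff_contDiffAt]
    intro y
    by_cases hyC : y ∈ C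
    · exact (hη.contDiffAt (hCt hyC).1).congr_of_eventuallyEq (hge y (hCt hyC).1)
    · exact contDiffAt_const.congr_of_eventuallyEq (hgn y hyC)
  have hgc : HasCompactSupport g := HasCompactSupport.intro hCc fun y hy =>
    Set.indicator_of_notMem hy _
  have hext0 : ∀ y ∉ C, extDeriv g y = 0 := fun y hy => by
    rw [(hgn y hy).extDeriv_eq, extDeriv_zero_apply]
  have hz := integral_extDeriv_eq_zero hgs hgc (fun i => EuclideanSpace.single i (1 : ℝ))
  rw [← setIntegral_eq_integral_of_forall_compl_eq_zero
      (s := (extChartAt 𝓘(ℝ, E3) c).target ∩ (extChartAt 𝓘(ℝ, E3) c).symm ⁻¹' K)] at hz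
  rw [← hz, chartIntegral]
  · refine setIntegral_congr_fun (measurableSet_chart_preimage c hK.isClosed) fun y hy => ?_
    simp only [one_mul]
    rw [(hge y hy.1).extDeriv_eq, chartRep_extd hη hy.1]
  · intro y hy
    rw [hext0 y fun h => hy (hCt h)]
    rfl

/-- Stokes' theorem for forms with compact support. -/
theorem formIntegral_extd {η : Form E3 X 2} (hη : IsSmoothForm η) {K : Set X}
    (hK : IsCompact K) (h0 : ∀ x ∉ K, η.at x = 0) : formIntegral K (extd η) = 0 := by
  classical
  obtain ⟨s, hs, hs1⟩ := exists_finset_chartPartition hK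
  -- The form is split into pieces supported in single charts; by linearity it suffices to treat one
  -- piece.
  set η' : X → Form E3 X 2 := fun c x => chartPartition X c x • η x with hη'
  have hsm : ∀ c, IsSmoothForm (η' c) := fun c =>
    hη.smul_fun (chartPartition X c).contMDiff
  have hsum : η = ∑ c ∈ s, η' c := by
    apply Form.ext_at
    intro x
    have : (∑ c ∈ s, η' c).at x = (∑ c ∈ s, chartPartition X c x) • η.at x := by
      rw [Finset.sum_smul]
      exact Finset.sum_apply x s η'
    rw [this]
    by_cases hx : x ∈ K
    · rw [hs1 x hx, one_smul]
    · rw [h0 x hx, smul_zero]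
  have hind : ∀ t : Finset X, IsSmoothForm (∑ c ∈ t, η' c) ∧
      formIntegral K (extd (∑ c ∈ t, η' c)) = ∑ c ∈ t, formIntegral K (extd (η' c)) := by
    intro t
    induction t using Finset.induction_on with
    | empty =>
      have h := formIntegral_smul hK 0 (0 : Form E3 X 3)
      rw [zero_smul, zero_mul] at h
      simpa [extd_zero, h] using isSmoothForm_zero
    | insert a t ha ih =>
      rw [Finset.sum_insert ha, Finset.sum_insert ha, extd_add (hsm a) ih.1,
        formIntegral_add hK (hsm a).extd ih.1.extd, ih.2]
      exact ⟨(hsm a).add ih.1, rfl⟩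
  rw [hsum, (hind s).2]
  refine Finset.sum_eq_zero fun c _ => ?_
  have hoff : ∀ x ∉ tsupport (chartPartition X c), (extd (η' c)).at x = 0 := by
    intro x hx
    apply extd_at_eq_zero
    filter_upwards [(isClosed_tsupport _).isOpen_compl.mem_nhds hx] with z hz
    change chartPartition X c z • η.at z = 0
    rw [image_eq_zero_of_notMem_tsupport hz, zero_smul]
  rw [formIntegral_eq_sum hK.isClosed hs]
  -- The piece `η' c` lives in the chart around `c`, while `formIntegral` distributes its derivative
  -- over all charts. Change of variables along the identity moves every term to the chart around
  -- `c`, where the weights add up to 1.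
  have e1 : ∀ c', chartIntegral c' K (chartPartition X c') (extd (η' c)) =
      chartIntegral c K (chartPartition X c') (extd (η' c)) := by
    intro c'
    -- The indicator does not change the integrand, as `extd (η' c)` vanishes off this support, but
    -- it puts the weight inside both chart domains.
    set u : X → ℝ := (tsupport (chartPartition X c)).indicator (chartPartition X c') with hu
    have hu1 : ∀ c'', chartIntegral c'' K (chartPartition X c') (extd (η' c)) =
        chartIntegral c'' K u (extd (η' c)) := fun c'' => by
      refine chartIntegral_congr hK.isClosed fun x _ _ => ?_
      by_cases hx : x ∈ tsupport (chartPartition X c)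
      · rw [hu, Set.indicator_of_mem hx]
      · rw [hoff x hx, smul_zero, smul_zero]
    rw [hu1, hu1]
    have h := chartIntegral_pullback (Diffeomorph.refl 𝓘(ℝ, E3) X ∞) orientationPreserving_id c' c
      hK.isClosed (u := u) ?_ (extd (η' c))
    · have hid : (Diffeomorph.refl 𝓘(ℝ, E3) X ∞ : X → X) = id := rfl
      rw [hid, pullback_id, Set.image_id] at h
      exact h
    · intro x hx
      have hxt : x ∈ tsupport (chartPartition X c) := Set.mem_of_indicator_ne_zero hx
      rw [hu, Set.indicator_of_mem hxt] at hx
      exact ⟨tsupport_chartPartition_subset c' (subset_tsupport _ hx),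
        tsupport_chartPartition_subset c hxt⟩
  simp only [e1]
  rw [← chartIntegral_sum hK s (fun c' _ => continuous_chartPartition c') (isClosed_tsupport _)
    (tsupport_chartPartition_subset c) (fun c' _ x hx => by rw [hoff x hx, smul_zero]) (hsm c).extd,
    ← chartIntegral_one_extd (hsm c) hK (isClosed_tsupport _) (tsupport_chartPartition_subset c)]
  · exact chartIntegral_congr hK.isClosed fun x hx _ => by rw [hs1 x hx]
  · intro x hx
    change chartPartition X c x • η.at x = 0
    by_cases hxK : x ∈ K
    · rw [image_eq_zero_of_notMem_tsupport fun h => hx ⟨hxK, h⟩, zero_smul]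
    · rw [h0 x hxK, smul_zero]

end Integration

/-! ### Differentiation with respect to a parameter -/

section Parametric

open MeasureTheory

variable {E : Type*} [NormedAddCommGroup E] [NormedSpace ℝ E]

/-- The exterior derivative is a fixed linear map applied to the space part of `fderiv ℝ A`. The
parameter derivative passes through it because the second derivative of `A` is symmetric. -/
theorem hasDerivAt_extDeriv_param {k : ℕ} {A : ℝ × E → E [⋀^Fin k]→L[ℝ] ℝ} {ε : ℝ} {y : E}
    (hA : ContDiffAt ℝ ∞ A (ε, y)) :
    HasDerivAt (fun e => extDeriv (fun z => A (e, z)) y)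
      (extDeriv (fun z => fderiv ℝ A (ε, z) (1, 0)) y) ε := by
  have hd : ContDiffAt ℝ ∞ (fderiv ℝ A) (ε, y) := hA.fderiv_right (by simp)
  have hev : ∀ᶠ p in 𝓝 (ε, y), DifferentiableAt ℝ A p := by
    have h1 : ContDiffAt ℝ 1 A (ε, y) := hA.of_le (by simp)
    filter_upwards [h1.eventually (by simp)] with p hp using hp.differentiableAt (by simp)
  have hce : ContinuousAt (fun e : ℝ => (e, y)) ε := by fun_prop
  have h1 : ∀ᶠ e in 𝓝 ε, extDeriv (fun z => A (e, z)) y =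
      ContinuousAlternatingMap.alternatizeUncurryFinCLM ℝ E ℝ
        ((fderiv ℝ A (e, y)).comp (ContinuousLinearMap.inr ℝ ℝ E)) := by
    filter_upwards [hce.eventually hev] with e he
    have h2 : HasFDerivAt (fun z => A (e, z)) ((fderiv ℝ A (e, y)).comp
        (ContinuousLinearMap.inr ℝ ℝ E)) y :=
      he.hasFDerivAt.comp y (hasFDerivAt_prodMk_right e y)
    rw [extDeriv, h2.fderiv]
    rfl
  have h2 := (hd.differentiableAt (by simp)).hasFDerivAt
  have hl : HasDerivAt (fun e : ℝ => (e, y)) ((1 : ℝ), (0 : E)) ε :=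
    (hasDerivAt_id ε).prodMk (hasDerivAt_const ε y)
  have h3 := HasFDerivAt.comp_hasDerivAt (l := fderiv ℝ A) (f := fun e : ℝ => (e, y)) ε h2 hl
  have h4 := (ContinuousAlternatingMap.alternatizeUncurryFinCLM ℝ E ℝ (n := k)).hasFDerivAt.comp_hasDerivAt
    ε (h3.clm_comp (hasDerivAt_const ε (ContinuousLinearMap.inr ℝ ℝ E)))
  have h5i : HasFDerivAt (fun z : E => (ε, z)) (ContinuousLinearMap.inr ℝ ℝ E) y :=
    hasFDerivAt_prodMk_right ε y
  have h5a := HasFDerivAt.comp (g := fderiv ℝ A) (f := fun z : E => (ε, z)) y h2 h5i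
  have h5 : fderiv ℝ (fun z => fderiv ℝ A (ε, z) (1, 0)) y = _ :=
    (h5a.clm_apply (hasFDerivAt_const ((1 : ℝ), (0 : E)) y)).fderiv
  have hsymm := hA.isSymmSndFDerivAt minSmoothness_le_infty
  refine (h4.congr_of_eventuallyEq h1).congr_deriv ?_
  rw [extDeriv, h5]
  change ContinuousAlternatingMap.alternatizeUncurryFin _ = _
  congr 1
  ext v w
  simp
  rw [hsymm.eq]

/-- Differentiation under the integral sign, for a smooth integrand over a compact set. -/
theorem hasDerivAt_setIntegral_of_contDiffAt {f : ℝ × E3 → ℝ} {C : Set E3} (hC : IsCompact C)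
    (hf : ∀ ε, ∀ y ∈ C, ContDiffAt ℝ ∞ f (ε, y)) :
    HasDerivAt (fun ε => ∫ y in C, f (ε, y)) (∫ y in C, fderiv ℝ f (0, y) (1, 0)) 0 := by
  have hcont : ∀ ε, ContinuousOn (fun y => f (ε, y)) C := fun ε y hy =>
    ((hf ε y hy).continuousAt.comp (by fun_prop : ContinuousAt (fun y => (ε, y)) y)).continuousWithinAt
  have hd : ∀ ε, ∀ y ∈ C, ContinuousAt (fun p => fderiv ℝ f p (1, 0)) (ε, y) := fun ε y hy =>
    (((hf ε y hy).fderiv_right (m := ∞) (by simp)).continuousAt).clm_apply continuousAt_const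
  -- The dominating function is a constant: the continuous derivative is bounded on the product of a
  -- compact parameter interval around `0` with `C`.
  have hbd : ∃ B, ∀ p ∈ Metric.closedBall (0 : ℝ) 1 ×ˢ C, ‖fderiv ℝ f p (1, 0)‖ ≤ B :=
    ((isCompact_closedBall (0 : ℝ) 1).prod hC).exists_bound_of_continuousOn
      fun p hp => (hd p.1 p.2 hp.2).continuousWithinAt
  obtain ⟨B, hB⟩ := hbd
  have hae : ∀ {P : E3 → Prop}, (∀ y ∈ C, P y) → ∀ᵐ y ∂(volume.restrict C), P y := fun h =>
    (ae_restrict_iff' hC.measurableSet).2 (Filter.Eventually.of_forall h)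
  refine (hasDerivAt_integral_of_dominated_loc_of_deriv_le (μ := volume.restrict C)
    (F := fun ε y => f (ε, y)) (F' := fun ε y => fderiv ℝ f (ε, y) (1, 0)) (x₀ := 0)
    (s := Metric.ball 0 1) (bound := fun _ => B)
    (Metric.ball_mem_nhds _ one_pos) ?_ ?_ ?_ ?_ ?_ ?_).2
  · exact Filter.Eventually.of_forall fun ε => (hcont ε).aestronglyMeasurable hC.measurableSet
  · exact (hcont 0).integrableOn_compact hC
  · exact ContinuousOn.aestronglyMeasurable (fun y hy => ((hd 0 y hy).comp
      (by fun_prop : ContinuousAt (fun y => ((0 : ℝ), y)) y)).continuousWithinAt) hC.measurableSet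
  · exact hae fun y hy ε hε => hB (ε, y) ⟨Metric.ball_subset_closedBall hε, hy⟩
  · exact integrableOn_const (hs := hC.measure_lt_top.ne)
  · refine hae fun y hy ε _ => ?_
    exact ((hf ε y hy).differentiableAt (by simp)).hasFDerivAt.comp_hasDerivAt ε
      ((hasDerivAt_id ε).prodMk (hasDerivAt_const ε y))

end Parametric

/-! ### Smooth families of forms and the first variation of $\int\eta\wedge d\eta$ -/

section Families

variable {X : Type*} [TopologicalSpace X] [ChartedSpace E3 X]

/-- A family of `k`-forms on `X` which depends smoothly on a parameter. -/
def IsSmoothFamily {k : ℕ} (η : ℝ → Form E3 X k) : Prop :=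
  ∀ (c : X) (ε : ℝ), ∀ y ∈ (extChartAt 𝓘(ℝ, E3) c).target,
    ContDiffAt ℝ ∞ (fun p : ℝ × E3 => chartRep c (η p.1) p.2) (ε, y)

/-- The derivative of a family of forms at parameter `0`. -/
noncomputable def velocity {k : ℕ} (η : ℝ → Form E3 X k) : Form E3 X k := fun x =>
  deriv (fun ε => (η ε).at x) 0

theorem IsSmoothFamily.isSmoothForm {k : ℕ} {η : ℝ → Form E3 X k} (hη : IsSmoothFamily η) (ε : ℝ) :
    IsSmoothForm (η ε) := by
  rw [isSmoothForm_iff]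
  intro c y hy
  exact (hη c ε y hy).comp y (contDiffAt_const.prodMk contDiffAt_id)

variable [IsManifold 𝓘(ℝ, E3) ∞ X]

theorem IsSmoothFamily.hasDerivAt_chartRep {k : ℕ} {η : ℝ → Form E3 X k} (hη : IsSmoothFamily η)
    {c : X} {y : E3} (hy : y ∈ (extChartAt 𝓘(ℝ, E3) c).target) (ε : ℝ) :
    HasDerivAt (fun e => chartRep c (η e) y)
      (fderiv ℝ (fun p : ℝ × E3 => chartRep c (η p.1) p.2) (ε, y) (1, 0)) ε :=
  HasFDerivAt.comp_hasDerivAt (l := fun p : ℝ × E3 => chartRep c (η p.1) p.2)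
    (f := fun e : ℝ => (e, y)) ε
    ((hη c ε y hy).differentiableAt (by simp)).hasFDerivAt
    ((hasDerivAt_id ε).prodMk (hasDerivAt_const ε y))

theorem IsSmoothFamily.chartRep_velocity {k : ℕ} {η : ℝ → Form E3 X k} (hη : IsSmoothFamily η)
    {c : X} {y : E3} (hy : y ∈ (extChartAt 𝓘(ℝ, E3) c).target) :
    chartRep c (velocity η) y =
      fderiv ℝ (fun p : ℝ × E3 => chartRep c (η p.1) p.2) (0, y) (1, 0) := by
  set x := (extChartAt 𝓘(ℝ, E3) c).symm y with hx
  have hxs : x ∈ (extChartAt 𝓘(ℝ, E3) c).source := (extChartAt 𝓘(ℝ, E3) c).map_target hy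
  have hyx : extChartAt 𝓘(ℝ, E3) c x = y := (extChartAt 𝓘(ℝ, E3) c).right_inv hy
  -- `velocity` is a `deriv`, which would be zero without differentiability. So differentiability of
  -- the value at `x` is obtained from the chart first; both passages between chart and point are
  -- fixed continuous linear maps.
  have h1 : HasDerivAt (fun e => (η e).at x) _ 0 :=
    (ContinuousAlternatingMap.compContinuousLinearMapCLM (𝕜 := ℝ) (ι := Fin k) (F := ℝ)
      (tder E3 E3 (extChartAt 𝓘(ℝ, E3) c) x)).hasFDerivAt.comp_hasDerivAt 0
      (hη.hasDerivAt_chartRep hy 0) |>.congr_of_eventuallyEq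
      (Filter.Eventually.of_forall fun e => by
        simp only [at_eq_chartRep (η e) hxs, hyx]; rfl)
  have h2 : HasDerivAt (fun e => chartRep c (η e) y) _ 0 :=
    (ContinuousAlternatingMap.compContinuousLinearMapCLM (𝕜 := ℝ) (ι := Fin k) (F := ℝ)
      (tder E3 E3 (extChartAt 𝓘(ℝ, E3) c).symm y)).hasFDerivAt.comp_hasDerivAt 0
      h1.differentiableAt.hasDerivAt
  exact h2.unique (hη.hasDerivAt_chartRep hy 0)

theorem IsSmoothFamily.isSmoothForm_velocity {k : ℕ} {η : ℝ → Form E3 X k}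
    (hη : IsSmoothFamily η) : IsSmoothForm (velocity η) := by
  rw [isSmoothForm_iff]
  intro c y hy
  have h1 : ContDiffAt ℝ ∞ (fderiv ℝ (fun p : ℝ × E3 => chartRep c (η p.1) p.2)) (0, y) :=
    (hη c 0 y hy).fderiv_right (by simp)
  have h2 : ContDiffAt ℝ ∞ (fun z => fderiv ℝ (fun p : ℝ × E3 => chartRep c (η p.1) p.2) (0, z)
      (1, 0)) y :=
    (ContDiffAt.comp (f := fun z : E3 => ((0 : ℝ), z)) y h1
      (contDiffAt_const.prodMk contDiffAt_id)).clm_apply contDiffAt_const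
  refine h2.congr_of_eventuallyEq ?_
  filter_upwards [chart_target_mem_nhds hy] with z hz
  exact hη.chartRep_velocity hz

theorem IsSmoothFamily.extd {k : ℕ} {η : ℝ → Form E3 X k} (hη : IsSmoothFamily η) :
    IsSmoothFamily (fun ε => extd (η ε)) := by
  intro c ε y hy
  set A := fun p : ℝ × E3 => chartRep c (η p.1) p.2 with hA
  have h1 : ContDiffAt ℝ ∞ (fun p => ContinuousAlternatingMap.alternatizeUncurryFinCLM ℝ E3 ℝ
        ((fderiv ℝ A p).comp (ContinuousLinearMap.inr ℝ ℝ E3))) (ε, y) :=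
    (ContinuousAlternatingMap.alternatizeUncurryFinCLM ℝ E3 ℝ).contDiff.contDiffAt.comp (ε, y)
      (((hη c ε y hy).fderiv_right (by simp)).clm_comp contDiffAt_const)
  refine h1.congr_of_eventuallyEq ?_
  have ho : ∀ᶠ p : ℝ × E3 in 𝓝 (ε, y), p.2 ∈ (extChartAt 𝓘(ℝ, E3) c).target :=
    continuousAt_snd.eventually (chart_target_mem_nhds hy)
  filter_upwards [ho] with p hp
  have h2 : HasFDerivAt (fun z => A (p.1, z)) ((fderiv ℝ A p).comp
      (ContinuousLinearMap.inr ℝ ℝ E3)) p.2 :=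
    ((hη c p.1 p.2 hp).differentiableAt (by simp)).hasFDerivAt.comp p.2
      (hasFDerivAt_prodMk_right p.1 p.2)
  rw [chartRep_extd (hη.isSmoothForm p.1) hp]
  change extDeriv (fun z => A (p.1, z)) p.2 = _
  rw [extDeriv, h2.fderiv]
  rfl

theorem IsSmoothFamily.velocity_extd {k : ℕ} {η : ℝ → Form E3 X k} (hη : IsSmoothFamily η) :
    velocity (fun ε => PoissonCS.extd (η ε)) = PoissonCS.extd (velocity η) := by
  apply form_eq_of_chartRep
  intro c y hy
  have e1 : chartRep c (velocity η) =ᶠ[𝓝 y] fun z =>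
      fderiv ℝ (fun p : ℝ × E3 => chartRep c (η p.1) p.2) (0, z) (1, 0) := by
    filter_upwards [chart_target_mem_nhds hy] with z hz
    exact hη.chartRep_velocity hz
  rw [chartRep_extd hη.isSmoothForm_velocity hy, e1.extDeriv_eq, hη.extd.chartRep_velocity hy]
  refine (hη.extd.hasDerivAt_chartRep hy 0).unique ?_
  refine (hasDerivAt_extDeriv_param (hη c 0 y hy)).congr_of_eventuallyEq
    (Filter.Eventually.of_forall fun e => ?_)
  exact chartRep_extd (hη.isSmoothForm e) hy

theorem IsSmoothFamily.wedge {k : ℕ} {a : ℝ → Form E3 X 1} {b : ℝ → Form E3 X k}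
    (ha : IsSmoothFamily a) (hb : IsSmoothFamily b) : IsSmoothFamily (fun ε => wedge (a ε) (b ε)) := by
  intro c ε y hy
  refine (((wedgeCLM E3 k).contDiff.contDiffAt.comp (ε, y) (ha c ε y hy)).clm_apply
    (hb c ε y hy)).congr_of_eventuallyEq (Filter.Eventually.of_forall fun p => ?_)
  exact chartRep_wedge c (a p.1) (b p.1) p.2

theorem IsSmoothFamily.velocity_wedge {k : ℕ} {a : ℝ → Form E3 X 1} {b : ℝ → Form E3 X k}
    (ha : IsSmoothFamily a) (hb : IsSmoothFamily b) :
    velocity (fun ε => PoissonCS.wedge (a ε) (b ε)) =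
      PoissonCS.wedge (velocity a) (b 0) + PoissonCS.wedge (a 0) (velocity b) := by
  apply form_eq_of_chartRep
  intro c y hy
  rw [chartRep_add, Pi.add_apply, chartRep_wedge, chartRep_wedge, ha.chartRep_velocity hy,
    hb.chartRep_velocity hy, (ha.wedge hb).chartRep_velocity hy]
  refine ((ha.wedge hb).hasDerivAt_chartRep hy 0).unique ?_
  have h := (wedgeCLM E3 k).hasFDerivAt_of_bilinear (ha.hasDerivAt_chartRep hy 0).hasFDerivAt
    (hb.hasDerivAt_chartRep hy 0).hasFDerivAt
  refine (h.hasDerivAt.congr_of_eventuallyEq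
    (Filter.Eventually.of_forall fun e => chartRep_wedge c (a e) (b e) y)).congr_deriv ?_
  simp [wedgeCLM_apply]
  exact add_comm _ _

variable [T2Space X] [SigmaCompactSpace X] [OrientedAtlas X]

open MeasureTheory in
/-- Differentiation of the integral of a smooth family of 3-forms. -/
theorem IsSmoothFamily.hasDerivAt_formIntegral {η : ℝ → Form E3 X 3} (hη : IsSmoothFamily η)
    {K : Set X} (hK : IsCompact K) :
    HasDerivAt (fun ε => formIntegral K (η ε)) (formIntegral K (velocity η)) 0 := by
  obtain ⟨s, hs, -⟩ := exists_finset_chartPartition hK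
  simp only [formIntegral_eq_sum hK.isClosed hs]
  refine HasDerivAt.fun_sum fun c _ => ?_
  -- The weight vanishes on the rest of the domain of integration, so the integral can be
  -- differentiated over a compact set.
  set C := extChartAt 𝓘(ℝ, E3) c '' (K ∩ tsupport (chartPartition X c)) with hC
  have hCc : IsCompact C := isCompact_chart_image hK (isClosed_tsupport _)
    (tsupport_chartPartition_subset c)
  have hCt := chart_image_subset (K := K) (tsupport_chartPartition_subset c)
  set ρ : E3 → ℝ := fun y => chartPartition X c ((extChartAt 𝓘(ℝ, E3) c).symm y) with hρ
  have hρ0 : ∀ y ∈ ((extChartAt 𝓘(ℝ, E3) c).target ∩ (extChartAt 𝓘(ℝ, E3) c).symm ⁻¹' K) \ C,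
      ρ y = 0 := by
    intro y hy
    by_contra h
    exact hy.2 ⟨_, ⟨hy.1.2, subset_tsupport _ h⟩, (extChartAt 𝓘(ℝ, E3) c).right_inv hy.1.1⟩
  have hred : ∀ θ : Form E3 X 3, chartIntegral c K (chartPartition X c) θ =
      ∫ y in C, ρ y * chartRep c θ y (fun i => EuclideanSpace.single i (1 : ℝ)) := fun θ =>
    setIntegral_eq_of_subset_of_forall_sdiff_eq_zero (measurableSet_chart_preimage c hK.isClosed)
      hCt fun y hy => by
        change ρ y * _ = 0
        rw [hρ0 y hy, zero_mul]
  simp only [hred]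
  set f : ℝ × E3 → ℝ := fun p => ρ p.2 *
    chartRep c (η p.1) p.2 (fun i => EuclideanSpace.single i (1 : ℝ)) with hf
  have hfs : ∀ ε, ∀ y ∈ C, ContDiffAt ℝ ∞ f (ε, y) := by
    intro ε y hy
    have h1 : ContDiffAt ℝ ∞ ρ y :=
      contDiffAt_comp_chart (chartPartition X c).contMDiff (hCt hy).1
    exact (ContDiffAt.comp (g := ρ) (ε, y) h1 contDiffAt_snd).mul
      ((ContinuousAlternatingMap.apply ℝ E3 ℝ
        (fun i : Fin 3 => EuclideanSpace.single i (1 : ℝ))).contDiff.contDiffAt.comp (ε, y)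
        (hη c ε y (hCt hy).1))
  refine (hasDerivAt_setIntegral_of_contDiffAt hCc hfs).congr_deriv ?_
  refine setIntegral_congr_fun hCc.measurableSet fun y hy => ?_
  rw [hη.chartRep_velocity (hCt hy).1]
  have h1 : HasDerivAt (fun e => f (e, y)) (fderiv ℝ f (0, y) (1, 0)) 0 :=
    HasFDerivAt.comp_hasDerivAt (l := f) (f := fun e : ℝ => (e, y)) 0
      ((hfs 0 y hy).differentiableAt (by simp)).hasFDerivAt
      ((hasDerivAt_id (0 : ℝ)).prodMk (hasDerivAt_const (0 : ℝ) y))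
  refine h1.unique ?_
  exact (((ContinuousAlternatingMap.apply ℝ E3 ℝ
    (fun i : Fin 3 => EuclideanSpace.single i (1 : ℝ))).hasFDerivAt.comp_hasDerivAt 0
      (hη.hasDerivAt_chartRep (hCt hy).1 0))).const_mul (ρ y)

/-- The first variation of `∫_K η ∧ dη`. -/
theorem IsSmoothFamily.hasDerivAt_chernSimons {η : ℝ → Form E3 X 1} (hη : IsSmoothFamily η)
    {K : Set X} (hK : IsCompact K) (h0 : ∀ ε, ∀ x ∉ K, (η ε).at x = (η 0).at x) :
    HasDerivAt (fun ε => formIntegral K (PoissonCS.wedge (η ε) (PoissonCS.extd (η ε))))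
      (2 * formIntegral K (PoissonCS.wedge (velocity η) (PoissonCS.extd (η 0)))) 0 := by
  refine ((hη.wedge hη.extd).hasDerivAt_formIntegral hK).congr_deriv ?_
  have hs0 := hη.isSmoothForm 0
  have hsv := hη.isSmoothForm_velocity
  have hv0 : ∀ x ∉ K, (velocity η).at x = 0 := fun x hx => by
    have : (fun ε => (η ε).at x) = fun _ => (η 0).at x := funext fun ε => h0 ε x hx
    change deriv (fun ε => (η ε).at x) 0 = 0
    rw [this, deriv_const]
  -- Stokes for $\eta_0\wedge\dot\eta$, which vanishes off `K` with $\dot\eta$. It turns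
  -- $\int\eta_0\wedge d\dot\eta$ into $\int\dot\eta\wedge d\eta_0$, whence the factor 2.
  have hst : formIntegral K (PoissonCS.extd (PoissonCS.wedge (η 0) (velocity η))) = 0 := by
    refine formIntegral_extd (hs0.wedge hsv) hK fun x hx => ?_
    rw [wedge_at, hv0 x hx, ← wedgeCLM_apply, map_zero]
  rw [extd_wedge hs0 hsv, formIntegral_sub hK (hsv.wedge hs0.extd) (hs0.wedge hsv.extd)] at hst
  rw [hη.velocity_wedge hη.extd, hη.velocity_extd,
    formIntegral_add hK (hsv.wedge hs0.extd) (hs0.wedge hsv.extd)]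
  linarith

end Families

/-! ### Cartan's formula along a family of maps -/

section Cartan

variable {X : Type*} [TopologicalSpace X] [ChartedSpace E3 X] [IsManifold 𝓘(ℝ, E3) ∞ X]
variable {F : Type*} [NormedAddCommGroup F] [NormedSpace ℝ F]
variable {G : Type*} [TopologicalSpace G] [ChartedSpace F G] [IsManifold 𝓘(ℝ, F) ∞ G]

variable (F) in
/-- A map `ℝ × X → G`, read in the preferred charts around `c` and `c'`. -/
noncomputable def readFamily (c : X) (c' : G) (S : ℝ → X → G) : ℝ × E3 → F :=
  fun p => extChartAt 𝓘(ℝ, F) c' (S p.1 ((extChartAt 𝓘(ℝ, E3) c).symm p.2))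

variable {S : ℝ → X → G}

theorem contMDiffAt_chart_family (c : X) {p : ℝ × E3}
    (hp : p.2 ∈ (extChartAt 𝓘(ℝ, E3) c).target) :
    ContMDiffAt 𝓘(ℝ, ℝ × E3) (𝓘(ℝ, ℝ).prod 𝓘(ℝ, E3)) ∞
      (fun p : ℝ × E3 => (p.1, (extChartAt 𝓘(ℝ, E3) c).symm p.2)) p :=
  (contDiff_fst.contMDiff.contMDiffAt).prodMk
    (ContMDiffAt.comp (g := (extChartAt 𝓘(ℝ, E3) c).symm) p (contMDiffAt_extChartAt_symm hp)
      contDiff_snd.contMDiff.contMDiffAt)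

theorem contDiffAt_readFamily
    (hS : ContMDiff (𝓘(ℝ, ℝ).prod 𝓘(ℝ, E3)) 𝓘(ℝ, F) ∞ (fun p : ℝ × X => S p.1 p.2))
    {c : X} {c' : G} {p : ℝ × E3} (hp : p.2 ∈ (extChartAt 𝓘(ℝ, E3) c).target)
    (hp' : S p.1 ((extChartAt 𝓘(ℝ, E3) c).symm p.2) ∈ (extChartAt 𝓘(ℝ, F) c').source) :
    ContDiffAt ℝ ∞ (readFamily F c c' S) p := by
  rw [← contMDiffAt_iff_contDiffAt]
  exact ContMDiffAt.comp (g := extChartAt 𝓘(ℝ, F) c') p (contMDiffAt_extChartAt_of_mem hp')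
    (ContMDiffAt.comp (g := fun p : ℝ × X => S p.1 p.2) p hS.contMDiffAt
      (contMDiffAt_chart_family c hp))

theorem eventually_readFamily
    (hS : ContMDiff (𝓘(ℝ, ℝ).prod 𝓘(ℝ, E3)) 𝓘(ℝ, F) ∞ (fun p : ℝ × X => S p.1 p.2))
    {c : X} {c' : G} {p : ℝ × E3} (hp : p.2 ∈ (extChartAt 𝓘(ℝ, E3) c).target)
    (hp' : S p.1 ((extChartAt 𝓘(ℝ, E3) c).symm p.2) ∈ (extChartAt 𝓘(ℝ, F) c').source) :
    ∀ᶠ q in 𝓝 p, q.2 ∈ (extChartAt 𝓘(ℝ, E3) c).target ∧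
      S q.1 ((extChartAt 𝓘(ℝ, E3) c).symm q.2) ∈ (extChartAt 𝓘(ℝ, F) c').source := by
  have h1 : ContinuousAt (fun q : ℝ × E3 => S q.1 ((extChartAt 𝓘(ℝ, E3) c).symm q.2)) p :=
    (ContMDiffAt.comp (g := fun p : ℝ × X => S p.1 p.2) p hS.contMDiffAt
      (contMDiffAt_chart_family c hp)).continuousAt
  exact (continuousAt_snd.eventually (chart_target_mem_nhds hp)).and
    (h1.eventually ((isOpen_extChartAt_source c').mem_nhds hp'))

theorem contMDiff_family_slice
    (hS : ContMDiff (𝓘(ℝ, ℝ).prod 𝓘(ℝ, E3)) 𝓘(ℝ, F) ∞ (fun p : ℝ × X => S p.1 p.2)) (ε : ℝ) :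
    ContMDiff 𝓘(ℝ, E3) 𝓘(ℝ, F) ∞ (S ε) :=
  hS.comp (contMDiff_const.prodMk contMDiff_id)

theorem fderiv_readIn_slice
    (hS : ContMDiff (𝓘(ℝ, ℝ).prod 𝓘(ℝ, E3)) 𝓘(ℝ, F) ∞ (fun p : ℝ × X => S p.1 p.2))
    {c : X} {c' : G} {p : ℝ × E3} (hp : p.2 ∈ (extChartAt 𝓘(ℝ, E3) c).target)
    (hp' : S p.1 ((extChartAt 𝓘(ℝ, E3) c).symm p.2) ∈ (extChartAt 𝓘(ℝ, F) c').source) :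
    fderiv ℝ (readIn E3 F c c' (S p.1)) p.2 =
      (fderiv ℝ (readFamily F c c' S) p).comp (ContinuousLinearMap.inr ℝ ℝ E3) := by
  have h1 : HasFDerivAt (fun z : E3 => (p.1, z)) (ContinuousLinearMap.inr ℝ ℝ E3) p.2 :=
    hasFDerivAt_prodMk_right p.1 p.2
  exact (HasFDerivAt.comp (g := readFamily F c c' S) (f := fun z : E3 => (p.1, z)) p.2
    ((contDiffAt_readFamily hS hp hp').differentiableAt (by simp)).hasFDerivAt h1).fderiv

/-- The pullback of a smooth form along a smooth family of maps is a smooth family. -/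
theorem isSmoothFamily_pullback {k : ℕ}
    (hS : ContMDiff (𝓘(ℝ, ℝ).prod 𝓘(ℝ, E3)) 𝓘(ℝ, F) ∞ (fun p : ℝ × X => S p.1 p.2))
    {ϑ : Form F G k} (hϑ : IsSmoothForm ϑ) :
    IsSmoothFamily (fun ε => (pullback (S ε) ϑ : Form E3 X k)) := by
  intro c ε y hy
  set c' := S ε ((extChartAt 𝓘(ℝ, E3) c).symm y) with hc'
  have hy' : S (ε, y).1 ((extChartAt 𝓘(ℝ, E3) c).symm (ε, y).2) ∈
    (extChartAt 𝓘(ℝ, F) c').source := mem_extChartAt_source c'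
  have hr := contDiffAt_readFamily hS (p := (ε, y)) hy hy'
  have h1 : ContDiffAt ℝ ∞ (fun p => (chartRep c' ϑ (readFamily F c c' S p)).compContinuousLinearMap
      ((fderiv ℝ (readFamily F c c' S) p).comp (ContinuousLinearMap.inr ℝ ℝ E3))) (ε, y) := by
    refine contDiffAt_compContinuousLinearMap ?_ ((hr.fderiv_right (by simp)).clm_comp contDiffAt_const)
    exact (hϑ.contDiffAt ((extChartAt 𝓘(ℝ, F) c').map_source hy')).comp (ε, y) hr
  refine h1.congr_of_eventuallyEq ?_
  filter_upwards [eventually_readFamily hS (p := (ε, y)) hy hy'] with p hp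
  rw [chartRep_pullback ϑ hp.1 (contMDiff_family_slice hS p.1).contMDiffAt hp.2,
    fderiv_readIn_slice hS hp.1 hp.2]
  rfl

variable (F) in
/-- The velocity at parameter `0` of a family of maps, a vector field along `S 0`. -/
noncomputable def familyVelocity (S : ℝ → X → G) (x : X) : F := tder ℝ F (fun ε => S ε x) 0 1

theorem familyVelocity_eq
    (hS : ContMDiff (𝓘(ℝ, ℝ).prod 𝓘(ℝ, E3)) 𝓘(ℝ, F) ∞ (fun p : ℝ × X => S p.1 p.2))
    {c : X} {c' : G} {y : E3} (hy : y ∈ (extChartAt 𝓘(ℝ, E3) c).target)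
    (hy' : S 0 ((extChartAt 𝓘(ℝ, E3) c).symm y) ∈ (extChartAt 𝓘(ℝ, F) c').source) :
    tder F F (extChartAt 𝓘(ℝ, F) c').symm (readFamily F c c' S (0, y))
      (fderiv ℝ (readFamily F c c' S) (0, y) (1, 0)) =
        familyVelocity F S ((extChartAt 𝓘(ℝ, E3) c).symm y) := by
  have hr := contDiffAt_readFamily hS (p := (0, y)) hy hy'
  have h1 : HasDerivAt (fun e => readFamily F c c' S (e, y))
      (fderiv ℝ (readFamily F c c' S) (0, y) (1, 0)) 0 :=
    HasFDerivAt.comp_hasDerivAt (l := readFamily F c c' S) (f := fun e : ℝ => (e, y)) 0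
      (hr.differentiableAt (by simp)).hasFDerivAt
      ((hasDerivAt_id (0 : ℝ)).prodMk (hasDerivAt_const (0 : ℝ) y))
  have h2 : (fun ε => S ε ((extChartAt 𝓘(ℝ, E3) c).symm y)) =ᶠ[𝓝 0]
      (extChartAt 𝓘(ℝ, F) c').symm ∘ (fun e => readFamily F c c' S (e, y)) := by
    have hc : ContinuousAt (fun e : ℝ => (e, y)) 0 := by fun_prop
    filter_upwards [hc.eventually (eventually_readFamily hS (p := (0, y)) hy hy')] with e he
    exact ((extChartAt 𝓘(ℝ, F) c').left_inv he.2).symm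
  rw [familyVelocity, h2.tder_eq, tder_comp (E' := F)]
  · rw [tder_eq_fderiv, ContinuousLinearMap.comp_apply, h1.hasFDerivAt.fderiv]
    simp
  · exact mdifferentiableAt_extChartAt_symm ((extChartAt 𝓘(ℝ, F) c').map_source hy')
  · exact h1.differentiableAt.mdifferentiableAt

/-- The function `ϑ(V)` for the velocity `V` of a family of maps. -/
noncomputable def momentum (S : ℝ → X → G) (ϑ : Form F G 1) (x : X) : ℝ :=
  ϑ.at (S 0 x) (fun _ => familyVelocity F S x)

theorem momentum_chart
    (hS : ContMDiff (𝓘(ℝ, ℝ).prod 𝓘(ℝ, E3)) 𝓘(ℝ, F) ∞ (fun p : ℝ × X => S p.1 p.2))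
    {ϑ : Form F G 1} {c : X} {c' : G} {y : E3} (hy : y ∈ (extChartAt 𝓘(ℝ, E3) c).target)
    (hy' : S 0 ((extChartAt 𝓘(ℝ, E3) c).symm y) ∈ (extChartAt 𝓘(ℝ, F) c').source) :
    momentum S ϑ ((extChartAt 𝓘(ℝ, E3) c).symm y) =
      chartRep c' ϑ (readFamily F c c' S (0, y))
        (fun _ => fderiv ℝ (readFamily F c c' S) (0, y) (1, 0)) := by
  have h1 : (extChartAt 𝓘(ℝ, F) c').symm (readFamily F c c' S (0, y)) =
    S 0 ((extChartAt 𝓘(ℝ, E3) c).symm y) := (extChartAt 𝓘(ℝ, F) c').left_inv hy'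
  rw [momentum, chartRep_eq, h1, ← familyVelocity_eq hS hy hy']
  rfl

theorem contDiffAt_momentum
    (hS : ContMDiff (𝓘(ℝ, ℝ).prod 𝓘(ℝ, E3)) 𝓘(ℝ, F) ∞ (fun p : ℝ × X => S p.1 p.2))
    {ϑ : Form F G 1} (hϑ : IsSmoothForm ϑ) {c : X} {y : E3}
    (hy : y ∈ (extChartAt 𝓘(ℝ, E3) c).target) :
    ContDiffAt ℝ ∞ (fun z => momentum S ϑ ((extChartAt 𝓘(ℝ, E3) c).symm z)) y := by
  set c' := S 0 ((extChartAt 𝓘(ℝ, E3) c).symm y) with hc'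
  have hy' : S 0 ((extChartAt 𝓘(ℝ, E3) c).symm y) ∈ (extChartAt 𝓘(ℝ, F) c').source :=
    mem_extChartAt_source c'
  have hr := contDiffAt_readFamily hS (p := (0, y)) hy hy'
  have hl : ContDiffAt ℝ ∞ (fun z : E3 => ((0 : ℝ), z)) y := contDiffAt_const.prodMk contDiffAt_id
  have h1 : ContDiffAt ℝ ∞ (fun z => chartRep c' ϑ (readFamily F c c' S (0, z))) y :=
    ContDiffAt.comp (g := chartRep c' ϑ) (f := fun z => readFamily F c c' S (0, z)) y
      (hϑ.contDiffAt ((extChartAt 𝓘(ℝ, F) c').map_source hy'))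
      (ContDiffAt.comp (g := readFamily F c c' S) y hr hl)
  have h2 : ContDiffAt ℝ ∞ (fun z => fderiv ℝ (readFamily F c c' S) (0, z) (1, 0)) y :=
    (ContDiffAt.comp (g := fderiv ℝ (readFamily F c c' S)) y (hr.fderiv_right (m := ∞) (by simp))
      hl).clm_apply contDiffAt_const
  have h3 : ContDiffAt ℝ ∞ (fun z => ((ContinuousAlternatingMap.ofSubsingletonLIE (𝕜 := ℝ) (E := F)
      (F := ℝ) (0 : Fin 1)).symm (chartRep c' ϑ (readFamily F c c' S (0, z))))
      (fderiv ℝ (readFamily F c c' S) (0, z) (1, 0))) y :=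
    ((ContinuousAlternatingMap.ofSubsingletonLIE (𝕜 := ℝ) (E := F)
      (F := ℝ) (0 : Fin 1)).symm.contDiff.contDiffAt.comp y h1).clm_apply h2
  refine h3.congr_of_eventuallyEq ?_
  have hc : ContinuousAt (fun z : E3 => ((0 : ℝ), z)) y := by fun_prop
  filter_upwards [hc.eventually (eventually_readFamily hS (p := (0, y)) hy hy')] with z hz
  rw [momentum_chart hS hz.1 hz.2]
  rfl

theorem contMDiff_momentum
    (hS : ContMDiff (𝓘(ℝ, ℝ).prod 𝓘(ℝ, E3)) 𝓘(ℝ, F) ∞ (fun p : ℝ × X => S p.1 p.2))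
    {ϑ : Form F G 1} (hϑ : IsSmoothForm ϑ) :
    ContMDiff 𝓘(ℝ, E3) 𝓘(ℝ, ℝ) ∞ (momentum S ϑ) := by
  intro x
  have h1 := (contDiffAt_momentum hS hϑ (mem_extChartAt_target x)).contMDiffAt.comp x
    (contMDiffAt_extChartAt_of_mem (mem_extChartAt_source (I := 𝓘(ℝ, E3)) x))
  refine h1.congr_of_eventuallyEq ?_
  filter_upwards [(isOpen_extChartAt_source (I := 𝓘(ℝ, E3)) x).mem_nhds
    (mem_extChartAt_source x)] with z hz
  simp only [Function.comp_apply, (extChartAt 𝓘(ℝ, E3) x).left_inv hz]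

/-- The 1-form `(S 0)^* ι_V ω` for the velocity `V` of a family of maps. -/
noncomputable def contraction (S : ℝ → X → G) (η : Form F G 2) : Form E3 X 1 := fun x =>
  ((η.at (S 0 x)).curryLeft (familyVelocity F S x)).compContinuousLinearMap (tder E3 F (S 0) x)

theorem contraction_at_apply (η : Form F G 2) (x : X) (v : Fin 1 → E3) :
    (contraction S η).at x v = η.at (S 0 x) ![familyVelocity F S x, tder E3 F (S 0) x (v 0)] := by
  change η.at (S 0 x) _ = _
  congr 1
  ext i
  fin_cases i <;> rfl

/-- Cartan's formula along a family of maps. -/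
theorem velocity_pullback
    (hS : ContMDiff (𝓘(ℝ, ℝ).prod 𝓘(ℝ, E3)) 𝓘(ℝ, F) ∞ (fun p : ℝ × X => S p.1 p.2))
    {ϑ : Form F G 1} (hϑ : IsSmoothForm ϑ) :
    velocity (fun ε => (pullback (S ε) ϑ : Form E3 X 1)) =
      contraction S (extd ϑ) + differential E3 (momentum S ϑ) := by
  apply Form.ext_at
  intro x
  set y := extChartAt 𝓘(ℝ, E3) x x with hyx
  set c' := S 0 x with hc'
  have hy : y ∈ (extChartAt 𝓘(ℝ, E3) x).target := mem_extChartAt_target x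
  have hxy : (extChartAt 𝓘(ℝ, E3) x).symm y = x := extChartAt_to_inv x
  have hy' : S 0 ((extChartAt 𝓘(ℝ, E3) x).symm y) ∈ (extChartAt 𝓘(ℝ, F) c').source := by
    rw [hxy]; exact mem_extChartAt_source c'
  set r := readFamily F x c' S with hrdef
  have hr : ContDiffAt ℝ ∞ r (0, y) := contDiffAt_readFamily hS (p := (0, y)) hy hy'
  set t := chartRep c' ϑ with ht
  have ht' : ContDiffAt ℝ ∞ t (r (0, y)) :=
    hϑ.contDiffAt ((extChartAt 𝓘(ℝ, F) c').map_source hy')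
  -- `A` is the pullback of `ϑ` under the whole family, as a form in parameter and space together.
  -- On the pair $((1,0),(0,\xi))$, $dA$ is the contraction of $d\vartheta$ with the velocity;
  -- written out, it is the parameter derivative of the $\xi$-component minus the $\xi$-derivative
  -- of the parameter component, which is the momentum.
  set A : ℝ × E3 → (ℝ × E3) [⋀^Fin 1]→L[ℝ] ℝ := fun p =>
    (t (r p)).compContinuousLinearMap (fderiv ℝ r p) with hA
  have hAs : ContDiffAt ℝ ∞ A (0, y) :=
    contDiffAt_compContinuousLinearMap (ht'.comp (0, y) hr) (hr.fderiv_right (by simp))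
  have hpb : extDeriv A (0, y) = (extDeriv t (r (0, y))).compContinuousLinearMap
      (fderiv ℝ r (0, y)) :=
    extDeriv_pullback (ht'.differentiableAt (by simp)) hr minSmoothness_le_infty
  have hAd := (hAs.differentiableAt (by simp)).hasFDerivAt
  have hfam := isSmoothFamily_pullback hS hϑ
  have hmom := contMDiff_momentum hS hϑ
  rw [← chartRep_self, hfam.chartRep_velocity hy]
  ext v
  set ξ := v 0 with hξ
  have hv : v = fun _ => ξ := by ext i; rw [Subsingleton.elim i 0]
  have e1 : HasDerivAt (fun e => A (e, y) (fun _ => ((0 : ℝ), ξ)))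
      (fderiv ℝ A (0, y) (1, 0) (fun _ => ((0 : ℝ), ξ))) 0 :=
    (ContinuousAlternatingMap.apply ℝ (ℝ × E3) ℝ
      (fun _ : Fin 1 => ((0 : ℝ), ξ))).hasFDerivAt.comp_hasDerivAt 0
      (HasFDerivAt.comp_hasDerivAt (l := A) (f := fun e : ℝ => (e, y)) 0 hAd
      ((hasDerivAt_id (0 : ℝ)).prodMk (hasDerivAt_const (0 : ℝ) y)))
  have e2 : HasDerivAt (fun e => chartRep x (pullback (S e) ϑ : Form E3 X 1) y v) _ 0 :=
    (ContinuousAlternatingMap.apply ℝ E3 ℝ v).hasFDerivAt.comp_hasDerivAt 0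
      (hfam.hasDerivAt_chartRep hy 0)
  have e12 : (fun e => chartRep x (pullback (S e) ϑ : Form E3 X 1) y v) =ᶠ[𝓝 0]
      (fun e => A (e, y) (fun _ => ((0 : ℝ), ξ))) := by
    have hc : ContinuousAt (fun e : ℝ => (e, y)) 0 := by fun_prop
    filter_upwards [hc.eventually (eventually_readFamily hS (p := (0, y)) hy hy')] with e he
    rw [chartRep_pullback ϑ he.1 (contMDiff_family_slice hS e).contMDiffAt he.2,
      fderiv_readIn_slice hS (p := (e, y)) he.1 he.2, hv]
    rfl
  have e3 := e2.unique (e1.congr_of_eventuallyEq e12)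
  have i1 : HasFDerivAt (fun z : E3 => ((0 : ℝ), z)) (ContinuousLinearMap.inr ℝ ℝ E3) y :=
    hasFDerivAt_prodMk_right 0 y
  have d1 := ((ContinuousAlternatingMap.apply ℝ (ℝ × E3) ℝ
      (fun _ : Fin 1 => ((1 : ℝ), (0 : E3)))).hasFDerivAt.comp y
      (HasFDerivAt.comp (g := A) (f := fun z : E3 => ((0 : ℝ), z)) y hAd i1))
  have d12 : (fun z => momentum S ϑ ((extChartAt 𝓘(ℝ, E3) x).symm z)) =ᶠ[𝓝 y]
      (fun z => A (0, z) (fun _ => ((1 : ℝ), (0 : E3)))) := by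
    have hc : ContinuousAt (fun z : E3 => ((0 : ℝ), z)) y := by fun_prop
    filter_upwards [hc.eventually (eventually_readFamily hS (p := (0, y)) hy hy')] with z hz
    rw [momentum_chart hS hz.1 hz.2]
    rfl
  have d3 : fderiv ℝ (fun z => momentum S ϑ ((extChartAt 𝓘(ℝ, E3) x).symm z)) y ξ =
      fderiv ℝ A (0, y) (0, ξ) (fun _ => ((1 : ℝ), (0 : E3))) := by
    rw [d12.fderiv_eq]
    exact congrArg (fun L => L ξ) d1.fderiv
  have f1 := congrArg (fun g => g ![((1 : ℝ), (0 : E3)), ((0 : ℝ), ξ)]) hpb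
  simp only [extDeriv_one_apply] at f1
  have g1 : (differential E3 (momentum S ϑ)).at x v =
      fderiv ℝ (fun z => momentum S ϑ ((extChartAt 𝓘(ℝ, E3) x).symm z)) y ξ := by
    rw [← chartRep_self, chartRep_differential hmom hy]
    rfl
  have g2 : (contraction S (extd ϑ)).at x v =
      (extDeriv t (r (0, y))).compContinuousLinearMap (fderiv ℝ r (0, y))
        ![((1 : ℝ), (0 : E3)), ((0 : ℝ), ξ)] := by
    have hsl := fderiv_readIn_slice hS (p := (0, y)) hy hy'
    have hrx : r (0, y) = extChartAt 𝓘(ℝ, F) c' c' := by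
      simp only [hrdef, readFamily, hxy, hc']
    have k1 := familyVelocity_eq hS hy hy'
    have k2 := tder_symm_readIn hy (contMDiff_family_slice hS 0).contMDiffAt hy'
    have hrx2 : readIn E3 F x c' (S 0) y = extChartAt 𝓘(ℝ, F) c' c' := hrx
    rw [hxy, ← hrdef, hrx, tder_chart_symm_self] at k1
    rw [hxy, hrx2, tder_chart_symm_self, hyx, tder_chart_symm_self, ← hyx, hsl] at k2
    rw [contraction_at_apply, ← chartRep_self, ← hc', chartRep_extd hϑ (mem_extChartAt_target c'),
      hrx, ContinuousAlternatingMap.compContinuousLinearMap_apply]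
    congr 1
    ext i
    fin_cases i
    · exact k1.symm
    · have := congrArg (fun L => L ξ) k2
      exact this.symm
  change _ = (contraction S (extd ϑ)).at x v + (differential E3 (momentum S ϑ)).at x v
  rw [g1, g2, d3, ← f1]
  refine e3.trans ?_
  simp

/-- The contraction of a family of maps with an exact form is smooth. -/
theorem isSmoothForm_contraction
    (hS : ContMDiff (𝓘(ℝ, ℝ).prod 𝓘(ℝ, E3)) 𝓘(ℝ, F) ∞ (fun p : ℝ × X => S p.1 p.2))
    {ϑ : Form F G 1} (hϑ : IsSmoothForm ϑ) : IsSmoothForm (contraction S (extd ϑ)) := by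
  have h := (isSmoothFamily_pullback hS hϑ).isSmoothForm_velocity.sub
    (isSmoothForm_differential (contMDiff_momentum hS hϑ))
  rwa [velocity_pullback hS hϑ, add_sub_cancel_right] at h

variable [T2Space X] [SigmaCompactSpace X] [OrientedAtlas X]

/-- The first variation of the Chern-Simons action along a compactly supported family of maps. -/
theorem hasDerivAt_formIntegral_pullback
    (hS : ContMDiff (𝓘(ℝ, ℝ).prod 𝓘(ℝ, E3)) 𝓘(ℝ, F) ∞ (fun p : ℝ × X => S p.1 p.2))
    {ϑ : Form F G 1} (hϑ : IsSmoothForm ϑ) {K : Set X} (hK : IsCompact K)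
    (h0 : ∀ ε, ∀ x ∉ K, S ε x = S 0 x) :
    HasDerivAt (fun ε => formIntegral K
        (wedge (pullback (S ε) ϑ) (pullback (S ε) (extd ϑ)) : Form E3 X 3))
      (2 * formIntegral K (wedge (contraction S (extd ϑ)) (pullback (S 0) (extd ϑ)))) 0 := by
  have hfam := isSmoothFamily_pullback hS hϑ
  have hsl := contMDiff_family_slice hS
  have hmom := contMDiff_momentum hS hϑ
  have hF : ∀ ε, extd (pullback (S ε) ϑ : Form E3 X 1) = pullback (S ε) (extd ϑ) := fun ε =>
    extd_pullback hϑ (hsl ε)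
  have hoff : ∀ ε, ∀ x ∉ K, (pullback (S ε) ϑ : Form E3 X 1).at x =
      (pullback (S 0) ϑ : Form E3 X 1).at x := by
    intro ε x hx
    have he : S ε =ᶠ[𝓝 x] S 0 := by
      filter_upwards [hK.isClosed.isOpen_compl.mem_nhds hx] with z hz using h0 ε z hz
    rw [pullback_at, pullback_at, he.tder_eq, he.self_of_nhds]
  have hmain := hfam.hasDerivAt_chernSimons hK hoff
  simp only [hF] at hmain
  refine hmain.congr_deriv ?_
  have hsF : IsSmoothForm (pullback (S 0) (extd ϑ) : Form E3 X 2) := hϑ.extd.pullback (hsl 0)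
  have hdF : extd (pullback (S 0) (extd ϑ) : Form E3 X 2) = 0 := by
    rw [← hF, extd_extd (hϑ.pullback (hsl 0))]
  have hm0 : ∀ x ∉ K, momentum S ϑ x = 0 := by
    intro x hx
    have h1 : familyVelocity F S x = 0 := by
      have h2 : (fun ε => S ε x) = fun _ => S 0 x := funext fun ε => h0 ε x hx
      have h3 : tder ℝ F (fun _ : ℝ => S 0 x) 0 = 0 := mfderiv_const
      rw [familyVelocity, h2, h3]
      rfl
    rw [momentum, h1]
    exact (ϑ.at (S 0 x)).map_coord_zero 0 rfl
  -- The exact part of the velocity drops out. As $F$ is closed, $d(\vartheta(V))\wedge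
  -- F=d(\vartheta(V)\,F)$, and $\vartheta(V)$ vanishes off `K`, where the family is constant.
  have hst : formIntegral K (extd (fun x => momentum S ϑ x • pullback (S 0) (extd ϑ) x)) = 0 :=
    formIntegral_extd (hsF.smul_fun hmom) hK fun x hx => by
      rw [smul_fun_at, hm0 x hx, zero_smul]
  have hsd : IsSmoothForm (differential E3 (momentum S ϑ)) := isSmoothForm_differential hmom
  have hwd : extd (fun x => momentum S ϑ x • pullback (S 0) (extd ϑ) x) =
      wedge (differential E3 (momentum S ϑ)) (pullback (S 0) (extd ϑ)) := by
    rw [extd_smul_fun hmom hsF, hdF]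
    apply Form.ext_at
    intro x
    rw [add_at, smul_fun_at, zero_at, smul_zero, add_zero]
  rw [hwd] at hst
  have hc : IsSmoothForm (contraction S (extd ϑ)) := isSmoothForm_contraction hS hϑ
  have hadd : wedge (velocity (fun ε => (pullback (S ε) ϑ : Form E3 X 1))) (pullback (S 0) (extd ϑ)) =
      wedge (contraction S (extd ϑ)) (pullback (S 0) (extd ϑ)) +
        wedge (differential E3 (momentum S ϑ)) (pullback (S 0) (extd ϑ)) := by
    rw [velocity_pullback hS hϑ, wedge_add_left]
  rw [hadd, formIntegral_add hK (hc.wedge hsF) (hsd.wedge hsF), hst, add_zero]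

end Cartan

/-! ### Straightening a submersion -/

section Straightening

variable {F : Type*} [NormedAddCommGroup F] [NormedSpace ℝ F] [CompleteSpace F]
variable {E' : Type*} [NormedAddCommGroup E'] [NormedSpace ℝ E']

/-- A map with a right-invertible derivative agrees with its derivative in suitable coordinates. -/
theorem exists_straightening_vector {f : F → E'} {z₀ : F}
    (hf : ∀ᶠ z in 𝓝 z₀, ContDiffAt ℝ ∞ f z) {R : E' →L[ℝ] F}
    (hR : ∀ v, fderiv ℝ f z₀ (R v) = v) :
    ∃ e : OpenPartialHomeomorph F F, z₀ ∈ e.source ∧ (∀ z, f z = fderiv ℝ f z₀ (e z)) ∧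
      (∀ z ∈ e.source, ContDiffAt ℝ ∞ e z) ∧ (∀ z ∈ e.target, ContDiffAt ℝ ∞ e.symm z) ∧
      HasFDerivAt e.symm (ContinuousLinearMap.id ℝ F) (e z₀) := by
  set D := fderiv ℝ f z₀ with hD
  -- `Φ` replaces the component `R (D z)` of `z` by `R (f z)`. Since `D ∘ R = id`, this gives `D ∘ Φ
  -- = f` everywhere, and the derivative of `Φ` at `z₀` is the identity.
  set Φ : F → F := fun z => R (f z) + (z - R (D z)) with hΦ
  have hΦs : ∀ z, ContDiffAt ℝ ∞ f z → ContDiffAt ℝ ∞ Φ z := fun z hz =>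
    (R.contDiff.contDiffAt.comp z hz).add
      (contDiffAt_id.sub (R.contDiff.comp D.contDiff).contDiffAt)
  have hΦ0 := hΦs z₀ hf.self_of_nhds
  have hd : HasFDerivAt Φ ((ContinuousLinearEquiv.refl ℝ F : F ≃L[ℝ] F) : F →L[ℝ] F) z₀ := by
    have h1 : HasFDerivAt f D z₀ := (hf.self_of_nhds.differentiableAt (by simp)).hasFDerivAt
    have h2 := (R.hasFDerivAt.comp z₀ h1).add
      ((hasFDerivAt_id z₀).sub (R.hasFDerivAt.comp z₀ D.hasFDerivAt))
    refine h2.congr_fderiv ?_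
    ext v
    simp
  have hn : (∞ : WithTop ℕ∞) ≠ 0 := by simp
  set e₀ := hΦ0.toOpenPartialHomeomorph Φ hd hn with he₀
  -- The inverse has to be smooth on its whole domain, not only at one point, so the source is
  -- shrunk to where `Φ` is smooth with invertible derivative; invertibility is an open condition.
  have hgood : ∀ᶠ z in 𝓝 z₀, ContDiffAt ℝ ∞ Φ z ∧
      fderiv ℝ Φ z ∈ Set.range ((↑) : (F ≃L[ℝ] F) → F →L[ℝ] F) := by
    refine (hf.mono hΦs).and ?_
    have hc : ContinuousAt (fderiv ℝ Φ) z₀ := (hΦ0.fderiv_right (m := 0) (by simp)).continuousAt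
    refine hc.eventually ?_
    rw [hd.fderiv]
    exact ContinuousLinearEquiv.nhds (ContinuousLinearEquiv.refl ℝ F)
  obtain ⟨O, hO, hOo, hzO⟩ := mem_nhds_iff.1 hgood
  refine ⟨e₀.restrOpen O hOo, ⟨hΦ0.mem_toOpenPartialHomeomorph_source hd hn, hzO⟩, ?_, ?_, ?_, ?_⟩
  · intro z
    change f z = D (R (f z) + (z - R (D z)))
    rw [map_add, map_sub, hR, hR]
    abel
  · intro z hz
    exact (hO hz.2).1
  · intro z hz
    have hz' := (e₀.restrOpen O hOo).map_target hz
    obtain ⟨L, hL⟩ := (hO hz'.2).2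
    refine (e₀.restrOpen O hOo).contDiffAt_symm (f₀' := L) hz ?_ (hO hz'.2).1
    change HasFDerivAt Φ (L : F →L[ℝ] F) _
    rw [hL]
    exact ((hO hz'.2).1.differentiableAt (by simp)).hasFDerivAt
  · exact (hΦ0.hasStrictFDerivAt' hd hn).to_localInverse.hasFDerivAt

end Straightening

/-! ### Deformations along the fibres of a submersion -/

section Deformation

variable {F : Type*} [NormedAddCommGroup F] [NormedSpace ℝ F] [CompleteSpace F]
variable {G : Type*} [TopologicalSpace G] [ChartedSpace F G] [IsManifold 𝓘(ℝ, F) ∞ G]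
variable {E' : Type*} [NormedAddCommGroup E'] [NormedSpace ℝ E'] [FiniteDimensional ℝ E']
variable {N : Type*} [TopologicalSpace N] [ChartedSpace E' N] [IsManifold 𝓘(ℝ, E') ∞ N]
variable {E : Type*} [NormedAddCommGroup E] [NormedSpace ℝ E]
variable {M : Type*} [TopologicalSpace M] [ChartedSpace E M]

/-- A smooth map into the domain of a submersion can be deformed along the fibres with a prescribed
velocity at one point. -/
theorem exists_fiber_deformation {f : G → N} (hf : ContMDiff 𝓘(ℝ, F) 𝓘(ℝ, E') ∞ f)
    {u : M → G} (hu : ContMDiff 𝓘(ℝ, E) 𝓘(ℝ, F) ∞ u) (x₀ : M)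
    (hs : Function.Surjective (tder F E' f (u x₀))) {w : F} (hw : tder F E' f (u x₀) w = 0) :
    ∃ (ψ : ℝ → M → G) (O : Set (ℝ × M)), IsOpen O ∧ (0, x₀) ∈ O ∧
      ContMDiffOn (𝓘(ℝ, ℝ).prod 𝓘(ℝ, E)) 𝓘(ℝ, F) ∞ (fun p : ℝ × M => ψ p.1 p.2) O ∧
      (∀ p ∈ O, ψ 0 p.2 = u p.2) ∧ (∀ p ∈ O, f (ψ p.1 p.2) = f (u p.2)) ∧
      tder ℝ F (fun t => ψ t x₀) 0 1 = w := by
  set γ := u x₀ with hγ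
  set g := readIn F E' γ (f γ) f with hg
  set z₀ := extChartAt 𝓘(ℝ, F) γ γ with hz₀
  have hz₀t : z₀ ∈ (extChartAt 𝓘(ℝ, F) γ).target := mem_extChartAt_target γ
  have hγz : (extChartAt 𝓘(ℝ, F) γ).symm z₀ = γ := extChartAt_to_inv γ
  have hfz : f ((extChartAt 𝓘(ℝ, F) γ).symm z₀) ∈ (extChartAt 𝓘(ℝ, E') (f γ)).source := by
    rw [hγz]; exact mem_extChartAt_source _
  have hnear : ∀ᶠ z in 𝓝 z₀, z ∈ (extChartAt 𝓘(ℝ, F) γ).target ∧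
      f ((extChartAt 𝓘(ℝ, F) γ).symm z) ∈ (extChartAt 𝓘(ℝ, E') (f γ)).source :=
    (Filter.Eventually.and (chart_target_mem_nhds hz₀t)
      (eventually_mem_chart_source hz₀t hf.continuous.continuousAt hfz))
  have hgs : ∀ᶠ z in 𝓝 z₀, ContDiffAt ℝ ∞ g z := hnear.mono fun z hz =>
    contDiffAt_readIn hz.1 hf.contMDiffAt hz.2
  have hD : fderiv ℝ g z₀ = tder F E' f γ := by
    have h := tder_symm_readIn hz₀t hf.contMDiffAt hfz
    have h1 : readIn F E' γ (f γ) f z₀ = extChartAt 𝓘(ℝ, E') (f γ) (f γ) := by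
      simp only [readIn, Function.comp_apply, hγz]
    rw [h1, tder_chart_symm_self, tder_chart_symm_self, hγz] at h
    exact h
  obtain ⟨R, hR⟩ := (tder F E' f γ).toLinearMap.exists_rightInverse_of_surjective
    (LinearMap.range_eq_top.2 hs)
  obtain ⟨e, hz₀e, hfe, hes, hes', hed⟩ := exists_straightening_vector (f := g) hgs
    (R := LinearMap.toContinuousLinearMap R) (fun v => by
      rw [hD]; exact congrArg (fun L => L v) hR)
  obtain ⟨O₁, hO₁, hO₁o, hzO₁⟩ := mem_nhds_iff.1 hnear
  -- Inside `O₁` the values of `f` stay in one chart of `N`, so equality of their coordinates gives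
  -- equality of the points.
  set e' := e.restrOpen O₁ hO₁o with he'
  have he's : ∀ z ∈ e'.source, z ∈ e.source ∧ z ∈ O₁ := fun z hz => hz
  set q : M → F := fun x => extChartAt 𝓘(ℝ, F) γ (u x) with hq
  -- In the coordinates `e'` the map `f` is linear with derivative `D`. Translation by `t • w` with
  -- `D w = 0` therefore stays in the fibre; its velocity at `x₀` is `w` because `e.symm` has the
  -- identity as derivative there.
  set ψ : ℝ → M → G := fun t x => (extChartAt 𝓘(ℝ, F) γ).symm (e'.symm (e' (q x) + t • w)) with hψ
  have hUo : IsOpen {x : M | u x ∈ (extChartAt 𝓘(ℝ, F) γ).source ∧ q x ∈ e'.source} :=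
    ((continuousOn_extChartAt γ).isOpen_inter_preimage (isOpen_extChartAt_source γ)
      e'.open_source).preimage hu.continuous
  set U := {x : M | u x ∈ (extChartAt 𝓘(ℝ, F) γ).source ∧ q x ∈ e'.source} with hU
  have hx₀U : x₀ ∈ U := ⟨mem_extChartAt_source γ, hz₀e, hzO₁⟩
  have hqs : ∀ x ∈ U, ContMDiffAt 𝓘(ℝ, E) 𝓘(ℝ, F) ∞ (fun x => e' (q x)) x := by
    intro x hx
    exact ContMDiffAt.comp (g := e) x (hes _ (he's _ hx.2).1).contMDiffAt
      (ContMDiffAt.comp (g := extChartAt 𝓘(ℝ, F) γ) x (contMDiffAt_extChartAt_of_mem hx.1)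
        hu.contMDiffAt)
  set A : ℝ × M → F := fun p => e' (q p.2) + p.1 • w with hA
  have hAs : ∀ p : ℝ × M, p.2 ∈ U → ContMDiffAt (𝓘(ℝ, ℝ).prod 𝓘(ℝ, E)) 𝓘(ℝ, F) ∞ A p := by
    intro p hp
    have h1 : ContMDiffAt (𝓘(ℝ, ℝ).prod 𝓘(ℝ, E)) 𝓘(ℝ, F) ∞ (fun p : ℝ × M => e' (q p.2)) p :=
      ContMDiffAt.comp (g := fun x => e' (q x)) p (hqs _ hp) contMDiffAt_snd
    have h2 : ContMDiffAt (𝓘(ℝ, ℝ).prod 𝓘(ℝ, E)) 𝓘(ℝ, F) ∞ (fun p : ℝ × M => p.1 • w) p :=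
      ContMDiffAt.comp (g := fun t : ℝ => t • w) p
        (contDiff_id.smul contDiff_const).contMDiff.contMDiffAt contMDiffAt_fst
    exact h1.add h2
  have hUo' : IsOpen {p : ℝ × M | p.2 ∈ U} := hUo.preimage continuous_snd
  have hOo : IsOpen ({p : ℝ × M | p.2 ∈ U} ∩ A ⁻¹' e'.target) :=
    ContinuousOn.isOpen_inter_preimage (fun p hp => (hAs p hp).continuousAt.continuousWithinAt)
      hUo' e'.open_target
  have hrinv : ∀ p : ℝ × M, A p ∈ e'.target → e'.symm (A p) ∈ e.source ∧ e'.symm (A p) ∈ O₁ :=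
    fun p hp => he's _ (e'.map_target hp)
  have hwD : fderiv ℝ g z₀ w = 0 := by rw [hD, hw]
  have hA0 : ∀ x, A (0, x) = e' (q x) := fun x => by simp [hA]
  refine ⟨ψ, {p : ℝ × M | p.2 ∈ U} ∩ A ⁻¹' e'.target, hOo, ⟨hx₀U, ?_⟩, ?_, ?_, ?_, ?_⟩
  · rw [Set.mem_preimage, hA0]
    exact e'.map_source hx₀U.2
  · intro p hp
    refine ContMDiffAt.contMDiffWithinAt ?_
    have h1 : ContMDiffAt 𝓘(ℝ, F) 𝓘(ℝ, F) ∞ e'.symm (A p) :=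
      (hes' _ (by have h := e.map_source (hrinv p hp.2).1
                  have h2 : e (e'.symm (A p)) = A p := e'.right_inv hp.2
                  rwa [h2] at h)).contMDiffAt
    exact ContMDiffAt.comp (g := (extChartAt 𝓘(ℝ, F) γ).symm) p
      (contMDiffAt_extChartAt_symm (hO₁ (hrinv p hp.2).2).1)
      (ContMDiffAt.comp (g := e'.symm) p h1 (hAs p hp.1))
  · intro p hp
    change (extChartAt 𝓘(ℝ, F) γ).symm (e'.symm (A (0, p.2))) = u p.2
    rw [hA0, e'.left_inv hp.1.2, (extChartAt 𝓘(ℝ, F) γ).left_inv hp.1.1]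
  · intro p hp
    have h1 : f (ψ p.1 p.2) ∈ (extChartAt 𝓘(ℝ, E') (f γ)).source := (hO₁ (hrinv p hp.2).2).2
    have h2 : f (u p.2) ∈ (extChartAt 𝓘(ℝ, E') (f γ)).source := by
      have := (hO₁ (he's _ hp.1.2).2).2
      rwa [hq, (extChartAt 𝓘(ℝ, F) γ).left_inv hp.1.1] at this
    apply (extChartAt 𝓘(ℝ, E') (f γ)).injOn h1 h2
    have h3 : g (e'.symm (A p)) = fderiv ℝ g z₀ (e (e'.symm (A p))) := hfe _
    have h4 : g (q p.2) = fderiv ℝ g z₀ (e (q p.2)) := hfe _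
    have h5 : e (e'.symm (A p)) = e (q p.2) + p.1 • w := e'.right_inv hp.2
    rw [h5, map_add, map_smul, hwD, smul_zero, add_zero, ← h4] at h3
    have h6 : g (q p.2) = extChartAt 𝓘(ℝ, E') (f γ) (f (u p.2)) := by
      simp only [hg, readIn, Function.comp_apply, hq, (extChartAt 𝓘(ℝ, F) γ).left_inv hp.1.1]
    rw [h6] at h3
    exact h3
  · have hcur : HasFDerivAt (fun t : ℝ => e (q x₀) + t • w)
        ((ContinuousLinearMap.id ℝ ℝ).smulRight w) 0 :=
      ((hasFDerivAt_id (0 : ℝ)).smul_const w).const_add _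
    have hb : e (q x₀) + (0 : ℝ) • w = e z₀ := by simp [hq, hz₀, ← hγ]
    have hed' : HasFDerivAt e.symm (ContinuousLinearMap.id ℝ F) (e (q x₀) + (0 : ℝ) • w) := by
      rw [hb]; exact hed
    have h1 := HasFDerivAt.comp (g := e.symm) (f := fun t : ℝ => e (q x₀) + t • w) 0 hed' hcur
    have h2 : e.symm (e (q x₀) + (0 : ℝ) • w) = z₀ := by rw [hb, e.left_inv hz₀e]
    have h3 : tder ℝ F (fun t => ψ t x₀) 0 =
        (tder F F (extChartAt 𝓘(ℝ, F) γ).symm (e.symm (e (q x₀) + (0 : ℝ) • w))).comp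
          (tder ℝ F (e.symm ∘ fun t : ℝ => e (q x₀) + t • w) 0) := by
      refine tder_comp (g := (extChartAt 𝓘(ℝ, F) γ).symm)
        (f := e.symm ∘ fun t : ℝ => e (q x₀) + t • w) (0 : ℝ) ?_ h1.differentiableAt.mdifferentiableAt
      refine mdifferentiableAt_extChartAt_symm ?_
      rw [Function.comp_apply, h2]
      exact hz₀t
    rw [h3, h2, hz₀, tder_chart_symm_self, tder_eq_fderiv, h1.fderiv]
    simp

/-- The deformation of a constant map; `N` serves only as some manifold with a point. Along a curve
inside a fibre products stay defined, which makes `Tm` computable on vertical vectors. -/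
theorem exists_fiber_curve {f : G → N} (hf : ContMDiff 𝓘(ℝ, F) 𝓘(ℝ, E') ∞ f) {α : G}
    (hs : Function.Surjective (tder F E' f α)) {w : F} (hw : tder F E' f α w = 0) :
    ∃ c : ℝ → G, c 0 = α ∧ MDifferentiableAt 𝓘(ℝ, ℝ) 𝓘(ℝ, F) c 0 ∧ tder ℝ F c 0 1 = w ∧
      ∀ᶠ t in 𝓝 0, f (c t) = f α := by
  obtain ⟨ψ, O, hO, h0, hψ, hu, hsrc, hd⟩ := exists_fiber_deformation (M := N) (u := fun _ => α)
    hf (contMDiff_const (I := 𝓘(ℝ, E'))) (f α) hs hw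
  have h1 : ContMDiffAt 𝓘(ℝ, ℝ) 𝓘(ℝ, F) ∞ (fun t => ψ t (f α)) 0 :=
    ContMDiffAt.comp (g := fun p : ℝ × N => ψ p.1 p.2) (0 : ℝ) (hψ.contMDiffAt (hO.mem_nhds h0))
      (contMDiff_id.prodMk contMDiff_const).contMDiffAt
  have hc : ContinuousAt (fun t : ℝ => (t, f α)) 0 := (Continuous.prodMk_left (f α)).continuousAt
  exact ⟨fun t => ψ t (f α), hu _ h0, h1.mdifferentiableAt (by simp), hd,
    (hc.eventually (hO.mem_nhds h0)).mono fun t ht => hsrc _ ht⟩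

end Deformation

/-! ### Tangent groupoid and symplectic linear algebra -/

section Groupoid

variable {X : Type*} [TopologicalSpace X] [ChartedSpace E3 X] [IsManifold 𝓘(ℝ, E3) ∞ X]
variable {F : Type*} [NormedAddCommGroup F] [NormedSpace ℝ F] [FiniteDimensional ℝ F]
variable {G : Type*} [TopologicalSpace G] [ChartedSpace F G] [IsManifold 𝓘(ℝ, F) ∞ G]
variable {E : Type*} [NormedAddCommGroup E] [NormedSpace ℝ E]
variable {M : Type*} [TopologicalSpace M] [ChartedSpace E M]

theorem alternating_swap (η : E [⋀^Fin 2]→L[ℝ] ℝ) (u v : E) : η ![u, v] = - η ![v, u] := by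
  have h := η.toAlternatingMap.map_swap ![v, u] (show (0 : Fin 2) ≠ 1 by decide)
  have h2 : (![v, u] : Fin 2 → E) ∘ Equiv.swap (0 : Fin 2) 1 = ![u, v] := by
    ext i
    fin_cases i <;> simp
  rw [h2] at h
  exact h

namespace LocalLieGroupoid

variable (𝒢 : LocalLieGroupoid X F G)

/-- The tangent map of the source, on the model spaces. -/
noncomputable def Ts (α : G) : F →L[ℝ] E3 := tder F E3 𝒢.src α

/-- The tangent map of the target, on the model spaces. -/
noncomputable def Tt (α : G) : F →L[ℝ] E3 := tder F E3 𝒢.tgt α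

/-- The tangent map of the multiplication, on the model spaces. -/
noncomputable def Tm (β α : G) : F × F →L[ℝ] F :=
  mfderivWithin (𝓘(ℝ, F).prod 𝓘(ℝ, F)) 𝓘(ℝ, F) (fun p : G × G => 𝒢.mul p.1 p.2)
    𝒢.composable (β, α)

theorem Ts_surjective (α : G) : Function.Surjective (𝒢.Ts α) := 𝒢.submersion_src α

theorem Tt_surjective (α : G) : Function.Surjective (𝒢.Tt α) := 𝒢.submersion_tgt α

variable {𝒢}

/-- `composable` need not be open in `G × G`, so the derivative within it is meaningful only in
tangent directions. Pairs of maps that stay in `composable` meet just these directions, and the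
chain rule holds for them. -/
theorem hasMFDerivAt_mul {f g : M → G} {x : M} (hf : MDifferentiableAt 𝓘(ℝ, E) 𝓘(ℝ, F) f x)
    (hg : MDifferentiableAt 𝓘(ℝ, E) 𝓘(ℝ, F) g x) (h : ∀ᶠ z in 𝓝 x, (f z, g z) ∈ 𝒢.composable) :
    HasMFDerivAt 𝓘(ℝ, E) 𝓘(ℝ, F) (fun z => 𝒢.mul (f z) (g z)) x
      ((𝒢.Tm (f x) (g x)).comp ((tder E F f x).prod (tder E F g x))) := by
  have h1 : HasMFDerivWithinAt (𝓘(ℝ, F).prod 𝓘(ℝ, F)) 𝓘(ℝ, F) (fun p : G × G => 𝒢.mul p.1 p.2)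
      𝒢.composable (f x, g x) _ :=
    (((𝒢.contMDiffOn_mul (f x, g x) h.self_of_nhds)).mdifferentiableWithinAt
      (by simp)).hasMFDerivWithinAt
  have h2 := hf.hasMFDerivAt.prodMk hg.hasMFDerivAt
  have h3 := HasMFDerivWithinAt.comp (g := fun p : G × G => 𝒢.mul p.1 p.2)
    (f := fun z => (f z, g z)) (s := {z | (f z, g z) ∈ 𝒢.composable}) x h1 h2.hasMFDerivWithinAt
    (fun z hz => hz)
  exact h3.hasMFDerivAt h

theorem tder_mul {f g : M → G} {x : M} (hf : MDifferentiableAt 𝓘(ℝ, E) 𝓘(ℝ, F) f x)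
    (hg : MDifferentiableAt 𝓘(ℝ, E) 𝓘(ℝ, F) g x) (h : ∀ᶠ z in 𝓝 x, (f z, g z) ∈ 𝒢.composable)
    (v : E) :
    tder E F (fun z => 𝒢.mul (f z) (g z)) x v =
      𝒢.Tm (f x) (g x) (tder E F f x v, tder E F g x v) :=
  congrArg (fun L => L v) (hasMFDerivAt_mul hf hg h).mfderiv

theorem src_eq_tgt {β α : G} (h : (β, α) ∈ 𝒢.composable) : 𝒢.src β = 𝒢.tgt α := by
  obtain ⟨U, hU, hc⟩ := 𝒢.composable_open
  rw [hc] at h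
  exact h.2

theorem eventually_composable {f g : M → G} {x : M} (hf : ContinuousAt f x) (hg : ContinuousAt g x)
    (h : (f x, g x) ∈ 𝒢.composable) (hfg : ∀ᶠ z in 𝓝 x, 𝒢.src (f z) = 𝒢.tgt (g z)) :
    ∀ᶠ z in 𝓝 x, (f z, g z) ∈ 𝒢.composable := by
  obtain ⟨U, hU, hc⟩ := 𝒢.composable_open
  rw [hc] at h ⊢
  filter_upwards [(hf.prodMk hg).eventually (hU.mem_nhds h.1), hfg] with z h1 h2 using ⟨h1, h2⟩

theorem mdifferentiableAt_src (α : G) : MDifferentiableAt 𝓘(ℝ, F) 𝓘(ℝ, E3) 𝒢.src α :=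
  𝒢.contMDiff_src.mdifferentiable (by simp) _

theorem mdifferentiableAt_tgt (α : G) : MDifferentiableAt 𝓘(ℝ, F) 𝓘(ℝ, E3) 𝒢.tgt α :=
  𝒢.contMDiff_tgt.mdifferentiable (by simp) _

theorem mdifferentiableAt_unit (x : X) : MDifferentiableAt 𝓘(ℝ, E3) 𝓘(ℝ, F) 𝒢.unit x :=
  𝒢.contMDiff_unit.mdifferentiable (by simp) _

theorem tder_const (y : G) (x : M) : tder E F (fun _ => y) x = 0 := mfderiv_const

/-- Along a curve through `β` in its source fibre, the product with `α` has the constant source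
`𝒢.src α`. -/
theorem Ts_Tm_zero_right {β α : G} (h : (β, α) ∈ 𝒢.composable) {v : F} (hv : 𝒢.Ts β v = 0) :
    𝒢.Ts (𝒢.mul β α) (𝒢.Tm β α (v, 0)) = 0 := by
  have : CompleteSpace F := FiniteDimensional.complete ℝ F
  obtain ⟨c, hc0, hcd, hd, hcs⟩ := exists_fiber_curve 𝒢.contMDiff_src (𝒢.Ts_surjective β) hv
  have hm : ∀ᶠ t in 𝓝 (0 : ℝ), (c t, α) ∈ 𝒢.composable :=
    eventually_composable hcd.continuousAt continuousAt_const (by rwa [hc0])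
      (hcs.mono fun t ht => ht.trans (src_eq_tgt h))
  have h1 := tder_mul hcd (mdifferentiableAt_const (c := α)) hm 1
  rw [hc0, hd, tder_const] at h1
  have h3 : (𝒢.src ∘ fun t => 𝒢.mul (c t) α) =ᶠ[𝓝 0] fun _ => 𝒢.src α :=
    hm.mono fun t ht => 𝒢.src_mul _ _ ht
  have h2 : tder ℝ E3 (𝒢.src ∘ fun t => 𝒢.mul (c t) α) 0 = 0 := h3.tder_eq.trans mfderiv_const
  rw [tder_comp (E' := F) 0 (mdifferentiableAt_src _)
    (hasMFDerivAt_mul hcd mdifferentiableAt_const hm).mdifferentiableAt] at h2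
  have h4 := congrArg (fun L => L 1) h2
  simp only [ContinuousLinearMap.comp_apply, hc0, h1] at h4
  exact h4

/-- Along a curve through `α` in its target fibre, left multiplication by `β` has constant target
`𝒢.tgt β` and does not change the source. -/
theorem Tm_zero_left {β α : G} (h : (β, α) ∈ 𝒢.composable) {w : F} (hw : 𝒢.Tt α w = 0) :
    𝒢.Tt (𝒢.mul β α) (𝒢.Tm β α (0, w)) = 0 ∧
      𝒢.Ts (𝒢.mul β α) (𝒢.Tm β α (0, w)) = 𝒢.Ts α w := by
  have : CompleteSpace F := FiniteDimensional.complete ℝ F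
  obtain ⟨c, hc0, hcd, hd, hcs⟩ := exists_fiber_curve 𝒢.contMDiff_tgt (𝒢.Tt_surjective α) hw
  have hm : ∀ᶠ t in 𝓝 (0 : ℝ), (β, c t) ∈ 𝒢.composable :=
    eventually_composable continuousAt_const hcd.continuousAt (by rwa [hc0])
      (hcs.mono fun t ht => (src_eq_tgt h).trans ht.symm)
  have hmd := (hasMFDerivAt_mul mdifferentiableAt_const hcd hm).mdifferentiableAt
  have h1 := tder_mul (mdifferentiableAt_const (c := β)) hcd hm 1
  rw [hc0, hd, tder_const] at h1
  constructor
  · have h3 : (𝒢.tgt ∘ fun t => 𝒢.mul β (c t)) =ᶠ[𝓝 0] fun _ => 𝒢.tgt β :=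
      hm.mono fun t ht => 𝒢.tgt_mul _ _ ht
    have h2 : tder ℝ E3 (𝒢.tgt ∘ fun t => 𝒢.mul β (c t)) 0 = 0 := h3.tder_eq.trans mfderiv_const
    rw [tder_comp (E' := F) 0 (mdifferentiableAt_tgt _) hmd] at h2
    have h4 := congrArg (fun L => L 1) h2
    simp only [ContinuousLinearMap.comp_apply, hc0, h1] at h4
    exact h4
  · have h3 : (𝒢.src ∘ fun t => 𝒢.mul β (c t)) =ᶠ[𝓝 0] 𝒢.src ∘ c :=
      hm.mono fun t ht => 𝒢.src_mul _ _ ht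
    have h2 := h3.tder_eq (E := ℝ) (E' := E3)
    rw [tder_comp (E' := F) 0 (mdifferentiableAt_src _) hmd,
      tder_comp (E' := F) 0 (mdifferentiableAt_src _) hcd] at h2
    have h4 := congrArg (fun L => L 1) h2
    simp only [ContinuousLinearMap.comp_apply, hc0, h1, hd] at h4
    exact h4

/-- The derivative of the unit law `𝒢.mul γ (𝒢.unit (𝒢.src γ)) = γ`. -/
theorem Tm_unit_right (γ : G) (v : F) :
    𝒢.Tm γ (𝒢.unit (𝒢.src γ)) (v, tder E3 F 𝒢.unit (𝒢.src γ) (𝒢.Ts γ v)) = v := by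
  have h0 : MDifferentiableAt 𝓘(ℝ, F) 𝓘(ℝ, F) (𝒢.unit ∘ 𝒢.src) γ :=
    (mdifferentiableAt_unit _).comp γ (mdifferentiableAt_src γ)
  have h1 := tder_mul (f := id) mdifferentiableAt_id h0
    (Filter.Eventually.of_forall fun z => 𝒢.composable_src z) v
  rw [tder_comp (E' := E3) γ (mdifferentiableAt_unit _) (mdifferentiableAt_src γ), tder_id] at h1
  have h2 : (fun z => 𝒢.mul (id z) ((𝒢.unit ∘ 𝒢.src) z)) = id := funext 𝒢.mul_unit
  rw [h2, tder_id] at h1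
  exact h1.symm

theorem Ts_tder_unit (x : X) (v : E3) : 𝒢.Ts (𝒢.unit x) (tder E3 F 𝒢.unit x v) = v := by
  have h := tder_comp (E' := F) x (mdifferentiableAt_src (𝒢 := 𝒢) (𝒢.unit x)) (mdifferentiableAt_unit x)
  rw [show 𝒢.src ∘ 𝒢.unit = id from funext 𝒢.src_unit, tder_id] at h
  exact congrArg (fun L => L v) h.symm

theorem Tt_tder_unit (x : X) (v : E3) : 𝒢.Tt (𝒢.unit x) (tder E3 F 𝒢.unit x v) = v := by
  have h := tder_comp (E' := F) x (mdifferentiableAt_tgt (𝒢 := 𝒢) (𝒢.unit x)) (mdifferentiableAt_unit x)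
  rw [show 𝒢.tgt ∘ 𝒢.unit = id from funext 𝒢.tgt_unit, tder_id] at h
  exact congrArg (fun L => L v) h.symm

end LocalLieGroupoid

namespace Bisection

variable {𝒢 : LocalLieGroupoid X F G} (σ : Bisection 𝒢)

theorem mdifferentiableAt_sec (x : X) : MDifferentiableAt 𝓘(ℝ, E3) 𝓘(ℝ, F) σ.sec x :=
  σ.contMDiff_sec.mdifferentiable (by simp) _

theorem Ts_tder_sec (x : X) (v : E3) : 𝒢.Ts (σ.sec x) (tder E3 F σ.sec x v) = v := by
  have h := tder_comp (E' := F) x (LocalLieGroupoid.mdifferentiableAt_src (𝒢 := 𝒢) (σ.sec x))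
    (σ.mdifferentiableAt_sec x)
  rw [show 𝒢.src ∘ σ.sec = id from funext σ.src_sec, tder_id] at h
  exact congrArg (fun L => L v) h.symm

theorem Tt_tder_sec (x : X) (v : E3) :
    𝒢.Tt (σ.sec x) (tder E3 F σ.sec x v) = tder E3 E3 σ.l x v := by
  have h := tder_comp (E' := F) x (LocalLieGroupoid.mdifferentiableAt_tgt (𝒢 := 𝒢) (σ.sec x))
    (σ.mdifferentiableAt_sec x)
  rw [show 𝒢.tgt ∘ σ.sec = σ.l from funext σ.tgt_sec] at h
  exact congrArg (fun L => L v) h.symm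

/-- The tangent map of `l` is invertible. -/
theorem exists_tder_l_inverse (x : X) : ∃ L : E3 →L[ℝ] E3,
    (∀ v, L (tder E3 E3 σ.l x v) = v) ∧ ∀ v, tder E3 E3 σ.l x (L v) = v := by
  have hl := σ.l.contMDiff.mdifferentiable (by simp)
  have hl' := σ.l.symm.contMDiff.mdifferentiable (by simp)
  refine ⟨tder E3 E3 σ.l.symm (σ.l x), fun v => ?_, fun v => ?_⟩
  · have h := tder_comp (E' := E3) x (hl' (σ.l x)) (hl x)
    rw [show σ.l.symm ∘ σ.l = id from funext σ.l.left_inv, tder_id] at h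
    exact congrArg (fun L => L v) h.symm
  · have h := tder_comp (E' := E3) (σ.l x) (hl (σ.l.symm (σ.l x))) (hl' (σ.l x))
    rw [show σ.l ∘ σ.l.symm = id from funext σ.l.right_inv, tder_id] at h
    have h3 := congrArg (fun L => L v) h.symm
    have h4 : σ.l.symm (σ.l x) = x := σ.l.left_inv x
    rw [h4] at h3
    exact h3

end Bisection

namespace LocalSymplecticGroupoid

variable {Θ : PoissonStructure X} (𝒢 : LocalSymplecticGroupoid (F := F) (G := G) Θ)

/-- The symplectic form at a point as a bilinear form on the model space. -/
noncomputable def pairing (α : G) : F →ₗ[ℝ] F →ₗ[ℝ] ℝ :=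
  LinearMap.mk₂ ℝ (fun u v => 𝒢.symp.at α ![u, v])
    (fun u u' v => (𝒢.symp.at α).toAlternatingMap.map_vecCons_add ![v] u u')
    (fun c u v => (𝒢.symp.at α).toAlternatingMap.map_vecCons_smul ![v] c u)
    (fun u v v' => by
      rw [alternating_swap _ u, alternating_swap _ u v, alternating_swap _ u v', ← neg_add]
      exact congrArg _ ((𝒢.symp.at α).toAlternatingMap.map_vecCons_add ![u] v v'))
    (fun c u v => by
      rw [alternating_swap _ u, alternating_swap _ u v, smul_neg]
      exact congrArg _ ((𝒢.symp.at α).toAlternatingMap.map_vecCons_smul ![u] c v))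

theorem pairing_apply (α : G) (u v : F) : 𝒢.pairing α u v = 𝒢.symp.at α ![u, v] := rfl

theorem eq_zero_of_pairing {α : G} {u : F} (h : ∀ v, 𝒢.pairing α u v = 0) : u = 0 :=
  𝒢.nondegenerate_symp α u h

theorem exists_pairing_eq (α : G) (a : F →ₗ[ℝ] ℝ) : ∃ u, ∀ v, 𝒢.pairing α u v = a v := by
  have hinj : Function.Injective (𝒢.pairing α) := by
    rw [injective_iff_map_eq_zero]
    intro u hu
    exact 𝒢.eq_zero_of_pairing fun v => by rw [hu]; rfl
  have hsurj := (LinearMap.injective_iff_surjective_of_finrank_eq_finrank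
    (Subspace.dual_finrank_eq (K := ℝ) (V := F)).symm).1 hinj
  obtain ⟨u, hu⟩ := hsurj a
  exact ⟨u, fun v => by rw [hu]⟩

theorem graph_iff {β α : G} (h : (β, α) ∈ 𝒢.composable) (u v w : F) :
    (𝒢.Ts β v = 𝒢.Tt α w ∧ u = 𝒢.Tm β α (v, w)) ↔
      ∀ v' w', 𝒢.Ts β v' = 𝒢.Tt α w' →
        - 𝒢.pairing (𝒢.mul β α) u (𝒢.Tm β α (v', w')) + 𝒢.pairing β v v' +
          𝒢.pairing α w w' = 0 :=
  𝒢.graph_lagrangian β α h u v w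

/-- The multiplication is isotropic. -/
theorem pairing_Tm {β α : G} (h : (β, α) ∈ 𝒢.composable) {v w v' w' : F}
    (hv : 𝒢.Ts β v = 𝒢.Tt α w) (hv' : 𝒢.Ts β v' = 𝒢.Tt α w') :
    𝒢.pairing (𝒢.mul β α) (𝒢.Tm β α (v, w)) (𝒢.Tm β α (v', w')) =
      𝒢.pairing β v v' + 𝒢.pairing α w w' := by
  have h1 := (𝒢.graph_iff h _ v w).1 ⟨hv, rfl⟩ v' w' hv'
  linarith

/-- By isotropy of the graph, `w` is orthogonal to every `w'`: surjectivity of `Ts` completes `w'`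
to a composable pair `(v', w')`, and the term `ω(0, v')` vanishes. -/
theorem Tm_zero_left_injective {β α : G} (h : (β, α) ∈ 𝒢.composable) {w : F}
    (hw : 𝒢.Tt α w = 0) (h0 : 𝒢.Tm β α (0, w) = 0) : w = 0 := by
  refine 𝒢.eq_zero_of_pairing (α := α) fun w' => ?_
  obtain ⟨v', hv'⟩ := 𝒢.Ts_surjective β (𝒢.Tt α w')
  have h1 := 𝒢.pairing_Tm h (v := 0) (by rw [hw, map_zero]) hv'
  rw [h0] at h1
  simpa using h1.symm

/-- Left translation maps the kernel of the tangent map of the target at a unit onto the kernel of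
the tangent map of the target. -/
theorem exists_Tm_zero_left {γ : G} {k : F} (hk : 𝒢.Tt γ k = 0) :
    ∃ w, 𝒢.Tt (𝒢.unit (𝒢.src γ)) w = 0 ∧ 𝒢.Tm γ (𝒢.unit (𝒢.src γ)) (0, w) = k := by
  have hc := 𝒢.composable_src γ
  set ε := 𝒢.unit (𝒢.src γ) with hε
  have hmu : 𝒢.mul γ ε = γ := 𝒢.mul_unit γ
  let A : F →ₗ[ℝ] F := (𝒢.Tm γ ε).toLinearMap ∘ₗ LinearMap.inr ℝ F F
  have hA : ∀ w ∈ LinearMap.ker (𝒢.Tt ε).toLinearMap, A w ∈ LinearMap.ker (𝒢.Tt γ).toLinearMap := by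
    intro w hw
    have h1 := (LocalLieGroupoid.Tm_zero_left hc hw).1
    rw [hmu] at h1
    exact h1
  -- All kernels of `Tt` have dimension `dim F - 3`, so injectivity of left translation between two
  -- of them gives surjectivity.
  have hfin : ∀ δ, Module.finrank ℝ (LinearMap.ker (𝒢.Tt δ).toLinearMap) + 3 =
      Module.finrank ℝ F := by
    intro δ
    have h1 := (𝒢.Tt δ).toLinearMap.finrank_range_add_finrank_ker
    rw [LinearMap.range_eq_top.2 (𝒢.Tt_surjective δ), finrank_top, finrank_euclideanSpace_fin] at h1
    omega
  have hinj : Function.Injective (A.restrict hA) := by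
    rw [injective_iff_map_eq_zero]
    intro w hw
    exact Subtype.ext (𝒢.Tm_zero_left_injective hc w.2 (congrArg Subtype.val hw))
  have hsurj := (LinearMap.injective_iff_surjective_of_finrank_eq_finrank
    (by have h1 := hfin ε; have h2 := hfin γ; omega)).1 hinj
  obtain ⟨w, hw⟩ := hsurj ⟨k, hk⟩
  exact ⟨w, w.2, congrArg Subtype.val hw⟩

/-- The fibres of the source and of the target are symplectically orthogonal. -/
theorem pairing_ker_ker {γ : G} {a b : F} (ha : 𝒢.Ts γ a = 0) (hb : 𝒢.Tt γ b = 0) :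
    𝒢.pairing γ a b = 0 := by
  obtain ⟨w, hw, rfl⟩ := 𝒢.exists_Tm_zero_left hb
  -- Multiplication by a unit gives `a = Tm (a, 0)` and `b = Tm (0, w)`, so isotropy of the graph
  -- evaluates `ω(a, b)` as `ω(a, 0) + ω(0, w) = 0`.
  have h1 := LocalLieGroupoid.Tm_unit_right (𝒢 := 𝒢.toLocalLieGroupoid) γ a
  rw [ha, map_zero] at h1
  have h2 := 𝒢.pairing_Tm (𝒢.composable_src γ) (v := a) (w := 0) (v' := 0) (w' := w)
    (by rw [ha, map_zero]) (by rw [hw, map_zero])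
  rw [h1, 𝒢.mul_unit] at h2
  rw [h2]
  simp

/-- This inclusion $(\ker Tt)^\omega\subseteq\ker Ts$ uses the maximality of the graph in place of a
dimension count. For a suitable `v`, the triple `(V, v, 0)` is orthogonal to the tangent space of
the graph over `(unit, γ)`, hence lies in it. So `V = Tm (v, 0)` with `Ts v = 0`, a vector tangent
to the source fibre. -/
theorem Ts_eq_zero_of_orthogonal {γ : G} {V : F}
    (hV : ∀ k, 𝒢.Tt γ k = 0 → 𝒢.pairing γ V k = 0) : 𝒢.Ts γ V = 0 := by
  have hc := 𝒢.composable_tgt γ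
  set ε := 𝒢.unit (𝒢.tgt γ) with hε
  have hmu : 𝒢.mul ε γ = γ := 𝒢.unit_mul γ
  obtain ⟨R, hR⟩ := (𝒢.Tt γ).toLinearMap.exists_rightInverse_of_surjective
    (LinearMap.range_eq_top.2 (𝒢.Tt_surjective γ))
  have hR' : ∀ z, 𝒢.Tt γ (R z) = z := fun z => congrArg (fun L => L z) hR
  -- `v` represents `v' ↦ ω(V, Tm (v', w'))` for the partner `w' = R (Ts v')`. Any other partner
  -- differs by an element of `ker Tt`, whose translate stays in `ker Tt` and is orthogonal to `V`,
  -- so the choice of `R` is immaterial.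
  obtain ⟨v, hv⟩ := 𝒢.exists_pairing_eq ε (𝒢.pairing γ V ∘ₗ (𝒢.Tm ε γ).toLinearMap ∘ₗ
    (LinearMap.prod LinearMap.id (R ∘ₗ (𝒢.Ts ε).toLinearMap)))
  have h1 : 𝒢.Ts ε v = 𝒢.Tt γ 0 ∧ V = 𝒢.Tm ε γ (v, 0) := by
    rw [𝒢.graph_iff hc]
    intro v' w' hvw
    have h2 : 𝒢.pairing ε v v' = 𝒢.pairing γ V (𝒢.Tm ε γ (v', R (𝒢.Ts ε v'))) := hv v'
    have h3 : 𝒢.Tt γ (w' - R (𝒢.Ts ε v')) = 0 := by rw [map_sub, hR', hvw, sub_self]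
    have h4 := (LocalLieGroupoid.Tm_zero_left hc h3).1
    rw [hmu] at h4
    have h5 := hV _ h4
    have h6 : 𝒢.Tm ε γ (v', w') =
        𝒢.Tm ε γ (v', R (𝒢.Ts ε v')) + 𝒢.Tm ε γ (0, w' - R (𝒢.Ts ε v')) := by
      rw [← map_add]; simp
    rw [hmu, h6, map_add, h5, h2]
    simp
  rw [map_zero] at h1
  have h2 := LocalLieGroupoid.Ts_Tm_zero_right hc h1.1
  rwa [hmu, ← h1.2] at h2

variable (σ : 𝒢.Bisec)

theorem fieldStrength_at (x : X) (v : Fin 2 → E3) : (fieldStrength 𝒢 σ).at x v =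
    𝒢.pairing (σ.sec x) (tder E3 F σ.sec x (v 0)) (tder E3 F σ.sec x (v 1)) := by
  rw [fieldStrength, pullback_at, pairing_apply,
    ContinuousAlternatingMap.compContinuousLinearMap_apply]
  congr 1
  ext i
  fin_cases i <;> rfl

theorem fieldStrength_eq_zero_iff : fieldStrength 𝒢 σ = 0 ↔
    ∀ x v w, 𝒢.pairing (σ.sec x) (tder E3 F σ.sec x v) (tder E3 F σ.sec x w) = 0 := by
  constructor
  · intro h x v w
    have h1 := 𝒢.fieldStrength_at σ x ![v, w]
    rw [h] at h1
    exact h1.symm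
  · intro h
    apply Form.ext_at
    intro x
    ext v
    rw [fieldStrength_at, h]
    rfl

/-- Vanishing of $F$ is isotropy; maximality is automatic. If `u` is orthogonal to $T\Sigma$,
subtracting the vector of $T\Sigma$ with the same source component leaves some `k` in `ker Ts` that
is still orthogonal to $T\Sigma$. It is also orthogonal to `ker Tt`, and as `l` is a diffeomorphism
$T\Sigma$ and `ker Tt` span, so `k = 0`. -/
theorem isLagrangian_iff : IsLagrangian 𝒢 σ ↔ fieldStrength 𝒢 σ = 0 := by
  rw [fieldStrength_eq_zero_iff]
  constructor
  · intro h x v w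
    exact (h x _).1 ⟨v, rfl⟩ w
  · intro h x (u : F)
    constructor
    · rintro ⟨v, rfl⟩ w
      exact h x v w
    · intro hu
      have hu' : ∀ v, 𝒢.pairing (σ.sec x) u (tder E3 F σ.sec x v) = 0 := hu
      obtain ⟨L, -, hL⟩ := σ.exists_tder_l_inverse x
      set T := tder E3 F σ.sec x with hT
      set k : F := u - T (𝒢.Ts (σ.sec x) u) with hk
      have hk1 : 𝒢.Ts (σ.sec x) k = 0 := by
        rw [hk, map_sub, hT, σ.Ts_tder_sec, sub_self]
      have hk0 : k = 0 := by
        refine 𝒢.eq_zero_of_pairing (α := σ.sec x) fun y => ?_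
        set ζ := L (𝒢.Tt (σ.sec x) y) with hζ
        have h1 : 𝒢.Tt (σ.sec x) (y - T ζ) = 0 := by
          rw [map_sub, hT, σ.Tt_tder_sec, hζ, hL, sub_self]
        have h2 : 𝒢.pairing (σ.sec x) k (T ζ) = 0 := by
          rw [hk, map_sub, LinearMap.sub_apply, hu', h, sub_zero]
        have h3 := 𝒢.pairing_ker_ker hk1 h1
        rw [map_sub, h2, sub_zero] at h3
        exact h3
      exact ⟨𝒢.Ts (σ.sec x) u, (sub_eq_zero.1 (hk ▸ hk0 : u - T (𝒢.Ts (σ.sec x) u) = 0)).symm⟩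

/-- Every covector is the contraction of the symplectic form with the infinitesimal right
translation of a vector that is tangent to the fibre of the source at a unit. -/
theorem exists_right_translation (x : X) (a : E3 →ₗ[ℝ] ℝ) :
    ∃ W : F, 𝒢.Ts (𝒢.unit x) W = 0 ∧ ∀ ξ, 𝒢.pairing (σ.sec x)
      (𝒢.Tm (σ.sec x) (𝒢.unit x) (tder E3 F σ.sec x (𝒢.Tt (𝒢.unit x) W), W))
      (tder E3 F σ.sec x ξ) = a ξ := by
  obtain ⟨L, hL, hL'⟩ := σ.exists_tder_l_inverse x
  set γ := σ.sec x with hγ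
  have hx : 𝒢.src γ = x := σ.src_sec x
  set T := tder E3 F σ.sec x with hT
  -- Composition with `Tt` makes the functional vanish on `ker Tt`, which forces `Ts V = 0`; the
  -- factor `L`, inverse to the derivative of `l`, makes it restrict to `a` on $T\Sigma$.
  obtain ⟨V, hV⟩ := 𝒢.exists_pairing_eq γ (a ∘ₗ L.toLinearMap ∘ₗ (𝒢.Tt γ).toLinearMap)
  have hV' : ∀ y, 𝒢.pairing γ V y = a (L (𝒢.Tt γ y)) := hV
  have hsV : 𝒢.Ts γ V = 0 := 𝒢.Ts_eq_zero_of_orthogonal fun k hk => by rw [hV', hk]; simp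
  set ζ := L (𝒢.Tt γ V) with hζ
  have hk : 𝒢.Tt γ (V - T ζ) = 0 := by rw [map_sub, hT, σ.Tt_tder_sec, hζ, hL', sub_self]
  obtain ⟨w, hw, hwk⟩ := 𝒢.exists_Tm_zero_left hk
  have h1 := (LocalLieGroupoid.Tm_zero_left (𝒢.composable_src γ) hw).2
  have h2 := LocalLieGroupoid.Tm_unit_right (𝒢 := 𝒢.toLocalLieGroupoid) γ (T ζ)
  rw [hwk, 𝒢.mul_unit, map_sub, hsV, hT, σ.Ts_tder_sec] at h1
  rw [hx] at hw hwk h1 h2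
  rw [hT, σ.Ts_tder_sec, ← hT] at h2
  -- `W` has target component `ζ`, so `V = T ζ + (V - T ζ)` is `Tm (T ζ, W)` by the unit law and the
  -- choice of `w`. Its source component is `ζ + Ts w`, and `Ts w = Ts (V - T ζ) = -ζ`.
  refine ⟨tder E3 F 𝒢.unit x ζ + w, ?_, fun ξ => ?_⟩
  · rw [map_add, LocalLieGroupoid.Ts_tder_unit, ← h1]
    simp
  · rw [map_add, LocalLieGroupoid.Tt_tder_unit, hw, add_zero]
    have h3 : 𝒢.Tm γ (𝒢.unit x) (T ζ, tder E3 F 𝒢.unit x ζ + w) = V := by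
      have h4 : ((T ζ, tder E3 F 𝒢.unit x ζ + w) : F × F) =
        (T ζ, tder E3 F 𝒢.unit x ζ) + (0, w) := by simp
      rw [h4, map_add, h2, hwk]
      abel
    rw [h3, hV', hT, σ.Tt_tder_sec, hL]

end LocalSymplecticGroupoid

end Groupoid

/-! ### Stationarity for vanishing field strength, and gauge invariance -/

section Equations

variable {X : Type*} [TopologicalSpace X] [ChartedSpace E3 X] [IsManifold 𝓘(ℝ, E3) ∞ X]
variable {F : Type*} [NormedAddCommGroup F] [NormedSpace ℝ F] [FiniteDimensional ℝ F]
variable {G : Type*} [TopologicalSpace G] [ChartedSpace F G] [IsManifold 𝓘(ℝ, F) ∞ G]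

theorem wedge_zero {E : Type*} [NormedAddCommGroup E] [NormedSpace ℝ E] {M : Type*}
    [TopologicalSpace M] [ChartedSpace E M] {k : ℕ} (a : Form E M 1) :
    wedge a (0 : Form E M k) = 0 :=
  Form.ext_at fun x => by
    rw [wedge_at, zero_at, ← wedgeCLM_apply, map_zero]
    rfl

theorem wedgeAlt_self {E : Type*} [NormedAddCommGroup E] [NormedSpace ℝ E]
    (a : E [⋀^Fin 1]→L[ℝ] ℝ) : wedgeAlt a a = 0 := by
  ext v
  have h : ∀ w : Fin 1 → E, w = fun _ => w 0 := fun w => funext fun i => by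
    rw [Subsingleton.elim i 0]
  rw [wedgeAlt_apply, Fin.sum_univ_two, h (Fin.removeNth 0 v), h (Fin.removeNth 1 v)]
  simp [Fin.removeNth_apply]
  ring

namespace Bisection

variable {𝒢 : LocalLieGroupoid X F G}

theorem mul_one_sec (σ : Bisection 𝒢) (x : X) : 𝒢.mul (σ.sec x) (𝒢.unit x) = σ.sec x := by
  have h := 𝒢.mul_unit (σ.sec x)
  rwa [σ.src_sec] at h

theorem l_eq_of_sec_eq_unit (Λ : Bisection 𝒢) {x : X} (h : Λ.sec x = 𝒢.unit x) : Λ.l x = x := by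
  rw [← Λ.tgt_sec, h, 𝒢.tgt_unit]

theorem mul_sec_eq_of_sec_eq_unit (σ Λ : Bisection 𝒢) (h : σ.Composable Λ) {x : X}
    (hx : Λ.sec x = 𝒢.unit x) : (σ.mul Λ h).sec x = σ.sec x := by
  change 𝒢.mul (σ.sec (Λ.l x)) (Λ.sec x) = _
  rw [Λ.l_eq_of_sec_eq_unit hx, hx, mul_one_sec]

theorem isVariation_mul (σ : Bisection 𝒢) {δ : ℝ → Bisection 𝒢} {K : Set X}
    (hδ : (one 𝒢).IsVariation δ K) (h : ∀ ε, σ.Composable (δ ε)) :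
    σ.IsVariation (fun ε => σ.mul (δ ε) (h ε)) K where
  smooth := by
    have h1 : ContMDiff (𝓘(ℝ, ℝ).prod 𝓘(ℝ, E3)) 𝓘(ℝ, F) ∞
        (fun p : ℝ × X => σ.sec ((δ p.1).l p.2)) := by
      -- Joint smoothness in the parameter is given for the sections only, so `l` is expressed as
      -- the target of the section.
      have h2 : (fun p : ℝ × X => σ.sec ((δ p.1).l p.2)) =
          fun p : ℝ × X => σ.sec (𝒢.tgt ((δ p.1).sec p.2)) :=
        funext fun p => by rw [(δ p.1).tgt_sec]
      rw [h2]
      exact σ.contMDiff_sec.comp (𝒢.contMDiff_tgt.comp hδ.smooth)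
    exact 𝒢.contMDiffOn_mul.comp_contMDiff (h1.prodMk hδ.smooth) fun p => h p.1 p.2
  zero := fun x => σ.mul_sec_eq_of_sec_eq_unit _ _ (hδ.zero x)
  eq_off := fun ε x hx => σ.mul_sec_eq_of_sec_eq_unit _ _ (hδ.eq_off ε x hx)

theorem tder_mul_sec (σ Λ : Bisection 𝒢) (h : σ.Composable Λ) (x : X) (v : E3) :
    tder E3 F (σ.mul Λ h).sec x v = 𝒢.Tm (σ.sec (Λ.l x)) (Λ.sec x)
      (tder E3 F σ.sec (Λ.l x) (tder E3 E3 Λ.l x v), tder E3 F Λ.sec x v) := by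
  have hl := Λ.l.contMDiff.mdifferentiable (by simp) x
  have h1 := LocalLieGroupoid.tder_mul (𝒢 := 𝒢) (f := σ.sec ∘ Λ.l) (g := Λ.sec) (x := x)
    ((σ.mdifferentiableAt_sec _).comp x hl) (Λ.mdifferentiableAt_sec x)
    (Filter.Eventually.of_forall h) v
  rw [tder_comp (E' := E3) x (σ.mdifferentiableAt_sec _) hl] at h1
  exact h1

end Bisection

namespace LocalSymplecticGroupoid

variable {Θ : PoissonStructure X} (𝒢 : LocalSymplecticGroupoid (F := F) (G := G) Θ)

/-- Isotropy of the graph splits $\omega$ on a product into its values on the two factors. The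
factor `Λ` contributes its own field strength, which is zero. -/
theorem fieldStrength_mul (σ Λ : 𝒢.Bisec) (h : σ.Composable Λ) (hΛ : IsLagrangian 𝒢 Λ) :
    fieldStrength 𝒢 (σ.mul Λ h) = pullback Λ.l (fieldStrength 𝒢 σ) := by
  rw [isLagrangian_iff, fieldStrength_eq_zero_iff] at hΛ
  apply Form.ext_at
  intro x
  ext v
  have hts : ∀ w : E3, 𝒢.Ts (σ.sec (Λ.l x)) (tder E3 F σ.sec (Λ.l x) (tder E3 E3 Λ.l x w)) =
      𝒢.Tt (Λ.sec x) (tder E3 F Λ.sec x w) := fun w => by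
    rw [σ.Ts_tder_sec, Λ.Tt_tder_sec]
  rw [fieldStrength_at, σ.tder_mul_sec, σ.tder_mul_sec, pullback_at,
    ContinuousAlternatingMap.compContinuousLinearMap_apply, fieldStrength_at]
  refine (𝒢.pairing_Tm (h x) (hts _) (hts _)).trans ?_
  rw [hΛ, add_zero]
  rfl

variable {𝒢} {ϑ : Form F G 1}

theorem extd_potential (hϑ : IsSmoothForm ϑ) (hω : extd ϑ = 𝒢.symp) (σ : 𝒢.Bisec) :
    extd (potential 𝒢 ϑ σ) = fieldStrength 𝒢 σ := by
  rw [potential, extd_pullback hϑ σ.contMDiff_sec, hω]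
  rfl

theorem isSmoothForm_potential (hϑ : IsSmoothForm ϑ) (σ : 𝒢.Bisec) :
    IsSmoothForm (potential 𝒢 ϑ σ) := hϑ.pullback σ.contMDiff_sec

theorem isSmoothForm_fieldStrength (σ : 𝒢.Bisec) : IsSmoothForm (fieldStrength 𝒢 σ) :=
  𝒢.smooth_symp.pullback σ.contMDiff_sec

theorem extd_potential_mul_sub (hϑ : IsSmoothForm ϑ) (hω : extd ϑ = 𝒢.symp) (σ Λ : 𝒢.Bisec)
    (h : σ.Composable Λ) (hΛ : IsLagrangian 𝒢 Λ) :
    extd (potential 𝒢 ϑ (σ.mul Λ h) - pullback Λ.l (potential 𝒢 ϑ σ)) = 0 := by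
  rw [extd_sub (isSmoothForm_potential hϑ _)
    ((isSmoothForm_potential hϑ σ).pullback Λ.l.contMDiff), extd_potential hϑ hω,
    extd_pullback (isSmoothForm_potential hϑ σ) Λ.l.contMDiff, extd_potential hϑ hω,
    fieldStrength_mul 𝒢 σ Λ h hΛ, sub_self]

variable [T2Space X] [SigmaCompactSpace X]

theorem formIntegral_zero (K : Set X) : formIntegral K (0 : Form E3 X 3) = 0 := by
  have h : ∀ (c : X) (y : E3), chartRep c (0 : Form E3 X 3) y = 0 := fun c y => chartRep_eq_zero rfl
  simp [formIntegral, h]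

variable [OrientedAtlas X]

/-- The first variation of the action. -/
theorem hasDerivAt_action (hϑ : IsSmoothForm ϑ) (hω : extd ϑ = 𝒢.symp) {σ : 𝒢.Bisec} {K : Set X}
    (hK : IsCompact K) {fam : ℝ → 𝒢.Bisec} (hfam : σ.IsVariation fam K) :
    HasDerivAt (fun ε => action 𝒢 ϑ K (fam ε))
      (2 * formIntegral K (wedge (contraction (fun ε => (fam ε).sec) 𝒢.symp)
        (fieldStrength 𝒢 σ))) 0 := by
  have h := hasDerivAt_formIntegral_pullback (S := fun ε => (fam ε).sec) hfam.smooth hϑ hK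
    fun ε x hx => by rw [hfam.eq_off ε x hx, hfam.zero]
  rw [hω, show (fam 0).sec = σ.sec from funext hfam.zero] at h
  exact h

theorem isCritical_of_fieldStrength_eq_zero (hϑ : IsSmoothForm ϑ) (hω : extd ϑ = 𝒢.symp)
    {σ : 𝒢.Bisec} (h : fieldStrength 𝒢 σ = 0) : IsCritical 𝒢 ϑ σ := by
  intro K fam hK hfam
  have h1 := hasDerivAt_action hϑ hω hK hfam
  rwa [h, wedge_zero, formIntegral_zero, mul_zero] at h1

theorem isCriticalRight_of_isCritical {σ : 𝒢.Bisec} (h : IsCritical 𝒢 ϑ σ) :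
    IsCriticalRight 𝒢 ϑ σ :=
  fun K δ hK hδ hc => h K (fun ε => σ.mul (δ ε) (hc ε)) hK (σ.isVariation_mul hδ hc)

/-- After the change of variables along `Λ.l`, both densities contain the same 2-form $F'$, which is
the exterior derivative of both potentials. By the Leibniz rule $(B-A)\wedge F'=d(A\wedge B)$. -/
theorem action_mul (hϑ : IsSmoothForm ϑ) (hω : extd ϑ = 𝒢.symp) (σ Λ : 𝒢.Bisec)
    (h : σ.Composable Λ) (hΛ : IsLagrangian 𝒢 Λ) (ho : OrientationPreserving Λ.l) {K : Set X}
    (hK : IsCompact K) :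
    action 𝒢 ϑ K (σ.mul Λ h) = action 𝒢 ϑ (Λ.l '' K) σ +
      formIntegral K (extd (wedge (pullback Λ.l (potential 𝒢 ϑ σ))
        (potential 𝒢 ϑ (σ.mul Λ h)))) := by
  have hs := isSmoothForm_potential hϑ σ
  have hs' := hs.pullback Λ.l.contMDiff
  have hm := isSmoothForm_potential hϑ (σ.mul Λ h)
  have hF := isSmoothForm_fieldStrength (σ.mul Λ h)
  have h1 : action 𝒢 ϑ (Λ.l '' K) σ =
      formIntegral K (wedge (pullback Λ.l (potential 𝒢 ϑ σ)) (fieldStrength 𝒢 (σ.mul Λ h))) := by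
    rw [action, density, ← formIntegral_pullback Λ.l ho hK (hs.wedge (isSmoothForm_fieldStrength σ)),
      pullback_wedge, fieldStrength_mul 𝒢 σ Λ h hΛ]
  rw [extd_wedge hs' hm, extd_pullback hs Λ.l.contMDiff, extd_potential hϑ hω,
    extd_potential hϑ hω, ← fieldStrength_mul 𝒢 σ Λ h hΛ,
    formIntegral_sub hK (hm.wedge hF) (hs'.wedge hF), h1, action, density]
  ring

/-- Near points off `K` the two potentials coincide, so their wedge product vanishes and Stokes
kills the boundary term. The diffeomorphism fixes every point off `K`, hence maps `K` onto itself.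
-/
theorem action_mul_of_eq_unit (hϑ : IsSmoothForm ϑ) (hω : extd ϑ = 𝒢.symp) (σ Λ : 𝒢.Bisec)
    (h : σ.Composable Λ) (hΛ : IsLagrangian 𝒢 Λ) (ho : OrientationPreserving Λ.l) {K : Set X}
    (hK : IsCompact K) (hoff : ∀ x ∉ K, Λ.sec x = 𝒢.unit x) :
    action 𝒢 ϑ K (σ.mul Λ h) = action 𝒢 ϑ K σ := by
  have hl : ∀ x ∉ K, Λ.l x = x := fun x hx => Λ.l_eq_of_sec_eq_unit (hoff x hx)
  have hlK : Λ.l '' K = K := by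
    ext x
    constructor
    · rintro ⟨y, hy, rfl⟩
      by_contra hx
      have e : Λ.l y = y := Λ.l.injective (hl _ hx)
      exact hx (by rw [e]; exact hy)
    · intro hx
      obtain ⟨y, rfl⟩ := Λ.l.surjective x
      refine ⟨y, ?_, rfl⟩
      by_contra hy
      exact hy (hl y hy ▸ hx)
  have hs' := (isSmoothForm_potential hϑ σ).pullback Λ.l.contMDiff
  rw [action_mul hϑ hω σ Λ h hΛ ho hK, hlK, formIntegral_extd
    (hs'.wedge (isSmoothForm_potential hϑ _)) hK, add_zero]
  intro x hx
  have hev : ∀ᶠ z in 𝓝 x, z ∉ K := hK.isClosed.isOpen_compl.mem_nhds hx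
  have h1 : (Λ.l : X → X) =ᶠ[𝓝 x] id := hev.mono hl
  have h2 : (σ.mul Λ h).sec =ᶠ[𝓝 x] σ.sec := hev.mono fun z hz =>
    σ.mul_sec_eq_of_sec_eq_unit Λ h (hoff z hz)
  have h3 : (pullback Λ.l (potential 𝒢 ϑ σ)).at x = (potential 𝒢 ϑ (σ.mul Λ h)).at x := by
    rw [pullback_at, h1.tder_eq, tder_id, hl x hx, potential, potential, pullback_at, pullback_at,
      h2.tder_eq, h2.self_of_nhds]
    rfl
  rw [wedge_at, h3, wedgeAlt_self]

end LocalSymplecticGroupoid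

end Equations

/-! ### Maps close to the identity are diffeomorphisms -/

section NearIdentity

variable {E : Type*} [NormedAddCommGroup E] [NormedSpace ℝ E] [CompleteSpace E]

/-- `Φ` differs from the identity by a map with Lipschitz constant 1/2, so it is a homeomorphism of
`E`. Its derivatives are invertible by the Neumann series, so the inverse is smooth. -/
theorem exists_contDiff_inverse {Φ : E → E} (hΦ : ContDiff ℝ ∞ Φ)
    (hd : ∀ y, ‖fderiv ℝ Φ y - ContinuousLinearMap.id ℝ E‖ ≤ 1 / 2) :
    ∃ Φ' : E → E, ContDiff ℝ ∞ Φ' ∧ (∀ y, Φ' (Φ y) = y) ∧ ∀ y, Φ (Φ' y) = y := by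
  rcases subsingleton_or_nontrivial E with hE | hE
  · exact ⟨id, contDiff_id, fun y => Subsingleton.elim _ _, fun y => Subsingleton.elim _ _⟩
  have hdiff : Differentiable ℝ Φ := hΦ.differentiable (by simp)
  have happ : ApproximatesLinearOn Φ ((ContinuousLinearEquiv.refl ℝ E : E ≃L[ℝ] E) : E →L[ℝ] E)
      Set.univ (1 / 2) := by
    intro x _ y _
    have h := Convex.norm_image_sub_le_of_norm_fderiv_le' (𝕜 := ℝ) (s := Set.univ) (x := y) (y := x)
      (fun z _ => hdiff z) (fun z _ => hd z) convex_univ trivial trivial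
    simpa using h
  have hc : Subsingleton E ∨ (1 / 2 : NNReal) <
      ‖((ContinuousLinearEquiv.refl ℝ E).symm : E →L[ℝ] E)‖₊⁻¹ := by
    right
    have h1 : ‖((ContinuousLinearEquiv.refl ℝ E).symm : E →L[ℝ] E)‖₊ = 1 := by
      ext; exact ContinuousLinearMap.norm_id
    rw [h1, inv_one]
    exact NNReal.half_lt_self one_ne_zero
  set e := happ.toHomeomorph Φ hc with he
  have hcoe : ∀ y, e y = Φ y := fun y => rfl
  have hlt : ∀ a, ‖ContinuousLinearMap.id ℝ E - fderiv ℝ Φ a‖ < 1 := fun a => by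
    rw [norm_sub_rev]
    exact (hd a).trans_lt (by norm_num)
  have hs : ContDiff ℝ ∞ e.symm := by
    refine e.contDiff_symm (f₀' := fun a =>
      ContinuousLinearEquiv.unitsEquiv ℝ E (Units.oneSub _ (hlt a))) (fun a => ?_) hΦ
    have h2 : ((ContinuousLinearEquiv.unitsEquiv ℝ E (Units.oneSub _ (hlt a)) : E ≃L[ℝ] E) :
        E →L[ℝ] E) = fderiv ℝ Φ a := by
      ext v
      change v - (v - fderiv ℝ Φ a v) = fderiv ℝ Φ a v
      abel
    rw [h2]
    exact (hdiff a).hasFDerivAt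
  exact ⟨e.symm, hs, e.left_inv, e.right_inv⟩

variable {M : Type*} [TopologicalSpace M] [ChartedSpace E M] [IsManifold 𝓘(ℝ, E) ∞ M] [T2Space M]

/-- A smooth map that is the identity off a compact subset of a chart, and is close to the identity
in this chart, is a diffeomorphism. -/
theorem exists_diffeomorph_of_near_id {c : M} {C : Set M} (hC : IsCompact C)
    (hCs : C ⊆ (extChartAt 𝓘(ℝ, E) c).source) {l : M → M} (hl : ContMDiff 𝓘(ℝ, E) 𝓘(ℝ, E) ∞ l)
    (hoff : ∀ x ∉ C, l x = x) (hin : ∀ x ∈ C, l x ∈ (extChartAt 𝓘(ℝ, E) c).source)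
    (hd : ∀ x ∈ C, ‖fderiv ℝ (readIn E E c c l) (extChartAt 𝓘(ℝ, E) c x) -
      ContinuousLinearMap.id ℝ E‖ ≤ 1 / 2) :
    ∃ D : Diffeomorph 𝓘(ℝ, E) 𝓘(ℝ, E) M M ∞, ∀ x, D x = l x := by
  classical
  set φ := extChartAt 𝓘(ℝ, E) c with hφ
  set C' := φ '' C with hC'
  have hC'c : IsClosed C' := (hC.image_of_continuousOn ((continuousOn_extChartAt c).mono hCs)).isClosed
  have hC'T : C' ⊆ φ.target := by
    rintro _ ⟨x, hx, rfl⟩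
    exact φ.map_source (hCs hx)
  have hls : ∀ x ∈ φ.source, l x ∈ φ.source := by
    intro x hx
    by_cases h : x ∈ C
    · exact hin x h
    · rwa [hoff x h]
  -- The map `l` in the chart, extended by the identity to all of `E`. It is already the identity
  -- off the compact set `C'`, so the extension is smooth and global inversion applies.
  set Φ : E → E := fun y => if y ∈ φ.target then readIn E E c c l y else y with hΦ
  have hΦT : ∀ y ∈ φ.target, Φ y = φ (l (φ.symm y)) := fun y hy => if_pos hy
  have hΦmem : ∀ y ∈ φ.target, Φ y ∈ φ.target := fun y hy => by
    rw [hΦT y hy]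
    exact φ.map_source (hls _ (φ.map_target hy))
  have hΦoff : ∀ y ∉ C', Φ y = y := by
    intro y hy
    by_cases hyT : y ∈ φ.target
    · rw [hΦT y hyT, hoff _ fun h => hy ⟨_, h, φ.right_inv hyT⟩, φ.right_inv hyT]
    · exact if_neg hyT
  have hΦev : ∀ y ∈ φ.target, Φ =ᶠ[𝓝 y] readIn E E c c l := fun y hy => by
    filter_upwards [chart_target_mem_nhds hy] with z hz using if_pos hz
  have hΦev' : ∀ y ∉ C', Φ =ᶠ[𝓝 y] id := fun y hy => by
    filter_upwards [hC'c.isOpen_compl.mem_nhds hy] with z hz using hΦoff z hz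
  obtain ⟨Φ', hΦ's, hl', hr'⟩ := exists_contDiff_inverse (Φ := Φ)
    (contDiff_iff_contDiffAt.2 fun y => by
      by_cases hy : y ∈ C'
      · have hyT := hC'T hy
        exact (contDiffAt_readIn hyT hl.contMDiffAt (hls _ (φ.map_target hyT))).congr_of_eventuallyEq
          (hΦev y hyT)
      · exact contDiffAt_id.congr_of_eventuallyEq (hΦev' y hy))
    (fun y => by
      by_cases hy : y ∈ C'
      · rw [(hΦev y (hC'T hy)).fderiv_eq]
        obtain ⟨x, hx, rfl⟩ := hy
        exact hd x hx
      · rw [(hΦev' y hy).fderiv_eq, fderiv_id, sub_self, norm_zero]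
        norm_num)
  have hΦ'off : ∀ y ∉ C', Φ' y = y := fun y hy => by
    conv_lhs => rw [← hΦoff y hy]
    exact hl' y
  -- `Φ` fixes all points outside the chart target, so its inverse cannot leave the target and can
  -- be carried back to `M`.
  have hΦ'mem : ∀ y ∈ φ.target, Φ' y ∈ φ.target := by
    intro y hy
    by_contra h
    have h1 : Φ (Φ' y) = Φ' y := if_neg h
    rw [hr'] at h1
    exact h (h1 ▸ hy)
  set l' : M → M := fun x => if x ∈ φ.source then φ.symm (Φ' (φ x)) else x with hl'def
  have hl's : ∀ x ∈ φ.source, l' x = φ.symm (Φ' (φ x)) := fun x hx => if_pos hx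
  have hlinv : ∀ x, l' (l x) = x := by
    intro x
    by_cases hx : x ∈ φ.source
    · have h1 : φ (l x) = Φ (φ x) := by rw [hΦT _ (φ.map_source hx), φ.left_inv hx]
      rw [hl's _ (hls x hx), h1, hl', φ.left_inv hx]
    · rw [hoff x fun h => hx (hCs h)]
      exact if_neg hx
  have hrinv : ∀ x, l (l' x) = x := by
    intro x
    by_cases hx : x ∈ φ.source
    · have h1 := hΦ'mem _ (φ.map_source hx)
      rw [hl's x hx]
      apply φ.injOn (hls _ (φ.map_target h1)) hx
      rw [← hΦT _ h1, hr']
    · rw [show l' x = x from if_neg hx, hoff x fun h => hx (hCs h)]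
  have hl'smooth : ContMDiff 𝓘(ℝ, E) 𝓘(ℝ, E) ∞ l' := by
    intro x
    by_cases hx : x ∈ φ.source
    · have h1 := hΦ'mem _ (φ.map_source hx)
      have h2 : ContMDiffAt 𝓘(ℝ, E) 𝓘(ℝ, E) ∞ (fun x => φ.symm (Φ' (φ x))) x :=
        ContMDiffAt.comp (g := φ.symm) x (contMDiffAt_extChartAt_symm h1)
          (ContMDiffAt.comp (g := Φ') x hΦ's.contMDiff.contMDiffAt
            (contMDiffAt_extChartAt_of_mem hx))
      refine h2.congr_of_eventuallyEq ?_
      filter_upwards [(isOpen_extChartAt_source c).mem_nhds hx] with z hz using hl's z hz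
    · refine contMDiffAt_id.congr_of_eventuallyEq ?_
      filter_upwards [hC.isClosed.isOpen_compl.mem_nhds fun h => hx (hCs h)] with z hz
      by_cases hzs : z ∈ φ.source
      · rw [hl's z hzs, hΦ'off, φ.left_inv hzs]
        · rfl
        · rintro ⟨w, hw, hwz⟩
          exact hz (φ.injOn (hCs hw) hzs hwz ▸ hw)
      · exact if_neg hzs
  exact ⟨⟨⟨l, l', hlinv, hrinv⟩, hl, hl'smooth⟩, fun x => rfl⟩

/-- The members of a smooth family of maps that starts at the identity, and is constant off a
compact subset of a chart, are diffeomorphisms for small parameters. -/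
theorem eventually_exists_diffeomorph {c : M} {C : Set M} (hC : IsCompact C)
    (hCs : C ⊆ (extChartAt 𝓘(ℝ, E) c).source) {l : ℝ → M → M} (h0 : ∀ x, l 0 x = x)
    (hoff : ∀ s, ∀ x ∉ C, l s x = x)
    (hl : ∀ x ∈ C, ∀ᶠ p in 𝓝 ((0 : ℝ), x),
      ContMDiffAt (𝓘(ℝ, ℝ).prod 𝓘(ℝ, E)) 𝓘(ℝ, E) ∞ (fun p : ℝ × M => l p.1 p.2) p) :
    ∀ᶠ s in 𝓝 (0 : ℝ), ∃ D : Diffeomorph 𝓘(ℝ, E) 𝓘(ℝ, E) M M ∞, ∀ x, D x = l s x := by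
  set φ := extChartAt 𝓘(ℝ, E) c with hφ
  -- These conditions hold near each `(0, x)`, since `l 0` is the identity and the space derivative
  -- depends continuously on both variables. Compactness of `C` then gives one bound on the
  -- parameter for all `x ∈ C`.
  have hkey : ∀ x ∈ C, ∀ᶠ p in 𝓝 ((0 : ℝ), x),
      ContMDiffAt (𝓘(ℝ, ℝ).prod 𝓘(ℝ, E)) 𝓘(ℝ, E) ∞ (fun p : ℝ × M => l p.1 p.2) (p.1, p.2) ∧
      l p.1 p.2 ∈ φ.source ∧
      ‖fderiv ℝ (readIn E E c c (l p.1)) (φ p.2) - ContinuousLinearMap.id ℝ E‖ ≤ 1 / 2 := by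
    intro x hx
    have hxs := hCs hx
    have hcont := (hl x hx).self_of_nhds.continuousAt
    have hsrc : ∀ᶠ p in 𝓝 ((0 : ℝ), x), l p.1 p.2 ∈ φ.source :=
      hcont.eventually ((isOpen_extChartAt_source c).mem_nhds (by
        change l 0 x ∈ φ.source
        rwa [h0]))
    refine (hl x hx).and (hsrc.and ?_)
    set r : ℝ × E → E := fun q => φ (l q.1 (φ.symm q.2)) with hr
    have hinv : ContinuousAt (fun q : ℝ × E => (q.1, φ.symm q.2)) ((0 : ℝ), φ x) :=
      continuousAt_fst.prodMk (ContinuousAt.comp (g := φ.symm)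
        (continuousAt_extChartAt_symm'' (φ.map_source hxs)) continuousAt_snd)
    have hinv0 : ((0 : ℝ), φ.symm (φ x)) = (0, x) := by rw [φ.left_inv hxs]
    have hrs : ∀ᶠ q in 𝓝 ((0 : ℝ), φ x), ContDiffAt ℝ ∞ r q := by
      have h1 := hinv.eventually (p := fun p : ℝ × M => ContMDiffAt (𝓘(ℝ, ℝ).prod 𝓘(ℝ, E)) 𝓘(ℝ, E) ∞
        (fun p : ℝ × M => l p.1 p.2) p ∧ l p.1 p.2 ∈ φ.source) (by
          simp only [hinv0]
          exact (hl x hx).and hsrc)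
      filter_upwards [h1, continuousAt_snd.eventually
        (chart_target_mem_nhds (φ.map_source hxs))] with q hq hqT
      rw [← contMDiffAt_iff_contDiffAt]
      refine ContMDiffAt.comp (g := φ) q (contMDiffAt_extChartAt_of_mem hq.2)
        (ContMDiffAt.comp (I' := 𝓘(ℝ, ℝ).prod 𝓘(ℝ, E)) (g := fun p : ℝ × M => l p.1 p.2)
          (f := fun q : ℝ × E => (q.1, φ.symm q.2)) q hq.1 ?_)
      exact (contDiff_fst.contMDiff.contMDiffAt).prodMk
        (ContMDiffAt.comp (g := φ.symm) q (contMDiffAt_extChartAt_symm hqT)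
          contDiff_snd.contMDiff.contMDiffAt)
    have hslice : ∀ q : ℝ × E, ContDiffAt ℝ ∞ r q → fderiv ℝ (readIn E E c c (l q.1)) q.2 =
        (fderiv ℝ r q).comp (ContinuousLinearMap.inr ℝ ℝ E) := by
      intro q hq
      exact (HasFDerivAt.comp (g := r) (f := fun z : E => (q.1, z)) q.2
        (hq.differentiableAt (by simp)).hasFDerivAt (hasFDerivAt_prodMk_right q.1 q.2)).fderiv
    have hd0 : (fderiv ℝ r (0, φ x)).comp (ContinuousLinearMap.inr ℝ ℝ E) =
        ContinuousLinearMap.id ℝ E := by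
      rw [← hslice _ hrs.self_of_nhds]
      have h1 : readIn E E c c (l 0) =ᶠ[𝓝 (φ x)] id := by
        filter_upwards [chart_target_mem_nhds (φ.map_source hxs)] with z hz
        simp only [readIn, Function.comp_apply, h0]
        exact φ.right_inv hz
      exact h1.fderiv_eq.trans fderiv_id
    have hdc : ContinuousAt (fun q => ‖(fderiv ℝ r q).comp (ContinuousLinearMap.inr ℝ ℝ E) -
        ContinuousLinearMap.id ℝ E‖) ((0 : ℝ), φ x) := by
      have h1 : ContinuousAt (fderiv ℝ r) ((0 : ℝ), φ x) :=
        (hrs.self_of_nhds.fderiv_right (m := 0) (by simp)).continuousAt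
      exact ((h1.clm_comp continuousAt_const).sub continuousAt_const).norm
    have hsmall : ∀ᶠ q in 𝓝 ((0 : ℝ), φ x), ‖fderiv ℝ (readIn E E c c (l q.1)) q.2 -
        ContinuousLinearMap.id ℝ E‖ ≤ 1 / 2 := by
      have h2 := hdc.eventually (p := fun t => t < 1 / 2) (by
        simp only [hd0, sub_self, norm_zero]
        exact Iio_mem_nhds (by norm_num))
      filter_upwards [h2, hrs] with q hq hqs
      rw [hslice q hqs]
      exact hq.le
    have hφc : ContinuousAt (fun p : ℝ × M => (p.1, φ p.2)) ((0 : ℝ), x) :=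
      continuousAt_fst.prodMk (ContinuousAt.comp (g := φ)
        (continuousAt_extChartAt' hxs) continuousAt_snd)
    exact hφc.eventually hsmall
  have hev := hC.eventually_forall_of_forall_eventually (P := fun s x =>
      ContMDiffAt (𝓘(ℝ, ℝ).prod 𝓘(ℝ, E)) 𝓘(ℝ, E) ∞ (fun p : ℝ × M => l p.1 p.2) (s, x) ∧
      l s x ∈ φ.source ∧
      ‖fderiv ℝ (readIn E E c c (l s)) (φ x) - ContinuousLinearMap.id ℝ E‖ ≤ 1 / 2) hkey
  filter_upwards [hev] with s hs
  have hsm : ContMDiff 𝓘(ℝ, E) 𝓘(ℝ, E) ∞ (l s) := by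
    intro x
    by_cases hx : x ∈ C
    · exact ContMDiffAt.comp (I' := 𝓘(ℝ, ℝ).prod 𝓘(ℝ, E)) (g := fun p : ℝ × M => l p.1 p.2)
        (f := fun z : M => (s, z)) x (hs x hx).1 (contMDiffAt_const.prodMk contMDiffAt_id)
    · refine contMDiffAt_id.congr_of_eventuallyEq ?_
      filter_upwards [hC.isClosed.isOpen_compl.mem_nhds hx] with z hz using hoff s z hz
  exact exists_diffeomorph_of_near_id hC hCs hsm (hoff s) (fun x hx => (hs x hx).2.1)
    fun x hx => (hs x hx).2.2

end NearIdentity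

/-! ### Positivity of integrals -/

section Positivity

open MeasureTheory

variable {X : Type*} [TopologicalSpace X] [ChartedSpace E3 X] [IsManifold 𝓘(ℝ, E3) ∞ X]
variable [OrientedAtlas X] [T2Space X] [SigmaCompactSpace X]

theorem chartRep_apply_basis (c : X) (η : Form E3 X 3) (y : E3) :
    chartRep c η y (fun i => EuclideanSpace.single i (1 : ℝ)) =
      (tder E3 E3 (extChartAt 𝓘(ℝ, E3) c).symm y).det *
        η.at ((extChartAt 𝓘(ℝ, E3) c).symm y) (fun i => EuclideanSpace.single i (1 : ℝ)) := by
  rw [chartRep_eq, compContinuousLinearMap_apply_basis]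

/-- The integral of a nonnegative 3-form that is positive somewhere is positive. -/
theorem formIntegral_pos {η : Form E3 X 3} (hη : IsSmoothForm η) {K : Set X} (hK : IsCompact K)
    (h0 : ∀ x, 0 ≤ η.at x (fun i => EuclideanSpace.single i (1 : ℝ))) {x₀ : X} (hx₀ : K ∈ 𝓝 x₀)
    (hpos : 0 < η.at x₀ (fun i => EuclideanSpace.single i (1 : ℝ))) : 0 < formIntegral K η := by
  obtain ⟨s, hs, hs1⟩ := exists_finset_chartPartition hK
  have hnn : ∀ (c : X) (y : E3), y ∈ (extChartAt 𝓘(ℝ, E3) c).target →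
      0 ≤ chartPartition X c ((extChartAt 𝓘(ℝ, E3) c).symm y) *
        chartRep c η y (fun i => EuclideanSpace.single i (1 : ℝ)) := by
    intro c y hy
    rw [chartRep_apply_basis]
    exact mul_nonneg ((chartPartition X).nonneg c _)
      (mul_nonneg (det_tder_chart_symm_pos hy).le (h0 _))
  have hmeas : ∀ c : X, MeasurableSet ((extChartAt 𝓘(ℝ, E3) c).target ∩
      (extChartAt 𝓘(ℝ, E3) c).symm ⁻¹' K) := fun c => measurableSet_chart_preimage c hK.isClosed
  rw [formIntegral_eq_sum hK.isClosed hs]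
  have hx₀K := mem_of_mem_nhds hx₀
  obtain ⟨c, hcs, hc⟩ : ∃ c ∈ s, 0 < chartPartition X c x₀ := by
    by_contra! h
    have h1 := hs1 x₀ hx₀K
    have h2 := Finset.sum_nonpos h
    linarith
  refine Finset.sum_pos' (fun c _ => setIntegral_nonneg (hmeas c) fun y hy => hnn c y hy.1)
    ⟨c, hcs, ?_⟩
  have hxc : x₀ ∈ (extChartAt 𝓘(ℝ, E3) c).source :=
    tsupport_chartPartition_subset c (subset_tsupport _ hc.ne')
  set y₀ := extChartAt 𝓘(ℝ, E3) c x₀ with hy₀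
  have hy₀T : y₀ ∈ (extChartAt 𝓘(ℝ, E3) c).target := (extChartAt 𝓘(ℝ, E3) c).map_source hxc
  have hxy : (extChartAt 𝓘(ℝ, E3) c).symm y₀ = x₀ := (extChartAt 𝓘(ℝ, E3) c).left_inv hxc
  rw [chartIntegral, setIntegral_pos_iff_support_of_nonneg_ae
    ((ae_restrict_iff' (hmeas c)).2 (Filter.Eventually.of_forall fun y hy => hnn c y hy.1))
    (integrableOn_partition hη hK c)]
  refine Measure.measure_pos_of_mem_nhds (x := y₀) volume ?_
  have hsymm : ContinuousAt (extChartAt 𝓘(ℝ, E3) c).symm y₀ := continuousAt_extChartAt_symm'' hy₀T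
  have hcont : ContinuousAt (fun y => chartPartition X c ((extChartAt 𝓘(ℝ, E3) c).symm y) *
      chartRep c η y (fun i => EuclideanSpace.single i (1 : ℝ))) y₀ :=
    (ContinuousAt.comp (continuous_chartPartition c).continuousAt hsymm).mul
      ((ContinuousAlternatingMap.apply ℝ E3 ℝ
        (fun i => EuclideanSpace.single i (1 : ℝ))).continuous.continuousAt.comp
          (hη.contDiffAt hy₀T).continuousAt)
  refine Filter.inter_mem (hcont.eventually_ne ?_)
    (Filter.inter_mem (chart_target_mem_nhds hy₀T) (hsymm (by rwa [hxy])))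
  rw [chartRep_apply_basis, hxy]
  exact (mul_pos hc (mul_pos (det_tder_chart_symm_pos hy₀T) hpos)).ne'

end Positivity

/-! ### Construction of right variations -/

section Variations

variable {X : Type*} [TopologicalSpace X] [ChartedSpace E3 X] [IsManifold 𝓘(ℝ, E3) ∞ X]
variable {F : Type*} [NormedAddCommGroup F] [NormedSpace ℝ F] [FiniteDimensional ℝ F]
variable {G : Type*} [TopologicalSpace G] [ChartedSpace F G] [IsManifold 𝓘(ℝ, F) ∞ G]

/-- The wedge pairing of 1-forms and 2-forms in dimension 3 is perfect. With the signed components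
of `b` on the coordinate planes as coefficients of `a`, the value is the sum of their squares. -/
theorem exists_wedgeAlt_pos {b : E3 [⋀^Fin 2]→L[ℝ] ℝ} (hb : b ≠ 0) :
    ∃ a : E3 →L[ℝ] ℝ, 0 < wedgeAlt (ContinuousAlternatingMap.ofSubsingleton ℝ E3 ℝ (0 : Fin 1) a) b
      (fun i => EuclideanSpace.single i (1 : ℝ)) := by
  set e : Fin 3 → E3 := fun i => EuclideanSpace.single i (1 : ℝ) with he
  set w : Fin 3 → ℝ := fun i => (-1 : ℝ) ^ i.val * b (i.removeNth e) with hw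
  set a : E3 →L[ℝ] ℝ := ∑ i, w i • EuclideanSpace.proj i with ha
  have hae : ∀ i, a (e i) = w i := fun i => by
    simp [ha, he]
  have hval : wedgeAlt (ContinuousAlternatingMap.ofSubsingleton ℝ E3 ℝ (0 : Fin 1) a) b e =
      ∑ i, w i * w i := by
    rw [wedgeAlt_apply]
    refine Finset.sum_congr rfl fun i _ => ?_
    change (-1 : ℝ) ^ i.val * (a (e i) * b (i.removeNth e)) = _
    rw [hae, hw]
    ring
  refine ⟨a, ?_⟩
  rw [hval]
  refine lt_of_le_of_ne (Finset.sum_nonneg fun i _ => mul_self_nonneg _) fun h0 => hb ?_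
  have hw0 : ∀ i : Fin 3, b (i.removeNth e) = 0 := by
    intro i
    have h1 := (Finset.sum_eq_zero_iff_of_nonneg fun i _ => mul_self_nonneg (w i)).1 h0.symm i
      (Finset.mem_univ i)
    have h2 : w i = 0 := mul_self_eq_zero.1 h1
    rcases mul_eq_zero.1 h2 with h3 | h3
    · exact absurd h3 (pow_ne_zero _ (by norm_num))
    · exact h3
  have hb2 : ∀ i j : Fin 3, b ![e i, e j] = 0 := by
    have hr0 : Fin.removeNth 0 e = ![e 1, e 2] := by ext i; fin_cases i <;> rfl
    have hr1 : Fin.removeNth 1 e = ![e 0, e 2] := by ext i; fin_cases i <;> rfl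
    have hr2 : Fin.removeNth 2 e = ![e 0, e 1] := by ext i; fin_cases i <;> rfl
    have h0 := hw0 0
    have h1 := hw0 1
    have h2 := hw0 2
    rw [hr0] at h0
    rw [hr1] at h1
    rw [hr2] at h2
    have hs : ∀ i, b ![e i, e i] = 0 := fun i => b.map_eq_zero_of_eq _ (i := 0) (j := 1) rfl (by decide)
    intro i j
    fin_cases i <;> fin_cases j
    · exact hs 0
    · exact h2
    · exact h1
    · exact (alternating_swap b _ _).trans (by simpa using h2)
    · exact hs 1
    · exact h0
    · exact (alternating_swap b _ _).trans (by simpa using h1)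
    · exact (alternating_swap b _ _).trans (by simpa using h0)
    · exact hs 2
  have hbm : b.toAlternatingMap = 0 := by
    refine (EuclideanSpace.basisFun (Fin 3) ℝ).toBasis.ext_alternating fun v _ => ?_
    have h1 : (fun i => (EuclideanSpace.basisFun (Fin 3) ℝ).toBasis (v i)) = ![e (v 0), e (v 1)] := by
      ext i
      fin_cases i <;> simp [he]
    rw [h1]
    exact hb2 _ _
  ext v
  exact congrArg (fun g => g v) hbm

variable [T2Space X]

/-- A deformation of the unit section along the fibres of the source, cut off by a bump function,
gives a family of bisections. -/
theorem exists_bisection_family {𝒢 : LocalLieGroupoid X F G} (σ : Bisection 𝒢) {ψ : ℝ → X → G}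
    {O : Set (ℝ × X)} (hO : IsOpen O)
    (hψ : ContMDiffOn (𝓘(ℝ, ℝ).prod 𝓘(ℝ, E3)) 𝓘(ℝ, F) ∞ (fun p : ℝ × X => ψ p.1 p.2) O)
    (hu : ∀ p ∈ O, ψ 0 p.2 = 𝒢.unit p.2) (hsrc : ∀ p ∈ O, 𝒢.src (ψ p.1 p.2) = p.2)
    {x₀ : X} (χ : SmoothBumpFunction 𝓘(ℝ, E3) x₀) (hχ : ∀ x ∈ tsupport χ, ((0 : ℝ), x) ∈ O) :
    ∃ r : ℝ, 0 < r ∧ ∃ δ : ℝ → Bisection 𝒢, (∀ ε, σ.Composable (δ ε)) ∧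
      (Bisection.one 𝒢).IsVariation δ (tsupport χ) ∧
      ∀ ε x, ((0 : ℝ), x) ∈ O → (δ ε).sec x = ψ (r * Real.sin ε * χ x) x := by
  classical
  have hχs : ContMDiff 𝓘(ℝ, E3) 𝓘(ℝ, ℝ) ∞ χ := χ.contMDiff
  set C := tsupport χ with hC
  have hCc : IsCompact C := χ.hasCompactSupport
  have hCcl : IsClosed C := isClosed_tsupport _
  have hχ0 : ∀ x ∉ C, χ x = 0 := fun x hx => image_eq_zero_of_notMem_tsupport hx
  -- `ψ` is controlled only on `O`. Where `χ` vanishes inside the neighbourhood, `ψ 0` is already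
  -- the unit section, so the two branches fit together smoothly.
  set d : ℝ → X → G := fun s x => if ((0 : ℝ), x) ∈ O then ψ (s * χ x) x else 𝒢.unit x with hd
  have hdO : ∀ s x, ((0 : ℝ), x) ∈ O → d s x = ψ (s * χ x) x := fun s x hx => if_pos hx
  have hdoff : ∀ s, ∀ x ∉ C, d s x = 𝒢.unit x := by
    intro s x hx
    by_cases hxO : ((0 : ℝ), x) ∈ O
    · rw [hdO s x hxO, hχ0 x hx, mul_zero]
      exact hu _ hxO
    · exact if_neg hxO
  have hd0 : ∀ x, d 0 x = 𝒢.unit x := by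
    intro x
    by_cases hxO : ((0 : ℝ), x) ∈ O
    · rw [hdO 0 x hxO, zero_mul]
      exact hu _ hxO
    · exact if_neg hxO
  have hmap : ContMDiff (𝓘(ℝ, ℝ).prod 𝓘(ℝ, E3)) (𝓘(ℝ, ℝ).prod 𝓘(ℝ, E3)) ∞
      (fun p : ℝ × X => (p.1 * χ p.2, p.2)) :=
    (contMDiff_fst.mul (hχs.comp contMDiff_snd)).prodMk contMDiff_snd
  have hsl : Continuous (fun p : ℝ × X => ((0 : ℝ), p.2)) := by fun_prop
  have hnear : ∀ x ∈ C, ∀ᶠ p in 𝓝 ((0 : ℝ), x), (p.1 * χ p.2, p.2) ∈ O := by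
    intro x hx
    refine hmap.continuous.continuousAt.eventually (hO.mem_nhds ?_)
    simpa using hχ x hx
  have hds : ∀ s x, (x ∈ C → (s * χ x, x) ∈ O) → ContMDiffAt (𝓘(ℝ, ℝ).prod 𝓘(ℝ, E3)) 𝓘(ℝ, F) ∞
      (fun p : ℝ × X => d p.1 p.2) (s, x) := by
    intro s x hx
    by_cases hxC : x ∈ C
    · have h1 : ContMDiffAt (𝓘(ℝ, ℝ).prod 𝓘(ℝ, E3)) 𝓘(ℝ, F) ∞
          (fun p : ℝ × X => ψ (p.1 * χ p.2) p.2) (s, x) :=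
        ContMDiffAt.comp (g := fun p : ℝ × X => ψ p.1 p.2) (s, x)
          (hψ.contMDiffAt (hO.mem_nhds (hx hxC))) hmap.contMDiffAt
      refine h1.congr_of_eventuallyEq ?_
      filter_upwards [hsl.continuousAt.eventually (hO.mem_nhds (hχ x hxC))] with p hp
        using hdO p.1 p.2 hp
    · refine (𝒢.contMDiff_unit.comp contMDiff_snd).contMDiffAt.congr_of_eventuallyEq ?_
      filter_upwards [continuousAt_snd.eventually (hCcl.isOpen_compl.mem_nhds hxC)] with p hp
        using hdoff p.1 p.2 hp
  have hdsrc : ∀ s x, (x ∈ C → (s * χ x, x) ∈ O) → 𝒢.src (d s x) = x := by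
    intro s x hx
    by_cases hxC : x ∈ C
    · rw [hdO s x (hχ x hxC)]
      exact hsrc _ (hx hxC)
    · rw [hdoff s x hxC, 𝒢.src_unit]
  have hdiff := eventually_exists_diffeomorph (c := x₀) hCc χ.tsupport_subset_extChartAt_source
    (l := fun s x => 𝒢.tgt (d s x)) (fun x => by rw [hd0, 𝒢.tgt_unit])
    (fun s x hx => by rw [hdoff s x hx, 𝒢.tgt_unit])
    (fun x hx => (hnear x hx).mono fun p hp =>
      ContMDiffAt.comp (g := 𝒢.tgt) (f := fun p : ℝ × X => d p.1 p.2) p 𝒢.contMDiff_tgt.contMDiffAt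
        (hds p.1 p.2 fun _ => hp))
  have hunit : ∀ x, (σ.sec x, 𝒢.unit x) ∈ 𝒢.composable := fun x => by
    have h := 𝒢.composable_src (σ.sec x)
    rwa [σ.src_sec] at h
  have hcomp : ∀ x ∈ C, ∀ᶠ p in 𝓝 ((0 : ℝ), x),
      (σ.sec (𝒢.tgt (d p.1 p.2)), d p.1 p.2) ∈ 𝒢.composable := by
    intro x hx
    have h1 := (hds 0 x fun _ => by simpa using hχ x hx).continuousAt
    refine LocalLieGroupoid.eventually_composable (𝒢 := 𝒢)
      (f := fun p : ℝ × X => σ.sec (𝒢.tgt (d p.1 p.2))) (g := fun p : ℝ × X => d p.1 p.2)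
      (ContinuousAt.comp (g := fun γ => σ.sec (𝒢.tgt γ))
        (σ.contMDiff_sec.continuous.comp 𝒢.contMDiff_tgt.continuous).continuousAt h1) h1 ?_
      (Filter.Eventually.of_forall fun p => σ.src_sec _)
    simp only [hd0, 𝒢.tgt_unit]
    exact hunit x
  -- For small parameters, uniformly on the compact support, three things hold: the induced map of
  -- `X` is a diffeomorphism, the deformation stays in `O`, and the products with `σ` are defined.
  have hall := hdiff.and ((hCc.eventually_forall_of_forall_eventually
    (P := fun s x => (s * χ x, x) ∈ O) hnear).and (hCc.eventually_forall_of_forall_eventually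
    (P := fun s x => (σ.sec (𝒢.tgt (d s x)), d s x) ∈ 𝒢.composable) hcomp))
  obtain ⟨r, hr, hball⟩ := Metric.eventually_nhds_iff.1 hall
  -- A variation must be defined for all real parameters. The function `r / 2 * sin ε` keeps the
  -- deformation parameter below `r` and has the nonzero derivative `r / 2` at `0`.
  set τ : ℝ → ℝ := fun ε => r / 2 * Real.sin ε with hτ
  have hτr : ∀ ε, dist (τ ε) 0 < r := fun ε => by
    rw [Real.dist_eq, sub_zero, hτ, abs_mul, abs_of_pos (half_pos hr)]
    have := Real.abs_sin_le_one ε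
    nlinarith
  have hgood := fun ε => hball (hτr ε)
  choose D hD using fun ε => (hgood ε).1
  have hsm : ∀ ε x, ContMDiffAt (𝓘(ℝ, ℝ).prod 𝓘(ℝ, E3)) 𝓘(ℝ, F) ∞
      (fun p : ℝ × X => d p.1 p.2) (τ ε, x) := fun ε x => hds _ x ((hgood ε).2.1 x)
  have hτs : ContDiff ℝ ∞ τ := contDiff_const.mul Real.contDiff_sin
  refine ⟨r / 2, half_pos hr, fun ε =>
    { sec := d (τ ε)
      l := D ε
      contMDiff_sec := fun x => ContMDiffAt.comp (I' := 𝓘(ℝ, ℝ).prod 𝓘(ℝ, E3))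
        (g := fun p : ℝ × X => d p.1 p.2) (f := fun z : X => (τ ε, z)) x (hsm ε x)
        (contMDiffAt_const.prodMk contMDiffAt_id)
      src_sec := fun x => hdsrc _ x ((hgood ε).2.1 x)
      tgt_sec := fun x => (hD ε x).symm }, fun ε x => ?_, ⟨fun p => ?_, fun x => ?_, fun ε x hx => ?_⟩,
    fun ε x hx => hdO _ x hx⟩
  · change (σ.sec (D ε x), d (τ ε) x) ∈ 𝒢.composable
    rw [hD]
    by_cases hx : x ∈ C
    · exact (hgood ε).2.2 x hx
    · rw [hdoff _ x hx, 𝒢.tgt_unit]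
      exact hunit x
  · exact ContMDiffAt.comp (I' := 𝓘(ℝ, ℝ).prod 𝓘(ℝ, E3))
      (g := fun p : ℝ × X => d p.1 p.2) (f := fun p : ℝ × X => (τ p.1, p.2)) p (hsm p.1 p.2)
      ((hτs.contMDiff.comp contMDiff_fst).prodMk contMDiff_snd).contMDiffAt
  · change d (τ 0) x = 𝒢.unit x
    rw [show τ 0 = 0 by simp [hτ], hd0]
  · exact hdoff _ x hx

/-- The velocity of the right translates of a bisection. -/
theorem familyVelocity_mul {𝒢 : LocalLieGroupoid X F G} (σ : Bisection 𝒢) {ψ : ℝ → X → G} {x : X}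
    (hψ : MDifferentiableAt 𝓘(ℝ, ℝ) 𝓘(ℝ, F) (fun t => ψ t x) 0) (hu : ψ 0 x = 𝒢.unit x)
    {r χ : ℝ} {δ : ℝ → Bisection 𝒢} (hc : ∀ ε, σ.Composable (δ ε))
    (hδ : ∀ ε, (δ ε).sec x = ψ (r * Real.sin ε * χ) x) :
    familyVelocity F (fun ε => (σ.mul (δ ε) (hc ε)).sec) x =
      (r * χ) • 𝒢.Tm (σ.sec x) (𝒢.unit x)
        (tder E3 F σ.sec x (𝒢.Tt (𝒢.unit x) (tder ℝ F (fun t => ψ t x) 0 1)),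
          tder ℝ F (fun t => ψ t x) 0 1) := by
  have hs : HasDerivAt (fun ε : ℝ => r * Real.sin ε * χ) (r * χ) 0 := by
    have h := ((Real.hasDerivAt_sin 0).const_mul r).mul_const χ
    simpa using h
  have hs0 : r * Real.sin 0 * χ = 0 := by simp
  have hψ' : MDifferentiableAt 𝓘(ℝ, ℝ) 𝓘(ℝ, F) (fun t => ψ t x) (r * Real.sin 0 * χ) := by
    rw [hs0]; exact hψ
  set g : ℝ → G := fun ε => ψ (r * Real.sin ε * χ) x with hg
  have hg0 : g 0 = 𝒢.unit x := by rw [hg]; simp only [hs0, hu]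
  have hgm : MDifferentiableAt 𝓘(ℝ, ℝ) 𝓘(ℝ, F) g 0 :=
    hψ'.comp 0 hs.differentiableAt.mdifferentiableAt
  have hgd : tder ℝ F g 0 1 = (r * χ) • tder ℝ F (fun t => ψ t x) 0 1 := by
    have h := tder_comp (E' := ℝ) (g := fun t => ψ t x) (f := fun ε : ℝ => r * Real.sin ε * χ) 0 hψ'
      hs.differentiableAt.mdifferentiableAt
    have h1 := congrArg (fun L => L 1) h
    simp only [ContinuousLinearMap.comp_apply, tder_eq_fderiv, hs.hasFDerivAt.fderiv, hs0] at h1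
    refine h1.trans ?_
    rw [← map_smul]
    simp
  have htm : MDifferentiableAt 𝓘(ℝ, ℝ) 𝓘(ℝ, E3) (𝒢.tgt ∘ g) 0 :=
    (LocalLieGroupoid.mdifferentiableAt_tgt _).comp 0 hgm
  have hfm : MDifferentiableAt 𝓘(ℝ, ℝ) 𝓘(ℝ, F) (σ.sec ∘ 𝒢.tgt ∘ g) 0 :=
    (σ.mdifferentiableAt_sec _).comp 0 htm
  -- With `l` written as the target of the section, the product depends on `ε` through the single
  -- curve `g`, and the product rule for `Tm` applies.
  have heq : ∀ ε, (σ.mul (δ ε) (hc ε)).sec x = 𝒢.mul ((σ.sec ∘ 𝒢.tgt ∘ g) ε) (g ε) := by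
    intro ε
    change 𝒢.mul (σ.sec ((δ ε).l x)) ((δ ε).sec x) = _
    rw [← (δ ε).tgt_sec, hδ]
    rfl
  have hcm : ∀ ε, ((σ.sec ∘ 𝒢.tgt ∘ g) ε, g ε) ∈ 𝒢.composable := by
    intro ε
    have h := hc ε x
    rw [← (δ ε).tgt_sec, hδ] at h
    exact h
  rw [familyVelocity]
  simp only [heq]
  rw [LocalLieGroupoid.tder_mul hfm hgm (Filter.Eventually.of_forall hcm),
    tder_comp (E' := E3) 0 (σ.mdifferentiableAt_sec _) htm,
    tder_comp (E' := F) 0 (LocalLieGroupoid.mdifferentiableAt_tgt _) hgm]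
  simp only [Function.comp_apply, ContinuousLinearMap.comp_apply, hgd, hg0, 𝒢.tgt_unit, map_smul]
  rw [← Prod.smul_mk, map_smul]
  rfl

end Variations

/-! ### Stationarity under right variations forces vanishing field strength -/

namespace LocalSymplecticGroupoid

variable {X : Type*} [TopologicalSpace X] [ChartedSpace E3 X] [IsManifold 𝓘(ℝ, E3) ∞ X]
variable {F : Type*} [NormedAddCommGroup F] [NormedSpace ℝ F] [FiniteDimensional ℝ F]
variable {G : Type*} [TopologicalSpace G] [ChartedSpace F G] [IsManifold 𝓘(ℝ, F) ∞ G]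
variable {Θ : PoissonStructure X} {𝒢 : LocalSymplecticGroupoid (F := F) (G := G) Θ}
variable {ϑ : Form F G 1} [T2Space X] [SigmaCompactSpace X] [OrientedAtlas X]

/-- The fundamental lemma of the calculus of variations: at a point with $F\neq0$ a right variation
is chosen whose contraction wedges positively with $F$, and it is localised where positivity
persists. -/
theorem fieldStrength_eq_zero_of_isCriticalRight (hϑ : IsSmoothForm ϑ) (hω : extd ϑ = 𝒢.symp)
    {σ : 𝒢.Bisec} (h : IsCriticalRight 𝒢 ϑ σ) : fieldStrength 𝒢 σ = 0 := by
  by_contra hne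
  obtain ⟨x₀, hx₀⟩ : ∃ x, (fieldStrength 𝒢 σ).at x ≠ 0 := by
    by_contra! h0
    exact hne (Form.ext_at h0)
  obtain ⟨a, ha⟩ := exists_wedgeAlt_pos hx₀
  obtain ⟨W, hW, hWa⟩ := 𝒢.exists_right_translation σ x₀ a.toLinearMap
  have : CompleteSpace F := FiniteDimensional.complete ℝ F
  obtain ⟨ψ, O, hO, h0O, hψ, hu, hsrc, hd⟩ := exists_fiber_deformation 𝒢.contMDiff_src
    𝒢.contMDiff_unit x₀ (𝒢.Ts_surjective _) hW
  have hsrc' : ∀ p ∈ O, 𝒢.src (ψ p.1 p.2) = p.2 := fun p hp => by rw [hsrc p hp, 𝒢.src_unit]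
  have hψd : ∀ x, ((0 : ℝ), x) ∈ O → MDifferentiableAt 𝓘(ℝ, ℝ) 𝓘(ℝ, F) (fun t => ψ t x) 0 := by
    intro x hx
    have h1 : ContMDiffAt 𝓘(ℝ, ℝ) 𝓘(ℝ, F) ∞ (fun t => ψ t x) 0 :=
      ContMDiffAt.comp (g := fun p : ℝ × X => ψ p.1 p.2) (0 : ℝ) (hψ.contMDiffAt (hO.mem_nhds hx))
        (contMDiff_id.prodMk contMDiff_const).contMDiffAt
    exact h1.mdifferentiableAt (by simp)
  set Z : X → F := fun x => 𝒢.Tm (σ.sec x) (𝒢.unit x)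
    (tder E3 F σ.sec x (𝒢.Tt (𝒢.unit x) (tder ℝ F (fun t => ψ t x) 0 1)),
      tder ℝ F (fun t => ψ t x) 0 1) with hZ
  -- Over `O` the contraction is `r * χ` times a 1-form built from `Z`, which does not involve `χ`;
  -- only the positive constant `r` and the cut-off change with the bump function.
  have hvar : ∀ χ : SmoothBumpFunction 𝓘(ℝ, E3) x₀, (∀ x ∈ tsupport χ, ((0 : ℝ), x) ∈ O) →
      ∃ (r : ℝ) (κ : Form E3 X 1), 0 < r ∧ IsSmoothForm κ ∧
        (∀ x, ((0 : ℝ), x) ∈ O → ∀ v, κ.at x v =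
          r * χ x * 𝒢.pairing (σ.sec x) (Z x) (tder E3 F σ.sec x (v 0))) ∧
        formIntegral (tsupport χ) (wedge κ (fieldStrength 𝒢 σ)) = 0 := by
    intro χ hχ
    obtain ⟨r, hr, δ, hc, hδ, hδψ⟩ := exists_bisection_family σ hO hψ hu hsrc' χ hχ
    have hv := σ.isVariation_mul hδ hc
    refine ⟨r, contraction (fun ε => (σ.mul (δ ε) (hc ε)).sec) 𝒢.symp, hr, ?_, ?_, ?_⟩
    · rw [← hω]
      exact isSmoothForm_contraction hv.smooth hϑ
    · intro x hx v
      have h1 : (σ.mul (δ 0) (hc 0)).sec = σ.sec := funext hv.zero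
      rw [contraction_at_apply, familyVelocity_mul σ (hψd x hx) (hu _ hx) hc
        (fun ε => hδψ ε x hx), h1, ← pairing_apply, map_smul, LinearMap.smul_apply, smul_eq_mul]
    · have h1 := (hasDerivAt_action hϑ hω χ.hasCompactSupport hv).unique
        (h _ δ χ.hasCompactSupport hδ hc)
      linarith
  have hON : ∀ᶠ x in 𝓝 x₀, ((0 : ℝ), x) ∈ O :=
    (Continuous.prodMk_right (0 : ℝ)).continuousAt.eventually (hO.mem_nhds h0O)
  -- The first bump function serves to produce a smooth form `κ`, equal to `r₁` times the form built
  -- from `Z` wherever `χ₁ = 1`. Its smoothness spreads positivity from `x₀` to a neighbourhood.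
  obtain ⟨χ₁, -, hχ₁⟩ := (SmoothBumpFunction.nhds_basis_tsupport (I := 𝓘(ℝ, E3)) x₀).mem_iff.1 hON
  obtain ⟨r₁, κ, hr₁, hκs, hκ, -⟩ := hvar χ₁ hχ₁
  have hsF := isSmoothForm_fieldStrength σ
  set e : Fin 3 → E3 := fun i => EuclideanSpace.single i (1 : ℝ) with he
  set η : Form E3 X 3 := wedge κ (fieldStrength 𝒢 σ) with hη
  have hηs : IsSmoothForm η := hκs.wedge hsF
  have hη0 : 0 < η.at x₀ e := by
    have h1 : κ.at x₀ = r₁ • ContinuousAlternatingMap.ofSubsingleton ℝ E3 ℝ (0 : Fin 1) a := by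
      ext v
      rw [hκ x₀ h0O, χ₁.eq_one, mul_one, hZ]
      simp only [hd]
      rw [hWa]
      rfl
    rw [hη, wedge_at, h1, ← wedgeCLM_apply, map_smul]
    exact mul_pos hr₁ ha
  have hηpos : ∀ᶠ x in 𝓝 x₀, 0 < η.at x e := by
    have hxs := mem_extChartAt_source (I := 𝓘(ℝ, E3)) x₀
    have hc : ContinuousAt (fun x => chartRep x₀ η (extChartAt 𝓘(ℝ, E3) x₀ x) e) x₀ :=
      ContinuousAt.comp (g := fun y => chartRep x₀ η y e)
        ((ContinuousAlternatingMap.apply ℝ E3 ℝ e).continuous.continuousAt.comp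
          (hηs.contDiffAt (mem_extChartAt_target x₀)).continuousAt)
        (continuousAt_extChartAt x₀)
    have h1 := hc.eventually (p := fun t => 0 < t) (by
      simp only [chartRep_self]
      exact Ioi_mem_nhds hη0)
    filter_upwards [h1, (isOpen_extChartAt_source x₀).mem_nhds hxs] with x hx hxs
    rw [chartRep_apply_basis, (extChartAt 𝓘(ℝ, E3) x₀).left_inv hxs] at hx
    exact (mul_pos_iff_of_pos_left
      (det_tder_chart_symm_pos ((extChartAt 𝓘(ℝ, E3) x₀).map_source hxs))).1 hx
  -- The second bump function is supported where `χ₁ = 1` and `η` is positive. There `κ₂ = (r₂ / r₁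
  -- * χ₂) • κ`, so its first variation, which vanishes by stationarity, is also the integral of a
  -- nonnegative form that is positive at `x₀`.
  obtain ⟨χ₂, -, hχ₂⟩ := (SmoothBumpFunction.nhds_basis_tsupport (I := 𝓘(ℝ, E3)) x₀).mem_iff.1
    (hON.and (χ₁.eventuallyEq_one.and hηpos))
  obtain ⟨r₂, κ₂, hr₂, -, hκ₂, hint⟩ := hvar χ₂ fun x hx => (hχ₂ hx).1
  have hχ₂s : ContMDiff 𝓘(ℝ, E3) 𝓘(ℝ, ℝ) ∞ (fun x => r₂ / r₁ * χ₂ x) :=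
    contMDiff_const.mul χ₂.contMDiff
  have hpos := formIntegral_pos (hηs.smul_fun hχ₂s) (K := tsupport χ₂) χ₂.hasCompactSupport
    (fun x => by
      rw [smul_fun_at]
      by_cases hx : x ∈ tsupport χ₂
      · exact mul_nonneg (mul_nonneg (div_pos hr₂ hr₁).le χ₂.nonneg) (hχ₂ hx).2.2.le
      · rw [image_eq_zero_of_notMem_tsupport hx, mul_zero, zero_smul]
        rfl) χ₂.tsupport_mem_nhds (by
      rw [smul_fun_at, χ₂.eq_one, mul_one]
      exact mul_pos (div_pos hr₂ hr₁) hη0)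
  rw [formIntegral_congr (isClosed_tsupport _) (η' := wedge κ₂ (fieldStrength 𝒢 σ)), hint] at hpos
  · exact lt_irrefl 0 hpos
  · intro x hx
    have hxO := (hχ₂ hx).1
    have hx1 : χ₁ x = 1 := (hχ₂ hx).2.1
    have h1 : κ₂.at x = (r₂ / r₁ * χ₂ x) • κ.at x := by
      ext v
      rw [ContinuousAlternatingMap.smul_apply, hκ₂ x hxO, hκ x hxO, hx1, smul_eq_mul]
      field_simp
    rw [smul_fun_at, hη, wedge_at, wedge_at, h1, ← wedgeCLM_apply, ← wedgeCLM_apply, map_smul]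
    rfl

end LocalSymplecticGroupoid

end PoissonCS

/-! ### The main theorem -/

theorem mainTheorem7
    {X : Type*} [TopologicalSpace X] [ChartedSpace E3 X] [IsManifold 𝓘(ℝ, E3) ∞ X]
    [T2Space X] [SigmaCompactSpace X] [OrientedAtlas X]
    {F : Type*} [NormedAddCommGroup F] [NormedSpace ℝ F] [FiniteDimensional ℝ F]
    {G : Type*} [TopologicalSpace G] [ChartedSpace F G] [IsManifold 𝓘(ℝ, F) ∞ G] [T2Space G]
    (Θ : PoissonStructure X) (𝒢 : LocalSymplecticGroupoid (F := F) (G := G) Θ)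
    (ϑ : Form F G 1) (hϑ : IsSmoothForm ϑ) (hω : extd ϑ = 𝒢.symp) :
    (∀ σ : 𝒢.Bisec,
      List.TFAE [IsCritical 𝒢 ϑ σ, IsCriticalRight 𝒢 ϑ σ, fieldStrength 𝒢 σ = 0, IsLagrangian 𝒢 σ]) ∧
    (∀ (σ Λ : 𝒢.Bisec) (h : σ.Composable Λ), IsLagrangian 𝒢 Λ →
      fieldStrength 𝒢 (σ.mul Λ h) = pullback Λ.l (fieldStrength 𝒢 σ) ∧
      extd (potential 𝒢 ϑ (σ.mul Λ h) - pullback Λ.l (potential 𝒢 ϑ σ)) = 0 ∧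
      (OrientationPreserving Λ.l →
        (∀ K : Set X, IsCompact K →
          action 𝒢 ϑ K (σ.mul Λ h) = action 𝒢 ϑ (Λ.l '' K) σ +
            formIntegral K (extd (wedge (pullback Λ.l (potential 𝒢 ϑ σ))
              (potential 𝒢 ϑ (σ.mul Λ h))))) ∧
        (∀ K : Set X, IsCompact K → (∀ x ∉ K, Λ.sec x = 𝒢.unit x) →
          action 𝒢 ϑ K (σ.mul Λ h) = action 𝒢 ϑ K σ))) := by
  refine ⟨fun σ => ?_, fun σ Λ h hΛ => ?_⟩
  · tfae_have 3 → 1 := LocalSymplecticGroupoid.isCritical_of_fieldStrength_eq_zero hϑ hω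
    tfae_have 1 → 2 := LocalSymplecticGroupoid.isCriticalRight_of_isCritical
    tfae_have 2 → 3 := LocalSymplecticGroupoid.fieldStrength_eq_zero_of_isCriticalRight hϑ hω
    tfae_have 4 ↔ 3 := 𝒢.isLagrangian_iff σ
    tfae_finish
  · exact ⟨𝒢.fieldStrength_mul σ Λ h hΛ,
      LocalSymplecticGroupoid.extd_potential_mul_sub hϑ hω σ Λ h hΛ, fun ho =>
      ⟨fun K hK => LocalSymplecticGroupoid.action_mul hϑ hω σ Λ h hΛ ho hK,
        fun K hK hoff => LocalSymplecticGroupoid.action_mul_of_eq_unit hϑ hω σ Λ h hΛ ho hK hoff⟩⟩
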